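/- Proposition 5.5. Let $T\in(0,\infty)$, $d\in\mathbb N$, $p\in(1,+\infty]$, and let $(\Omega,\mathcal F,(\mathcal F_t)_{t\in[0,T]},P)$ be a filtered probability space satisfying the usual conditions. Processes are identified when they are stochastically equivalent ($X_t=X'_t$ a.s. for every $t\in[0,T]$), and equalities and inequalities between random variables hold almost surely. For a random variable $Z\ge 0$ put $|||Z|||_p:=E[Z^p\mid\mathcal F_0]^{1/p}$ if $p<\infty$, where the conditional expectation may take the value $+\infty$, and let $|||Z|||_\infty$ be the (almost surely) smallest $\mathcal F_0$-measurable $[0,+\infty]$-valued random variable dominating $Z$. For a random vector $V$ let $|||V|||_p:=|||\,|V|\,|||_p$, where $|\cdot|$ is the Euclidean norm, and for a process $X$ let $|||X|||_{p,[0,t]}:=|||\sup_{0\le s\le t}|X_s|\,|||_p$ and $|||X|||_p:=|||X|||_{p,[0,T]}$. Let - $L^p_{\mathcal F_0}(\mathcal F_T,\mathbb R^d):=\{a\cdot x: a \text{ a real-valued } \mathcal F_0\text{-measurable random variable},\ x\in L^p(\mathcal F_T,\mathbb R^d)\}$; - $S^p_{\mathcal F_0}$ be the set of $\mathbb R^d$-valued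 adapted processes $Y$ with right continuous paths with left limits such that $|||Y|||_p<+\infty$ a.s.; - $M^p_{\mathcal F_0,0}$ be the set of those $M\in S^p_{\mathcal F_0}$ with $M_0=0$ that are generalized martingales: for all $0\le s<t\le T$ there are events $A_1\subset A_2\subset\cdots$ in $\mathcal F_s$ with $\bigcup_n A_n=\Omega$ such that $M_t$ is integrable on each $A_n$, and $E[M_t 1_A]=E[M_s 1_A]$ for every $A\in\mathcal F_s$ on which $M_t$ is integrable. Let $c_2=\frac15$, $c_\infty=\frac14$ and $c_p=\frac{p-1}{4p-1}$ for $p\in(1,\infty)\setminus\{2\}$. Let $\xi\in L^p_{\mathcal F_0}(\mathcal F_T,\mathbb R^d)$, and let $f:[0,T]\times\Omega\times S^p_{\mathcal F_0}\times M^p_{\mathcal F_0,0}\to\mathbb R^d$ satisfy the following two conditions. (i) For all $(Y,M)\in S^p_{\mathcal F_0}\times M^p_{\mathcal F_0,0}$ the process $f(\cdot,Y,M)$ is progressively measurable, and $|||\int_0^T|f(t,0,0)|\,dt\,|||_p<+\infty$ a.s. (ii) There are $\mathcal F_0$-measurable real-valued random variables $C_1>0$ and $C_2\ge0$ with $C_2<\dfrac{c_pC_1}{e^{C_1T}-1}$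 such that, for all $t\in[0,T]$ and all $(Y,M),(Y',M')\in S^p_{\mathcal F_0}\times M^p_{\mathcal F_0,0}$, $$|||f(t,Y,M)-f(t,Y',M')|||_p\le C_1\,|||Y-Y_0+M-(Y'-Y'_0+M')|||_{p,[0,t]}+C_2\big(|Y_0-Y'_0|+|||M-M'|||_p\big).$$ Then there is exactly one pair $(Y,M)\in S^p_{\mathcal F_0}\times M^p_{\mathcal F_0,0}$ such that $\int_0^T|f(s,Y,M)|\,ds<\infty$ a.s. and, for every $t\in[0,T]$, $$Y_t=\xi+\int_t^T f(s,Y,M)\,ds+M_T-M_t\quad\text{a.s.}$$ -/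

import Mathlib

open MeasureTheory ProbabilityTheory Filter Topology Set
open scoped ENNReal

namespace CondBSDE

/-- The time interval `[0, T]`. -/
abbrev Time (T : ℝ) : Type := Set.Icc (0 : ℝ) T

/-- Lebesgue measure on `[0, T]`. -/
noncomputable def timeVol (T : ℝ) : Measure (Time T) := Measure.comap Subtype.val volume

/-- The initial time `0`. -/
def tInit {T : ℝ} (hT : 0 < T) : Time T := ⟨0, le_rfl, hT.le⟩

/-- The terminal time `T`. -/
def tEnd {T : ℝ} (hT : 0 < T) : Time T := ⟨T, hT.le, le_rfl⟩

/-- The state space `ℝ^d` with its Euclidean norm. -/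
abbrev Vec (d : ℕ) : Type := EuclideanSpace ℝ (Fin d)

/-- The usual conditions: the filtration is right continuous and its initial sigma-algebra contains
every null set (a null set being a set of outer measure zero, so the probability space is
complete as well). -/
structure UsualConditions {Ω : Type*} [mΩ : MeasurableSpace Ω] {T : ℝ} (hT : 0 < T)
    (F : Filtration (Time T) mΩ) (P : Measure Ω) : Prop where
  rightCont : F.IsRightContinuous
  complete : ∀ s : Set Ω, P s = 0 → MeasurableSet[F (tInit hT)] s

/-! ### Conditional norms -/

/-- `η` is the smallest `m`-measurable `[0, ∞]`-valued random variable dominating `Z` almost surely,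
that is `η = ⋀ {η' ∈ L̄⁰₊(m) | Z ≤ η'}`. -/
structure IsCondEssSup {Ω : Type*} (m : MeasurableSpace Ω) [MeasurableSpace Ω] (P : Measure Ω)
    (Z η : Ω → ℝ≥0∞) : Prop where
  measurable : Measurable[m] η
  le : Z ≤ᵐ[P] η
  least : ∀ η' : Ω → ℝ≥0∞, Measurable[m] η' → Z ≤ᵐ[P] η' → η ≤ᵐ[P] η'

theorem exists_isCondEssSup {Ω : Type*} {m : MeasurableSpace Ω} [mΩ : MeasurableSpace Ω]
    (hm : m ≤ mΩ) (P : Measure Ω) [IsFiniteMeasure P] (Z : Ω → ℝ≥0∞) :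
    ∃ η, IsCondEssSup m P Z η := by
  let A : Set (Ω → ℝ≥0∞) := {η | Measurable[m] η ∧ Z ≤ᵐ[P] η}
  let I : (Ω → ℝ≥0∞) → ℝ≥0∞ := fun η => ∫⁻ ω, (1 + η ω)⁻¹ ∂P
  have hA : A.Nonempty := ⟨fun _ => ⊤, measurable_const, ae_of_all _ fun _ => le_top⟩
  obtain ⟨u, -, hu, huA⟩ := exists_seq_tendsto_sSup (hA.image I) (OrderTop.bddAbove _)
  choose v hvA hvu using huA
  have hB : (fun ω => ⨅ n, v n ω) ∈ A := by
    refine ⟨Measurable.iInf fun n => (hvA n).1, ?_⟩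
    filter_upwards [ae_all_iff.2 fun n => (hvA n).2] with ω h using le_iInf h
  set w : Ω → ℝ≥0∞ := fun ω => ⨅ n, v n ω with hw
  have hwI : sSup (I '' A) ≤ I w := by
    refine le_of_tendsto' hu fun n => ?_
    rw [← hvu n]
    refine lintegral_mono fun ω => ?_
    gcongr
    exact iInf_le _ n
  refine ⟨w, hB.1, hB.2, fun η' h1 h2 => ?_⟩
  have hmin : (fun ω => min (w ω) (η' ω)) ∈ A := by
    refine ⟨hB.1.min h1, ?_⟩
    filter_upwards [hB.2, h2] with ω a b using le_min a b
  have key : (fun ω => (1 + w ω)⁻¹) =ᵐ[P] fun ω => (1 + min (w ω) (η' ω))⁻¹ := by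
    refine ae_eq_of_ae_le_of_lintegral_le (ae_of_all _ fun ω => ?_) ?_ ?_ ?_
    · dsimp only
      gcongr
      exact min_le_left _ _
    · refine ne_top_of_le_ne_top (measure_ne_top P univ) ?_
      calc ∫⁻ ω, (1 + w ω)⁻¹ ∂P ≤ ∫⁻ _, 1 ∂P := by
            refine lintegral_mono fun ω => ?_
            simp
        _ = P univ := by simp
    · have h4 : Measurable[mΩ] fun ω => min (w ω) (η' ω) := hmin.1.mono hm le_rfl
      exact ((h4.const_add 1).inv).aemeasurable
    · exact (le_sSup (mem_image_of_mem I hmin)).trans hwI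
  filter_upwards [key] with ω h
  have h3 := (ENNReal.add_right_inj ENNReal.one_ne_top).1 (inv_inj.1 h)
  rw [h3]
  exact min_le_right _ _

open Classical in
/-- The conditional essential supremum `⋀ {η ∈ L̄⁰₊(m) | Z ≤ η}` of a `[0, ∞]`-valued random
variable (a version of it; it exists as soon as `m` is a sub-sigma-algebra and `P` is finite). -/
noncomputable def condEssSup {Ω : Type*} (m : MeasurableSpace Ω) [MeasurableSpace Ω]
    (P : Measure Ω) (Z : Ω → ℝ≥0∞) : Ω → ℝ≥0∞ :=
  if h : ∃ η, IsCondEssSup m P Z η then h.choose else fun _ => ⊤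

theorem isCondEssSup_condEssSup {Ω : Type*} {m : MeasurableSpace Ω} [mΩ : MeasurableSpace Ω]
    (hm : m ≤ mΩ) (P : Measure Ω) [IsFiniteMeasure P] (Z : Ω → ℝ≥0∞) :
    IsCondEssSup m P Z (condEssSup m P Z) := by
  have h := exists_isCondEssSup hm P Z
  rw [condEssSup, dif_pos h]
  exact h.choose_spec

/-- The conditional `p`-norm given `m` of a `[0, ∞]`-valued random variable `Z`:
`E[Z ^ p | m] ^ (1 / p)` for `p < ∞`, and the conditional essential supremum for `p = ∞`. The
conditional expectation is that of `[0, ∞]`-valued variables and may take the value `∞`. -/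
noncomputable def condNorm {Ω : Type*} (m : MeasurableSpace Ω) [MeasurableSpace Ω]
    (P : Measure Ω) (p : ℝ≥0∞) (Z : Ω → ℝ≥0∞) : Ω → ℝ≥0∞ :=
  if p = ∞ then condEssSup m P Z
  else fun ω => (condLExp m P (fun ω' => Z ω' ^ p.toReal) ω) ^ (1 / p.toReal)

/-- `sup_{0 ≤ s ≤ t} |X_s|`. -/
noncomputable def supNorm {Ω : Type*} {T : ℝ} {d : ℕ} (X : Time T → Ω → Vec d) (t : Time T) :
    Ω → ℝ≥0∞ :=
  fun ω => ⨆ s : Time T, ⨆ _ : s ≤ t, ‖X s ω‖ₑ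

/-- `|||X|||_{p,[0,t]}`, the conditional `p`-norm of `sup_{0 ≤ s ≤ t} |X_s|` given `F_0`. For
`t = T` this is `|||X|||_p`. -/
noncomputable def condSupNorm {Ω : Type*} [mΩ : MeasurableSpace Ω] {T : ℝ} (hT : 0 < T)
    (F : Filtration (Time T) mΩ) (P : Measure Ω) (p : ℝ≥0∞) {d : ℕ}
    (X : Time T → Ω → Vec d) (t : Time T) : Ω → ℝ≥0∞ :=
  condNorm (F (tInit hT)) P p (supNorm X t)

/-! ### Conditional integrability and generalized martingales -/

/-- `X` is conditionally integrable with respect to `m`: it is integrable on each member of some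
nondecreasing sequence of events of `m` that exhausts the whole space. -/
def CondIntegrable {Ω : Type*} (m : MeasurableSpace Ω) [MeasurableSpace Ω] (P : Measure Ω)
    {d : ℕ} (X : Ω → Vec d) : Prop :=
  ∃ A : ℕ → Set Ω, Monotone A ∧ (∀ n, MeasurableSet[m] (A n)) ∧ (⋃ n, A n) = univ ∧
    ∀ n, IntegrableOn X (A n) P

/-- `Y` is (a version of) the generalized conditional expectation `E[X | m]`. -/
structure IsGenCondExp {Ω : Type*} (m : MeasurableSpace Ω) [MeasurableSpace Ω] (P : Measure Ω)
    {d : ℕ} (X Y : Ω → Vec d) : Prop where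
  condIntegrable : CondIntegrable m P X
  measurable : Measurable[m] Y
  integral_eq : ∀ A : Set Ω, MeasurableSet[m] A → IntegrableOn X A P →
    IntegrableOn Y A P ∧ ∫ ω in A, Y ω ∂P = ∫ ω in A, X ω ∂P

/-- Generalized martingales. -/
structure IsGenMartingale {Ω : Type*} [mΩ : MeasurableSpace Ω] {T : ℝ}
    (F : Filtration (Time T) mΩ) (P : Measure Ω) {d : ℕ} (X : Time T → Ω → Vec d) : Prop where
  adapted : Adapted F X
  condExp_eq : ∀ s t : Time T, s < t → IsGenCondExp (F s) P (X t) (X s)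

/-! ### The spaces of random vectors and processes -/

/-- The module `L^p_{F_0}(F_T, ℝ^d) = L^0(F_0) · L^p(F_T, ℝ^d)`. -/
def MemLpCond {Ω : Type*} [mΩ : MeasurableSpace Ω] {T : ℝ} (hT : 0 < T)
    (F : Filtration (Time T) mΩ) (P : Measure Ω) (p : ℝ≥0∞) {d : ℕ} (ξ : Ω → Vec d) : Prop :=
  ∃ (a : Ω → ℝ) (x : Ω → Vec d), Measurable[F (tInit hT)] a ∧ Measurable[F (tEnd hT)] x ∧
    MemLp x p P ∧ ξ =ᵐ[P] fun ω => a ω • x ω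

/-- All paths are right continuous with left limits. -/
def IsRCLL {Ω : Type*} {T : ℝ} {d : ℕ} (X : Time T → Ω → Vec d) : Prop :=
  ∀ ω t, ContinuousWithinAt (fun s => X s ω) (Set.Ici t) t ∧
    ∃ l, Tendsto (fun s => X s ω) (𝓝[<] t) (𝓝 l)

/-- Membership in `S^p_{F_0}`: RCLL adapted processes whose conditional norm
`|||Y|||_p` is almost surely finite. -/
structure MemS {Ω : Type*} [mΩ : MeasurableSpace Ω] {T : ℝ} (hT : 0 < T)
    (F : Filtration (Time T) mΩ) (P : Measure Ω) (p : ℝ≥0∞) {d : ℕ}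
    (Y : Time T → Ω → Vec d) : Prop where
  rcll : IsRCLL Y
  adapted : Adapted F Y
  norm_lt_top : ∀ᵐ ω ∂P, condSupNorm hT F P p Y (tEnd hT) ω < ∞

/-- Membership in `M^p_{F_0,0}`: generalized martingales in `S^p_{F_0}` that vanish at
time `0`. -/
structure MemM0 {Ω : Type*} [mΩ : MeasurableSpace Ω] {T : ℝ} (hT : 0 < T)
    (F : Filtration (Time T) mΩ) (P : Measure Ω) (p : ℝ≥0∞) {d : ℕ}
    (M : Time T → Ω → Vec d) : Prop where
  memS : MemS hT F P p M
  martingale : IsGenMartingale F P M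
  init : M (tInit hT) =ᵐ[P] 0

/-- The processes representing the elements of `S^p_{F_0}`. -/
abbrev SpaceS {Ω : Type*} [mΩ : MeasurableSpace Ω] {T : ℝ} (hT : 0 < T)
    (F : Filtration (Time T) mΩ) (P : Measure Ω) (p : ℝ≥0∞) (d : ℕ) :=
  {Y : Time T → Ω → Vec d // MemS hT F P p Y}

/-- The processes representing the elements of `M^p_{F_0,0}`. -/
abbrev SpaceM0 {Ω : Type*} [mΩ : MeasurableSpace Ω] {T : ℝ} (hT : 0 < T)
    (F : Filtration (Time T) mΩ) (P : Measure Ω) (p : ℝ≥0∞) (d : ℕ) :=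
  {M : Time T → Ω → Vec d // MemM0 hT F P p M}

/-- Stochastic equivalence of processes: `X_t = X'_t` almost surely, for every `t`. -/
def StochEquiv {Ω : Type*} [MeasurableSpace Ω] {T : ℝ} (P : Measure Ω) {d : ℕ}
    (X X' : Time T → Ω → Vec d) : Prop :=
  ∀ t, X t =ᵐ[P] X' t

theorem condNorm_zero {Ω : Type*} {m : MeasurableSpace Ω} [mΩ : MeasurableSpace Ω]
    (hm : m ≤ mΩ) (P : Measure Ω) [IsFiniteMeasure P] {p : ℝ≥0∞} (hp : 1 < p) :
    condNorm m P p 0 =ᵐ[P] 0 := by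
  by_cases h : p = ∞
  · rw [condNorm, if_pos h]
    filter_upwards [(isCondEssSup_condEssSup hm P 0).least 0 (@measurable_const _ _ _ m 0)
      (ae_of_all _ fun _ => le_rfl)] with ω hω using le_antisymm hω bot_le
  · have hp0 : 0 < p.toReal := ENNReal.toReal_pos (by positivity) h
    rw [condNorm, if_neg h]
    have : (fun ω' : Ω => (0 : Ω → ℝ≥0∞) ω' ^ p.toReal) = 0 := by
      ext ω
      simp [hp0]
    rw [this, condLExp_zero]
    refine ae_of_all _ fun ω => ?_
    simp [hp0]

theorem memS_zero {Ω : Type*} [mΩ : MeasurableSpace Ω] {T : ℝ} (hT : 0 < T)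
    (F : Filtration (Time T) mΩ) (P : Measure Ω) [IsProbabilityMeasure P] {p : ℝ≥0∞}
    (hp : 1 < p) (d : ℕ) : MemS hT F P p (0 : Time T → Ω → Vec d) where
  rcll := fun _ _ => ⟨continuousWithinAt_const, 0, tendsto_const_nhds⟩
  adapted := fun _ => measurable_const
  norm_lt_top := by
    have : supNorm (0 : Time T → Ω → Vec d) (tEnd hT) = 0 := by
      ext ω
      simp [supNorm]
    rw [condSupNorm, this]
    filter_upwards [condNorm_zero (F.le (tInit hT)) P hp] with ω hω
    rw [hω]
    exact ENNReal.zero_lt_top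

theorem memM0_zero {Ω : Type*} [mΩ : MeasurableSpace Ω] {T : ℝ} (hT : 0 < T)
    (F : Filtration (Time T) mΩ) (P : Measure Ω) [IsProbabilityMeasure P] {p : ℝ≥0∞}
    (hp : 1 < p) (d : ℕ) : MemM0 hT F P p (0 : Time T → Ω → Vec d) where
  memS := memS_zero hT F P hp d
  martingale :=
    { adapted := fun _ => measurable_const
      condExp_eq := fun _ _ _ =>
        { condIntegrable := ⟨fun _ => univ, monotone_const, fun _ => MeasurableSet.univ,
            iUnion_const _, fun _ => integrableOn_zero⟩
          measurable := measurable_const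
          integral_eq := fun _ _ h => ⟨h, rfl⟩ } }
  init := EventuallyEq.rfl

/-! ### The equation -/

/-- A driver `f : [0,T] × Ω × S^p_{F_0} × M^p_{F_0,0} → ℝ^d`. It is evaluated on processes rather
than on equivalence classes of processes, which is more general. -/
abbrev Driver {Ω : Type*} [mΩ : MeasurableSpace Ω] {T : ℝ} (hT : 0 < T)
    (F : Filtration (Time T) mΩ) (P : Measure Ω) (p : ℝ≥0∞) (d : ℕ) :=
  Time T → Ω → SpaceS hT F P p d → SpaceM0 hT F P p d → Vec d

/-- The constants `c_2 = 1/5`, `c_∞ = 1/4` and `c_p = (p-1)/(4p-1)` for the other `p`. -/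
noncomputable def cConst (p : ℝ≥0∞) : ℝ :=
  if p = 2 then 1 / 5 else if p = ∞ then 1 / 4 else (p.toReal - 1) / (4 * p.toReal - 1)

/-- Conditions on the driver: measurability and conditional integrability at `(0, 0)`. -/
structure DriverRegular {Ω : Type*} [mΩ : MeasurableSpace Ω] {T : ℝ} (hT : 0 < T)
    (F : Filtration (Time T) mΩ) (P : Measure Ω) [IsProbabilityMeasure P] {p : ℝ≥0∞}
    (hp : 1 < p) {d : ℕ} (f : Driver hT F P p d) : Prop where
  progressive : ∀ Y M, IsProgressive F (fun t ω => f t ω Y M)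
  integrable_zero : ∀ᵐ ω ∂P, condNorm (F (tInit hT)) P p
    (fun ω' => ∫⁻ t : Time T,
      ‖f t ω' ⟨0, memS_zero hT F P hp d⟩ ⟨0, memM0_zero hT F P hp d⟩‖ₑ ∂timeVol T) ω < ∞

/-- The path-dependent `L^0`-Lipschitz condition with random constants `C₁` and `C₂`. -/
def DriverLipschitz {Ω : Type*} [mΩ : MeasurableSpace Ω] {T : ℝ} (hT : 0 < T)
    (F : Filtration (Time T) mΩ) (P : Measure Ω) {p : ℝ≥0∞} {d : ℕ}
    (f : Driver hT F P p d) (C₁ C₂ : Ω → ℝ) : Prop :=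
  ∀ (t : Time T) (Y Y' : SpaceS hT F P p d) (M M' : SpaceM0 hT F P p d), ∀ᵐ ω ∂P,
    condNorm (F (tInit hT)) P p (fun ω' => ‖f t ω' Y M - f t ω' Y' M'‖ₑ) ω ≤
      ENNReal.ofReal (C₁ ω) * condSupNorm hT F P p (fun s ω' =>
          (Y.1 s ω' - Y.1 (tInit hT) ω' + M.1 s ω') -
            (Y'.1 s ω' - Y'.1 (tInit hT) ω' + M'.1 s ω')) t ω +
      ENNReal.ofReal (C₂ ω) * (‖Y.1 (tInit hT) ω - Y'.1 (tInit hT) ω‖ₑ +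
        condSupNorm hT F P p (fun s ω' => M.1 s ω' - M'.1 s ω') (tEnd hT) ω)

/-- `(Y, M)` solves `Y_t = ξ + ∫_t^T f(s, Y, M) ds + M_T - M_t` for all `t` in `[0, T]`; the
integrals are required to exist almost surely. -/
structure IsSolution {Ω : Type*} [mΩ : MeasurableSpace Ω] {T : ℝ} (hT : 0 < T)
    (F : Filtration (Time T) mΩ) (P : Measure Ω) {p : ℝ≥0∞} {d : ℕ}
    (f : Driver hT F P p d) (ξ : Ω → Vec d)
    (Y : SpaceS hT F P p d) (M : SpaceM0 hT F P p d) : Prop where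
  integrable : ∀ᵐ ω ∂P, Integrable (fun s : Time T => f s ω Y M) (timeVol T)
  eq : ∀ t : Time T, ∀ᵐ ω ∂P,
    Y.1 t ω = ξ ω + (∫ s in Set.Ioi t, f s ω Y M ∂timeVol T) + M.1 (tEnd hT) ω - M.1 t ω

end CondBSDE

/-! The unknown is really the forward process `X = Y - Y_0 + M`. Comparing the equation at times `0`
and `t` shows that it is equivalent to `Y_T = ξ` together with `X_t = -∫_0^t f(s, Y, M) ds`.
Conversely `X` and `ξ` determine the pair: since `Y_0 - M_T = ξ - X_T`, conditioning gives `Y_0 =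
E[ξ - X_T | F_0]` and `M_t = Y_0 - E[ξ - X_T | F_t]`. So the problem is a fixed point problem for
`X`.

Let `δ` denote the difference of two pairs with the same terminal value, and `q` Doob's constant.
Then `δY_0 - δM` is a generalized martingale with terminal value `-δX_T` and initial value `δY_0`.
Jensen gives `|δY_0| ≤ |||δX_T|||_p`, and Doob gives `|||δM|||_p ≤ (1 + q) |||δX_T|||_p`. The sum
costs the factor `2 + q`, and `κ = c_p (2 + q) < 1` (`cConst_mul_lt_one`).

The Picard map is controlled with the weight `exp (C₁ t) - 1`. If `|||δX|||_{p,[0,t]} ≤ K (exp (C₁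
t) - 1)` for all `t`, then after one step the bound is at most `K (exp (C₁ t) - 1 - (1 - κ) C₁ t)`,
and convexity of `exp` bounds this by a factor below `1` times the old bound
(`setLIntegral_exp_le_factor_mul`). The factor is random and need not stay away from `1`, but it is
measurable for `F_0`; the geometric series converges for almost every `ω`
(`exists_geometric_bound`), which replaces Banach's theorem.

The analytic tools are conditional forms of Minkowski's integral inequality
(`condNorm_lintegral_le`) and of Doob's inequality (`condSupNorm_le_of_martingale`). Regular
versions of martingales come from upcrossings (`exists_rcll_condExp`). Generalized martingales are
reduced to martingales by dividing by a variable measurable for `F_0`. -/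

namespace CondBSDE

/-! ### Calculus of conditional norms -/

section CondNorm

variable {Ω : Type*} {m : MeasurableSpace Ω} [mΩ : MeasurableSpace Ω] {P : Measure Ω}
  {p : ℝ≥0∞} {Z Z' : Ω → ℝ≥0∞}

theorem toReal_pos_of_one_lt (hp : 1 < p) (hp' : p ≠ ∞) : 1 < p.toReal := by
  rw [← ENNReal.toReal_one]
  exact (ENNReal.toReal_lt_toReal ENNReal.one_ne_top hp').2 hp

/-- The measures with densities `u` and `v` are ordered once they are trimmed to `m`, and an
`m`-measurable weight only sees the trimmed measures. -/
theorem lintegral_mul_le_of_setLIntegral_le (hm : m ≤ mΩ) {u v b : Ω → ℝ≥0∞}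
    (hu : Measurable u) (hv : Measurable v) (hb : Measurable[m] b)
    (h : ∀ A, MeasurableSet[m] A → ∫⁻ ω in A, u ω ∂P ≤ ∫⁻ ω in A, v ω ∂P) :
    ∫⁻ ω, b ω * u ω ∂P ≤ ∫⁻ ω, b ω * v ω ∂P := by
  have key : ∀ w : Ω → ℝ≥0∞, Measurable w →
      ∫⁻ ω, b ω * w ω ∂P = ∫⁻ ω, b ω ∂((P.withDensity w).trim hm) := by
    intro w hw
    rw [lintegral_trim hm hb, lintegral_withDensity_eq_lintegral_mul _ hw (hb.mono hm le_rfl)]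
    simp only [Pi.mul_apply, mul_comm]
  rw [key u hu, key v hv]
  refine lintegral_mono' (Measure.le_iff.2 fun A hA => ?_) le_rfl
  rw [trim_measurableSet_eq hm hA, trim_measurableSet_eq hm hA, withDensity_apply _ (hm A hA),
    withDensity_apply _ (hm A hA)]
  exact h A hA

theorem ae_le_of_setLIntegral_le (hm : m ≤ mΩ) [IsFiniteMeasure P] {u v : Ω → ℝ≥0∞}
    (hu : Measurable[m] u) (hv : Measurable[m] v)
    (h : ∀ A, MeasurableSet[m] A → ∫⁻ ω in A, u ω ∂P ≤ ∫⁻ ω in A, v ω ∂P) : u ≤ᵐ[P] v := by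
  refine ae_le_of_ae_le_trim (hm := hm) ?_
  refine ae_le_of_forall_setLIntegral_le_of_sigmaFinite hu fun s hs _ => ?_
  rw [setLIntegral_trim hm hu hs, setLIntegral_trim hm hv hs]
  exact h s hs

theorem measurable_condNorm (hm : m ≤ mΩ) [IsFiniteMeasure P] :
    Measurable[m] (condNorm m P p Z) := by
  by_cases h : p = ∞
  · rw [condNorm, if_pos h]
    exact (isCondEssSup_condEssSup hm P Z).measurable
  · rw [condNorm, if_neg h]
    exact (measurable_condLExp m P _).pow_const _

theorem condNorm_top_le_iff (hm : m ≤ mΩ) [IsFiniteMeasure P] {η : Ω → ℝ≥0∞}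
    (hη : Measurable[m] η) : condNorm m P ∞ Z ≤ᵐ[P] η ↔ Z ≤ᵐ[P] η := by
  have h := isCondEssSup_condEssSup hm P Z
  rw [condNorm, if_pos rfl]
  exact ⟨fun h' => h.le.trans h', fun h' => h.least η hη h'⟩

/-- Turns a conditional bound into unconditional integrals over the sets of `m`, the form in which
Hölder, Minkowski and Doob are applied below. -/
theorem condNorm_le_iff (hm : m ≤ mΩ) [IsFiniteMeasure P] (hp : 1 < p) (hp' : p ≠ ∞)
    {η : Ω → ℝ≥0∞} (hη : Measurable[m] η) :
    condNorm m P p Z ≤ᵐ[P] η ↔ ∀ A, MeasurableSet[m] A →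
      ∫⁻ ω in A, Z ω ^ p.toReal ∂P ≤ ∫⁻ ω in A, η ω ^ p.toReal ∂P := by
  have hr : 0 < p.toReal := zero_lt_one.trans (toReal_pos_of_one_lt hp hp')
  have e : condNorm m P p Z ≤ᵐ[P] η ↔
      condLExp m P (fun ω' => Z ω' ^ p.toReal) ≤ᵐ[P] fun ω => η ω ^ p.toReal := by
    rw [condNorm, if_neg hp']
    refine eventually_congr (ae_of_all _ fun ω => ?_)
    exact by
      rw [one_div]
      exact ENNReal.rpow_inv_le_iff hr
  rw [e]
  constructor
  · intro h A hA
    rw [← setLIntegral_condLExp hm P _ hA]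
    exact lintegral_mono_ae (ae_restrict_of_ae h)
  · intro h
    refine ae_le_of_setLIntegral_le hm (measurable_condLExp m P _) (hη.pow_const _) fun A hA => ?_
    rw [setLIntegral_condLExp hm P _ hA]
    exact h A hA

theorem condNorm_mono (hm : m ≤ mΩ) [IsFiniteMeasure P] (hp : 1 < p) (h : Z ≤ᵐ[P] Z') :
    condNorm m P p Z ≤ᵐ[P] condNorm m P p Z' := by
  by_cases hp' : p = ∞
  · subst hp'
    rw [condNorm_top_le_iff hm (measurable_condNorm hm)]
    exact h.trans ((condNorm_top_le_iff hm (measurable_condNorm hm)).1 EventuallyLE.rfl)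
  · rw [condNorm_le_iff hm hp hp' (measurable_condNorm hm)]
    intro A hA
    refine le_trans ?_
      ((condNorm_le_iff hm hp hp' (measurable_condNorm hm)).1 EventuallyLE.rfl A hA)
    refine lintegral_mono_ae (ae_restrict_of_ae ?_)
    filter_upwards [h] with ω hω
    gcongr

theorem condNorm_congr (hm : m ≤ mΩ) [IsFiniteMeasure P] (hp : 1 < p) (h : Z =ᵐ[P] Z') :
    condNorm m P p Z =ᵐ[P] condNorm m P p Z' :=
  (condNorm_mono hm hp h.le).antisymm (condNorm_mono hm hp h.symm.le)

/-- A variable which is measurable for the conditioning sigma-algebra is its own norm. -/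
theorem condNorm_le_self (hm : m ≤ mΩ) [IsFiniteMeasure P] (hp : 1 < p) (hZ : Measurable[m] Z) :
    condNorm m P p Z ≤ᵐ[P] Z := by
  by_cases hp' : p = ∞
  · subst hp'
    rw [condNorm_top_le_iff hm hZ]
  · rw [condNorm_le_iff hm hp hp' hZ]
    exact fun _ _ => le_rfl

theorem condNorm_mul_le (hm : m ≤ mΩ) [IsFiniteMeasure P] (hp : 1 < p) {b : Ω → ℝ≥0∞}
    (hb : Measurable[m] b) (hZ : Measurable Z) :
    condNorm m P p (fun ω => b ω * Z ω) ≤ᵐ[P] fun ω => b ω * condNorm m P p Z ω := by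
  have hη := measurable_condNorm (P := P) (p := p) (Z := Z) hm
  have hbη : Measurable[m] fun ω => b ω * condNorm m P p Z ω := by
    exact hb.mul hη
  by_cases hp' : p = ∞
  · subst hp'
    rw [condNorm_top_le_iff hm hbη]
    filter_upwards [(condNorm_top_le_iff hm hη).1 EventuallyLE.rfl] with ω hω
    gcongr
  · rw [condNorm_le_iff hm hp hp' hbη]
    have h := (condNorm_le_iff hm hp hp' hη).1 EventuallyLE.rfl
    have hr : 0 ≤ p.toReal := ENNReal.toReal_nonneg
    intro A hA
    have hbA : Measurable[m] (A.indicator fun ω => b ω ^ p.toReal) :=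
      (hb.pow_const _).indicator hA
    have h2 := lintegral_mul_le_of_setLIntegral_le hm (hZ.pow_const _)
      ((hη.mono hm le_rfl).pow_const _) hbA h
    have e : ∀ w : Ω → ℝ≥0∞, ∫⁻ ω in A, (b ω * w ω) ^ p.toReal ∂P =
        ∫⁻ ω, A.indicator (fun ω => b ω ^ p.toReal) ω * w ω ^ p.toReal ∂P := by
      intro w
      rw [← lintegral_indicator (hm A hA)]
      refine lintegral_congr fun ω => ?_
      by_cases hω : ω ∈ A
      · simp [hω, ENNReal.mul_rpow_of_nonneg _ _ hr]
      · simp [hω]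
    rw [e, e]
    exact h2

/-- Hölder for the splitting `z = (z * g ^ (-1/q)) * g ^ (1/q)`. The right side is linear in `z ^ r`
with weights that depend on `g` alone. For `g` measurable with respect to `m`, a conditional bound
on `z ^ r` can then be inserted. -/
theorem lintegral_rpow_le_mul_lintegral {S : Type*} [MeasurableSpace S] {ν : Measure S} {r : ℝ}
    (hr : 1 < r) {z g : S → ℝ≥0∞} (hz : Measurable z) (hg : Measurable g)
    (h0 : ∀ᵐ s ∂ν, g s = 0 → z s = 0) (hG : ∫⁻ s, g s ∂ν ≠ ∞) :
    (∫⁻ s, z s ∂ν) ^ r ≤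
      (∫⁻ s, g s ∂ν) ^ (r - 1) * ∫⁻ s, g s ^ (1 - r) * z s ^ r ∂ν := by
  have hr0 : 0 < r := by linarith
  set q : ℝ := r / (r - 1) with hq
  have hq0 : 0 < q := div_pos hr0 (by linarith)
  have hpq : r.HolderConjugate q := Real.HolderConjugate.conjExponent hr
  have hH := ENNReal.lintegral_mul_le_Lp_mul_Lq ν hpq
    (f := fun s => z s * g s ^ (-(1 / q))) (g := fun s => g s ^ (1 / q))
    (hz.mul (hg.pow_const _)).aemeasurable (hg.pow_const _).aemeasurable
  have hfin : ∀ᵐ s ∂ν, g s < ∞ := ae_lt_top hg hG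
  have h1 : ∫⁻ s, z s ∂ν ≤
      ∫⁻ s, ((fun s => z s * g s ^ (-(1 / q))) * fun s => g s ^ (1 / q)) s ∂ν := by
    refine lintegral_mono_ae ?_
    filter_upwards [h0, hfin] with s hs hs'
    by_cases hgs : g s = 0
    · simp [hs hgs]
    · simp only [Pi.mul_apply]
      rw [mul_assoc, ← ENNReal.rpow_add _ _ hgs hs'.ne]
      simp
  have h2 : ∀ s, (z s * g s ^ (-(1 / q))) ^ r = g s ^ (1 - r) * z s ^ r := by
    intro s
    rw [ENNReal.mul_rpow_of_nonneg _ _ hr0.le, ← ENNReal.rpow_mul, mul_comm]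
    congr 2
    rw [hq]
    field_simp
    ring
  have h3 : ∀ s, (g s ^ (1 / q)) ^ q = g s := by
    intro s
    rw [← ENNReal.rpow_mul, one_div_mul_cancel hq0.ne', ENNReal.rpow_one]
  simp only [h2, h3] at hH
  calc (∫⁻ s, z s ∂ν) ^ r
      ≤ ((∫⁻ s, g s ^ (1 - r) * z s ^ r ∂ν) ^ (1 / r) * (∫⁻ s, g s ∂ν) ^ (1 / q)) ^ r := by
        gcongr
        exact h1.trans hH
    _ = (∫⁻ s, g s ∂ν) ^ (r - 1) * ∫⁻ s, g s ^ (1 - r) * z s ^ r ∂ν := by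
        rw [ENNReal.mul_rpow_of_nonneg _ _ hr0.le, ← ENNReal.rpow_mul, ← ENNReal.rpow_mul,
          one_div_mul_cancel hr0.ne', ENNReal.rpow_one, mul_comm]
        congr 2
        rw [hq]
        field_simp

/-- Minkowski's integral inequality for conditional norms. -/
theorem condNorm_lintegral_le (hm : m ≤ mΩ) [IsFiniteMeasure P] (hp : 1 < p) {S : Type*}
    [mS : MeasurableSpace S] {ν : Measure S} [SFinite ν] {Z g : S → Ω → ℝ≥0∞}
    (hZ : Measurable (Function.uncurry Z))
    (hg : Measurable[mS.prod m] (Function.uncurry g))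
    (h : ∀ᵐ s ∂ν, condNorm m P p (Z s) ≤ᵐ[P] g s) :
    condNorm m P p (fun ω => ∫⁻ s, Z s ω ∂ν) ≤ᵐ[P] fun ω => ∫⁻ s, g s ω ∂ν := by
  have hg' : Measurable (Function.uncurry g) :=
    hg.mono (sup_le_sup le_rfl (MeasurableSpace.comap_mono hm)) le_rfl
  have hgs : ∀ s, Measurable[m] (g s) := fun s => by
    exact hg.comp (@measurable_prodMk_left _ _ _ m s)
  have hG : Measurable[m] fun ω => ∫⁻ s, g s ω ∂ν := by
    exact @Measurable.lintegral_prod_left' _ _ _ m ν _ _ hg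
  by_cases hp' : p = ∞
  · subst hp'
    rw [condNorm_top_le_iff hm hG]
    have h1 : ∀ᵐ s ∂ν, ∀ᵐ ω ∂P, Z s ω ≤ g s ω := by
      filter_upwards [h] with s hs
      exact (condNorm_top_le_iff hm (hgs s)).1 hs
    have h2 : ∀ᵐ ω ∂P, ∀ᵐ s ∂ν, Z s ω ≤ g s ω :=
      (Measure.ae_ae_comm (p := fun s ω => Z s ω ≤ g s ω) (measurableSet_le hZ hg')).1 h1
    filter_upwards [h2] with ω hω
    exact lintegral_mono_ae hω
  · set r := p.toReal with hrdef
    have hr : 1 < r := toReal_pos_of_one_lt hp hp'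
    have h' : ∀ᵐ s ∂ν, ∀ A, MeasurableSet[m] A →
        ∫⁻ ω in A, Z s ω ^ r ∂P ≤ ∫⁻ ω in A, g s ω ^ r ∂P := by
      filter_upwards [h] with s hs
      exact (condNorm_le_iff hm hp hp' (hgs s)).1 hs
    rw [condNorm_le_iff hm hp hp' hG]
    intro A hA
    have hZs : ∀ s, Measurable (Z s) := fun s => hZ.comp measurable_prodMk_left
    -- Testing the bound on the set `{g s = 0}`, which lies in `m`, forces `Z s` to vanish there;
    -- Fubini then exchanges the exceptional null sets.
    have h0 : ∀ᵐ ω ∂P, ∀ᵐ s ∂ν, g s ω = 0 → Z s ω = 0 := by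
      have h1 : ∀ᵐ s ∂ν, ∀ᵐ ω ∂P, g s ω = 0 → Z s ω = 0 := by
        filter_upwards [h'] with s hs
        have hB : MeasurableSet[m] {ω | g s ω = 0} :=
          hgs s (measurableSet_singleton (0 : ℝ≥0∞))
        have h2 := hs _ hB
        have h3 : ∫⁻ ω in {ω | g s ω = 0}, g s ω ^ r ∂P = 0 := by
          rw [setLIntegral_congr_fun (hm _ hB) (g := fun _ => 0), lintegral_zero]
          intro ω hω
          have : g s ω = 0 := hω
          simp [this, zero_lt_one.trans hr]
        rw [h3, nonpos_iff_eq_zero, lintegral_eq_zero_iff ((hZs s).pow_const _)] at h2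
        rw [EventuallyEq, ae_restrict_iff' (hm _ hB)] at h2
        filter_upwards [h2] with ω hω hgω
        have := hω hgω
        simpa [zero_lt_one.trans hr, ENNReal.rpow_eq_zero_iff, not_lt.2 (zero_lt_one.trans hr).le]
          using this
      refine (Measure.ae_ae_comm ?_).1 h1
      have e1 : MeasurableSet {x : S × Ω | g x.1 x.2 = 0} := hg' (measurableSet_singleton 0)
      have e2 : MeasurableSet {x : S × Ω | Z x.1 x.2 = 0} := hZ (measurableSet_singleton 0)
      have : {x : S × Ω | g x.1 x.2 = 0 → Z x.1 x.2 = 0} =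
          {x : S × Ω | g x.1 x.2 = 0}ᶜ ∪ {x : S × Ω | Z x.1 x.2 = 0} := by
        ext x
        simp [imp_iff_not_or]
      rw [this]
      exact e1.compl.union e2
    set G : Ω → ℝ≥0∞ := fun ω => ∫⁻ s, g s ω ∂ν with hGdef
    -- On `B` the claim is trivial; off `B` the integral of `g` is finite, as the weighted Hölder
    -- inequality requires.
    set B : Set Ω := {ω | G ω = ∞} with hBdef
    have hB : MeasurableSet[m] B := hG (measurableSet_singleton (∞ : ℝ≥0∞))
    rw [← lintegral_inter_add_sdiff _ A (hm B hB),
      ← lintegral_inter_add_sdiff (fun ω => G ω ^ r) A (hm B hB)]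
    have hAB : MeasurableSet[m] (A \ B) := by exact hA.diff hB
    refine add_le_add ?_ ?_
    · refine setLIntegral_mono' ((hm A hA).inter (hm B hB)) fun ω hω => ?_
      have : G ω = ∞ := hω.2
      rw [this, ENNReal.top_rpow_of_pos (zero_lt_one.trans hr)]
      exact le_top
    · have hZG : Measurable fun x : S × Ω => g x.1 x.2 ^ (1 - r) * Z x.1 x.2 ^ r :=
        (hg'.pow_const _).mul (hZ.pow_const _)
      have hG' : Measurable G := hG.mono hm le_rfl
      calc ∫⁻ ω in A \ B, (∫⁻ s, Z s ω ∂ν) ^ r ∂P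
          ≤ ∫⁻ ω in A \ B, G ω ^ (r - 1) * ∫⁻ s, g s ω ^ (1 - r) * Z s ω ^ r ∂ν ∂P := by
            refine setLIntegral_mono_ae' (hm _ hAB) ?_
            filter_upwards [h0] with ω hω hωAB
            exact lintegral_rpow_le_mul_lintegral hr (hZ.comp measurable_prodMk_right)
              (hg'.comp measurable_prodMk_right) hω hωAB.2
        _ = ∫⁻ ω in A \ B, ∫⁻ s, G ω ^ (r - 1) * (g s ω ^ (1 - r) * Z s ω ^ r) ∂ν ∂P := by
            refine lintegral_congr fun ω => ?_
            exact (lintegral_const_mul _ (hZG.comp measurable_prodMk_right)).symm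
        _ = ∫⁻ s, ∫⁻ ω in A \ B, G ω ^ (r - 1) * (g s ω ^ (1 - r) * Z s ω ^ r) ∂P ∂ν := by
            rw [lintegral_lintegral_swap]
            refine Measurable.aemeasurable ?_
            exact ((hG'.comp measurable_fst).pow_const _).mul (hZG.comp measurable_swap)
        _ ≤ ∫⁻ s, ∫⁻ ω in A \ B, G ω ^ (r - 1) * g s ω ∂P ∂ν := by
            -- The weight `G ^ (r - 1) * g s ^ (1 - r)` is `m`-measurable, so `Z s ^ r` may be
            -- replaced by `g s ^ r`.
            refine lintegral_mono_ae ?_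
            filter_upwards [h'] with s hs
            have hb : Measurable[m]
                ((A \ B).indicator fun ω => G ω ^ (r - 1) * g s ω ^ (1 - r)) := by
              refine Measurable.indicator ?_ hAB
              exact (hG.pow_const _).mul ((hgs s).pow_const _)
            have h2 := lintegral_mul_le_of_setLIntegral_le hm ((hZs s).pow_const r)
              (((hgs s).mono hm le_rfl).pow_const r) hb hs
            rw [← lintegral_indicator (hm _ hAB), ← lintegral_indicator (hm _ hAB)]
            refine le_trans (le_of_eq ?_) (h2.trans ?_)
            · refine lintegral_congr fun ω => ?_
              by_cases hω : ω ∈ A \ B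
              · rw [indicator_of_mem hω, indicator_of_mem hω, mul_assoc]
              · rw [indicator_of_notMem hω, indicator_of_notMem hω, zero_mul]
            · refine lintegral_mono fun ω => ?_
              dsimp only
              by_cases hω : ω ∈ A \ B
              · rw [indicator_of_mem hω, indicator_of_mem hω, mul_assoc]
                gcongr
                by_cases e0 : g s ω = 0
                · simp [e0, zero_lt_one.trans hr]
                · by_cases e1 : g s ω = ∞
                  · simp [e1]
                  · rw [← ENNReal.rpow_add _ _ e0 e1]
                    simp
              · rw [indicator_of_notMem hω, indicator_of_notMem hω, zero_mul]
        _ = ∫⁻ ω in A \ B, ∫⁻ s, G ω ^ (r - 1) * g s ω ∂ν ∂P := by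
            rw [lintegral_lintegral_swap]
            refine Measurable.aemeasurable ?_
            exact ((hG'.comp measurable_snd).pow_const _).mul hg'
        _ = ∫⁻ ω in A \ B, G ω ^ r ∂P := by
            refine lintegral_congr fun ω => ?_
            refine (lintegral_const_mul _ (hg'.comp measurable_prodMk_right)).trans ?_
            change G ω ^ (r - 1) * G ω = _
            nth_rw 2 [← ENNReal.rpow_one (G ω)]
            rw [← ENNReal.rpow_add_of_nonneg _ _ (by linarith) zero_le_one]
            congr 1
            ring

/-- Minkowski's integral inequality for counting measure. -/
theorem condNorm_tsum_le (hm : m ≤ mΩ) [IsFiniteMeasure P] (hp : 1 < p) {ι : Type*} [Countable ι]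
    {Z : ι → Ω → ℝ≥0∞} (hZ : ∀ i, Measurable (Z i)) {g : ι → Ω → ℝ≥0∞}
    (hg : ∀ i, Measurable[m] (g i)) (h : ∀ i, condNorm m P p (Z i) ≤ᵐ[P] g i) :
    condNorm m P p (fun ω => ∑' i, Z i ω) ≤ᵐ[P] fun ω => ∑' i, g i ω := by
  let _ : MeasurableSpace ι := ⊤
  have := condNorm_lintegral_le (P := P) hm hp (ν := Measure.count) (Z := Z) (g := g)
    (measurable_from_prod_countable_right fun i => hZ i)
    (by exact measurable_from_prod_countable_right fun i => hg i) (ae_of_all _ h)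
  simpa only [lintegral_count] using this

theorem condNorm_add_le (hm : m ≤ mΩ) [IsFiniteMeasure P] (hp : 1 < p)
    (hZ : Measurable Z) (hZ' : Measurable Z') :
    condNorm m P p (fun ω => Z ω + Z' ω) ≤ᵐ[P]
      fun ω => condNorm m P p Z ω + condNorm m P p Z' ω := by
  have := condNorm_tsum_le (P := P) hm hp (ι := Bool) (Z := fun i => cond i Z' Z)
    (g := fun i => condNorm m P p (cond i Z' Z)) (by simp [hZ, hZ'])
    (fun i => measurable_condNorm hm) (fun i => EventuallyLE.rfl)
  simpa only [tsum_bool, cond_true, cond_false] using this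

/-- Conditional Hölder inequality: the conditional `L^1`-norm is bounded by the conditional
`L^p`-norm. -/
theorem setLIntegral_le_of_condNorm_le (hm : m ≤ mΩ) [IsFiniteMeasure P] (hp : 1 < p)
    (hZ : Measurable Z) {η : Ω → ℝ≥0∞} (hη : Measurable[m] η) (h : condNorm m P p Z ≤ᵐ[P] η)
    {A : Set Ω} (hA : MeasurableSet[m] A) : ∫⁻ ω in A, Z ω ∂P ≤ ∫⁻ ω in A, η ω ∂P := by
  by_cases hp' : p = ∞
  · subst hp'
    exact lintegral_mono_ae (ae_restrict_of_ae ((condNorm_top_le_iff hm hη).1 h))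
  · set r := p.toReal with hrdef
    have hr : 1 < r := toReal_pos_of_one_lt hp hp'
    have hr0 : 0 < r := by linarith
    by_cases hfin : ∫⁻ ω in A, η ω ∂P = ∞
    · rw [hfin]
      exact le_top
    have h' := (condNorm_le_iff hm hp hp' hη).1 h
    have hη' : Measurable η := hη.mono hm le_rfl
    have h0 : ∀ᵐ ω ∂P.restrict A, η ω = 0 → Z ω = 0 := by
      refine ae_restrict_of_ae ?_
      have hB : MeasurableSet[m] {ω | η ω = 0} := hη (measurableSet_singleton (0 : ℝ≥0∞))
      have h2 := h' _ hB
      have h3 : ∫⁻ ω in {ω | η ω = 0}, η ω ^ r ∂P = 0 := by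
        rw [setLIntegral_congr_fun (hm _ hB) (g := fun _ => 0), lintegral_zero]
        intro ω hω
        have : η ω = 0 := hω
        simp [this, hr0]
      rw [h3, nonpos_iff_eq_zero, lintegral_eq_zero_iff (hZ.pow_const _)] at h2
      rw [EventuallyEq, ae_restrict_iff' (hm _ hB)] at h2
      filter_upwards [h2] with ω hω hgω
      have := hω hgω
      exact (ENNReal.rpow_eq_zero_iff_of_pos hr0).1 this
    -- The weighted Hölder inequality again, now on `Ω` itself with the measure `P.restrict A` and
    -- the weight `η`.
    have h1 := lintegral_rpow_le_mul_lintegral hr hZ hη' h0 hfin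
    have hb : Measurable[m] (A.indicator fun ω => η ω ^ (1 - r)) :=
      (hη.pow_const _).indicator hA
    have h2 := lintegral_mul_le_of_setLIntegral_le hm (hZ.pow_const r) (hη'.pow_const r) hb h'
    have e : ∀ w : Ω → ℝ≥0∞, ∫⁻ ω in A, η ω ^ (1 - r) * w ω ∂P =
        ∫⁻ ω, A.indicator (fun ω => η ω ^ (1 - r)) ω * w ω ∂P := by
      intro w
      rw [← lintegral_indicator (hm A hA)]
      refine lintegral_congr fun ω => ?_
      by_cases hω : ω ∈ A <;> simp [hω]
    rw [← e (fun ω => Z ω ^ r), ← e (fun ω => η ω ^ r)] at h2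
    have h3 : ∫⁻ ω in A, η ω ^ (1 - r) * η ω ^ r ∂P ≤ ∫⁻ ω in A, η ω ∂P := by
      refine lintegral_mono fun ω => ?_
      by_cases e0 : η ω = 0
      · simp [e0, hr0]
      · by_cases e1 : η ω = ∞
        · simp [e1]
        · rw [← ENNReal.rpow_add _ _ e0 e1]
          simp
    have h4 : (∫⁻ ω in A, Z ω ∂P) ^ r ≤ (∫⁻ ω in A, η ω ∂P) ^ r := by
      refine (h1.trans (mul_le_mul_right (h2.trans h3) _)).trans (le_of_eq ?_)
      nth_rw 2 [← ENNReal.rpow_one (∫⁻ ω in A, η ω ∂P)]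
      rw [← ENNReal.rpow_add_of_nonneg _ _ (by linarith) zero_le_one]
      congr 1
      ring
    exact (ENNReal.rpow_le_rpow_iff hr0).1 h4

/-- On each set where the conditional norm is at most `n`, the variable has a finite integral; these
sets exhaust `Ω` up to a null set. -/
theorem ae_lt_top_of_condNorm (hm : m ≤ mΩ) [IsFiniteMeasure P] (hp : 1 < p)
    (hZ : Measurable Z) (h : ∀ᵐ ω ∂P, condNorm m P p Z ω < ∞) : ∀ᵐ ω ∂P, Z ω < ∞ := by
  have hη := measurable_condNorm (P := P) (p := p) (Z := Z) hm
  have key : ∀ n : ℕ, ∀ᵐ ω ∂P, condNorm m P p Z ω ≤ n → Z ω < ∞ := by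
    intro n
    have hA : MeasurableSet[m] {ω | condNorm m P p Z ω ≤ n} := by
      exact measurableSet_le hη measurable_const
    refine (ae_restrict_iff' (p := fun ω => Z ω < ∞) (hm _ hA)).1 ?_
    refine ae_lt_top hZ (ne_top_of_le_ne_top ?_
      (setLIntegral_le_of_condNorm_le hm hp hZ hη EventuallyLE.rfl hA))
    refine ne_top_of_le_ne_top ?_
      (setLIntegral_mono' (g := fun _ => (n : ℝ≥0∞)) (hm _ hA) fun ω hω => hω)
    rw [setLIntegral_const]
    exact ENNReal.mul_ne_top (ENNReal.natCast_ne_top n) (measure_ne_top _ _)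
  filter_upwards [ae_all_iff.2 key, h] with ω hω hfin
  obtain ⟨n, hn⟩ := ENNReal.exists_nat_gt hfin.ne
  exact hω n hn.le

theorem ae_eq_zero_of_condNorm (hm : m ≤ mΩ) [IsFiniteMeasure P] (hp : 1 < p)
    (hZ : Measurable Z) (h : condNorm m P p Z ≤ᵐ[P] 0) : ∀ᵐ ω ∂P, Z ω = 0 := by
  have h2 := setLIntegral_le_of_condNorm_le hm hp hZ (@measurable_const _ _ _ m 0) h
    (@MeasurableSet.univ _ m)
  have h3 : Z =ᵐ[P] 0 := by simpa [lintegral_eq_zero_iff hZ] using h2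
  exact h3

end CondNorm

/-! ### Doob's inequality -/

section Doob

variable {Ω : Type*} [mΩ : MeasurableSpace Ω] {μ : Measure Ω}

/-- With `I = ∫ g ^ r`, the layer cake formula and the weak type bound give `I ≤ q ∫ f g ^ (r - 1)`,
and Hölder bounds this by `q J ^ (1/r) I ^ (1/q)`. Boundedness of `g` makes `I` finite, so that `I ^
(1/q)` can be cancelled. -/
theorem lintegral_rpow_le_of_weak_type_of_bdd [IsFiniteMeasure μ] {r : ℝ} (hr : 1 < r)
    {f g : Ω → ℝ} (hf : Measurable f) (hg : Measurable g) (hg0 : ∀ ω, 0 ≤ g ω) {c : ℝ}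
    (hc : ∀ ω, g ω ≤ c)
    (h : ∀ t : ℝ, 0 < t →
      ENNReal.ofReal t * μ {ω | t ≤ g ω} ≤ ∫⁻ ω in {ω | t ≤ g ω}, ENNReal.ofReal (f ω) ∂μ) :
    ∫⁻ ω, ENNReal.ofReal (g ω) ^ r ∂μ ≤
      ENNReal.ofReal (r / (r - 1)) ^ r * ∫⁻ ω, ENNReal.ofReal (f ω) ^ r ∂μ := by
  have hr0 : 0 < r := by linarith
  have hr1 : 0 < r - 1 := by linarith
  set q : ℝ := r / (r - 1) with hq
  have hq0 : 0 < q := div_pos hr0 hr1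
  have hpq : r.HolderConjugate q := Real.HolderConjugate.conjExponent hr
  set ν : Measure Ω := μ.withDensity fun ω => ENNReal.ofReal (f ω) with hν
  set I : ℝ≥0∞ := ∫⁻ ω, ENNReal.ofReal (g ω) ^ r ∂μ with hI
  set J : ℝ≥0∞ := ∫⁻ ω, ENNReal.ofReal (f ω) ^ r ∂μ with hJ
  have hmeas : ∀ t, MeasurableSet {ω | t ≤ g ω} := fun t => measurableSet_le measurable_const hg
  have e1 : I = ENNReal.ofReal r *
      ∫⁻ t in Ioi (0 : ℝ), μ {a | t ≤ g a} * ENNReal.ofReal (t ^ (r - 1)) := by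
    rw [← lintegral_rpow_eq_lintegral_meas_le_mul μ (ae_of_all _ hg0) hg.aemeasurable hr0, hI]
    refine lintegral_congr fun ω => ?_
    rw [ENNReal.ofReal_rpow_of_nonneg (hg0 ω) hr0.le]
  have e2 : ∫⁻ ω, ENNReal.ofReal (g ω) ^ (r - 1) ∂ν = ENNReal.ofReal (r - 1) *
      ∫⁻ t in Ioi (0 : ℝ), ν {a | t ≤ g a} * ENNReal.ofReal (t ^ (r - 1 - 1)) := by
    rw [← lintegral_rpow_eq_lintegral_meas_le_mul ν (ae_of_all _ hg0) hg.aemeasurable hr1]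
    refine lintegral_congr fun ω => ?_
    rw [ENNReal.ofReal_rpow_of_nonneg (hg0 ω) hr1.le]
  have e3 : ∫⁻ t in Ioi (0 : ℝ), μ {a | t ≤ g a} * ENNReal.ofReal (t ^ (r - 1)) ≤
      ∫⁻ t in Ioi (0 : ℝ), ν {a | t ≤ g a} * ENNReal.ofReal (t ^ (r - 1 - 1)) := by
    refine setLIntegral_mono' measurableSet_Ioi fun t ht => ?_
    have ht' : 0 < t := ht
    have : t ^ (r - 1) = t * t ^ (r - 1 - 1) := by
      rw [← Real.rpow_one_add' ht'.le (by linarith)]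
      ring_nf
    rw [this, ENNReal.ofReal_mul ht'.le, ← mul_assoc, mul_comm (μ _)]
    refine mul_le_mul_left ?_ _
    rw [hν, withDensity_apply _ (hmeas t)]
    exact h t ht'
  have e4 : ENNReal.ofReal r = ENNReal.ofReal q * ENNReal.ofReal (r - 1) := by
    rw [← ENNReal.ofReal_mul hq0.le, hq, div_mul_cancel₀ _ hr1.ne']
  have e5 : I ≤ ENNReal.ofReal q * ∫⁻ ω, ENNReal.ofReal (g ω) ^ (r - 1) ∂ν := by
    rw [e1, e2, e4, mul_assoc]
    gcongr
  have e6 : ∫⁻ ω, ENNReal.ofReal (g ω) ^ (r - 1) ∂ν ≤ J ^ (1 / r) * I ^ (1 / q) := by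
    rw [hν, lintegral_withDensity_eq_lintegral_mul _ hf.ennreal_ofReal
      (hg.ennreal_ofReal.pow_const _)]
    refine (ENNReal.lintegral_mul_le_Lp_mul_Lq μ hpq hf.ennreal_ofReal.aemeasurable
      (hg.ennreal_ofReal.pow_const _).aemeasurable).trans (le_of_eq ?_)
    have : ∀ ω, (ENNReal.ofReal (g ω) ^ (r - 1)) ^ q = ENNReal.ofReal (g ω) ^ r := by
      intro ω
      rw [← ENNReal.rpow_mul]
      congr 1
      rw [hq]
      field_simp
    simp only [this]
    rfl
  have hItop : I ≠ ∞ := by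
    refine ne_top_of_le_ne_top ?_ (lintegral_mono (g := fun _ => ENNReal.ofReal c ^ r) fun ω => ?_)
    · rw [lintegral_const]
      exact ENNReal.mul_ne_top (ENNReal.rpow_ne_top_of_nonneg hr0.le ENNReal.ofReal_ne_top)
        (measure_ne_top _ _)
    · dsimp only
      gcongr
      exact hc ω
  by_cases hI0 : I = 0
  · rw [hI0]
    exact zero_le
  have e7 : I ^ (1 / r) * I ^ (1 / q) ≤ (ENNReal.ofReal q * J ^ (1 / r)) * I ^ (1 / q) := by
    rw [← ENNReal.rpow_add _ _ hI0 hItop, mul_assoc]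
    have : 1 / r + 1 / q = 1 := by
      rw [hq]
      field_simp
      ring
    rw [this, ENNReal.rpow_one]
    exact e5.trans (mul_le_mul_right e6 _)
  have hIq0 : I ^ (1 / q) ≠ 0 := by
    simp [ENNReal.rpow_eq_zero_iff, hI0, hItop]
  have hIq1 : I ^ (1 / q) ≠ ∞ := ENNReal.rpow_ne_top_of_nonneg (by positivity) hItop
  have e8 := (ENNReal.mul_le_mul_iff_left hIq0 hIq1).1 e7
  calc I = (I ^ (1 / r)) ^ r := by
        rw [← ENNReal.rpow_mul, one_div_mul_cancel hr0.ne', ENNReal.rpow_one]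
    _ ≤ (ENNReal.ofReal q * J ^ (1 / r)) ^ r := by gcongr
    _ = ENNReal.ofReal q ^ r * J := by
        rw [ENNReal.mul_rpow_of_nonneg _ _ hr0.le, ← ENNReal.rpow_mul,
          one_div_mul_cancel hr0.ne', ENNReal.rpow_one]

/-- Truncation at level `n` keeps the weak type hypothesis, because the level sets of `min g n` are
those of `g` or empty; then monotone convergence applies. -/
theorem lintegral_rpow_le_of_weak_type [IsFiniteMeasure μ] {r : ℝ} (hr : 1 < r)
    {f g : Ω → ℝ} (hf : Measurable f) (hg : Measurable g) (hg0 : ∀ ω, 0 ≤ g ω)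
    (h : ∀ t : ℝ, 0 < t →
      ENNReal.ofReal t * μ {ω | t ≤ g ω} ≤ ∫⁻ ω in {ω | t ≤ g ω}, ENNReal.ofReal (f ω) ∂μ) :
    ∫⁻ ω, ENNReal.ofReal (g ω) ^ r ∂μ ≤
      ENNReal.ofReal (r / (r - 1)) ^ r * ∫⁻ ω, ENNReal.ofReal (f ω) ^ r ∂μ := by
  have hr0 : 0 < r := by linarith
  have key : ∀ n : ℕ, ∫⁻ ω, ENNReal.ofReal (min (g ω) n) ^ r ∂μ ≤
      ENNReal.ofReal (r / (r - 1)) ^ r * ∫⁻ ω, ENNReal.ofReal (f ω) ^ r ∂μ := by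
    intro n
    refine lintegral_rpow_le_of_weak_type_of_bdd hr hf (hg.min measurable_const)
      (fun ω => le_min (hg0 ω) n.cast_nonneg) (fun ω => min_le_right _ _) fun t ht => ?_
    by_cases htn : t ≤ n
    · have : {ω | t ≤ min (g ω) n} = {ω | t ≤ g ω} := by
        ext ω
        simp [htn]
      rw [this]
      exact h t ht
    · have : {ω | t ≤ min (g ω) n} = ∅ := by
        ext ω
        simp [htn]
      rw [this]
      simp
  have hlim : ∫⁻ ω, ENNReal.ofReal (g ω) ^ r ∂μ =
      ∫⁻ ω, ⨆ n : ℕ, ENNReal.ofReal (min (g ω) n) ^ r ∂μ := by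
    refine lintegral_congr fun ω => le_antisymm ?_ (iSup_le fun n => ?_)
    · obtain ⟨n, hn⟩ := exists_nat_ge (g ω)
      refine le_iSup_of_le n ?_
      rw [min_eq_left hn]
    · gcongr
      exact min_le_left _ _
  rw [hlim, lintegral_iSup]
  · exact iSup_le key
  · exact fun n => (hg.min measurable_const).ennreal_ofReal.pow_const _
  · intro n k hnk ω
    dsimp only
    gcongr

variable {ι : Type*} {d : ℕ}

/-- The filtration sampled along a nondecreasing sequence of times. -/
def sampledFiltration [Preorder ι] (F : Filtration ι mΩ) {u : ℕ → ι} (hu : Monotone u) :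
    Filtration ℕ mΩ where
  seq k := F (u k)
  mono' _ _ h := F.mono (hu h)
  le' k := F.le (u k)

theorem submartingale_norm_sampled [Preorder ι] [IsFiniteMeasure μ] {F : Filtration ι mΩ}
    {N : ι → Ω → Vec d} (hN : Martingale N F μ) {u : ℕ → ι} (hu : Monotone u) :
    Submartingale (fun k ω => ‖N (u k) ω‖) (sampledFiltration F hu) μ := by
  refine ⟨fun k => (hN.1 (u k)).norm, fun i j hij => ?_, fun k => (hN.integrable _).norm⟩
  filter_upwards [hN.2 (u i) (u j) (hu hij), norm_condExp_le (μ := μ) (m := F (u i)) (N (u j))]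
    with ω h1 h2
  rw [← h1]
  exact h2

theorem lintegral_iSup_range_rpow_le [Preorder ι] [IsFiniteMeasure μ] {F : Filtration ι mΩ}
    {N : ι → Ω → Vec d} (hN : Martingale N F μ) {u : ℕ → ι} (hu : Monotone u) {r : ℝ} (hr : 1 < r)
    (n : ℕ) :
    ∫⁻ ω, (⨆ k ∈ Finset.range (n + 1), ‖N (u k) ω‖ₑ) ^ r ∂μ ≤
      ENNReal.ofReal (r / (r - 1)) ^ r * ∫⁻ ω, ‖N (u n) ω‖ₑ ^ r ∂μ := by
  have hsub := submartingale_norm_sampled hN hu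
  have hNm : ∀ k, Measurable fun ω => ‖N (u k) ω‖ := fun k =>
    ((hN.1 (u k)).mono (F.le _)).norm.measurable
  set g : Ω → ℝ := fun ω => (Finset.range (n + 1)).sup' Finset.nonempty_range_add_one
    fun k => ‖N (u k) ω‖ with hgdef
  have hg : Measurable g := Finset.measurable_range_sup'' fun k _ => hNm k
  have hg0 : ∀ ω, 0 ≤ g ω := fun ω => by
    refine (norm_nonneg (N (u 0) ω)).trans ?_
    exact Finset.le_sup' (fun k => ‖N (u k) ω‖) (Finset.mem_range.2 n.succ_pos)
  have hmeas : ∀ t, MeasurableSet {ω | t ≤ g ω} := fun t => measurableSet_le measurable_const hg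
  have h := lintegral_rpow_le_of_weak_type (μ := μ) hr (hNm n) hg hg0 fun t ht => by
    have := maximal_ineq hsub (fun k ω => norm_nonneg _) (ε := t.toNNReal) n
    rw [Real.coe_toNNReal _ ht.le] at this
    refine le_trans this (le_of_eq ?_)
    rw [ofReal_integral_eq_lintegral_ofReal (hsub.integrable n).integrableOn
      (ae_of_all _ fun ω => norm_nonneg _)]
  simp only [ofReal_norm] at h
  refine le_trans (lintegral_mono fun ω => ?_) h
  dsimp only
  gcongr
  refine iSup₂_le fun k hk => ?_
  rw [← ofReal_norm]
  exact ENNReal.ofReal_le_ofReal (Finset.le_sup' (fun k => ‖N (u k) ω‖) hk)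

/-- Makes discrete-time martingale theorems applicable to a finite set of times with greatest
element `t`. -/
theorem exists_monotone_enumeration [LinearOrder ι] {S : Finset ι} {t : ι} (ht : t ∈ S)
    (hS : ∀ s ∈ S, s ≤ t) :
    ∃ (u : ℕ → ι) (n : ℕ), Monotone u ∧ (∀ s ∈ S, ∃ k ∈ Finset.range (n + 1), u k = s) ∧
      ∀ k, n ≤ k → u k = t := by
  have hcard : 0 < S.card := Finset.card_pos.2 ⟨t, ht⟩
  -- Indices are clamped at the last position, so the sequence stays at `t` from then on.
  set i : ℕ → Fin S.card := fun k => ⟨min k (S.card - 1), by omega⟩ with hi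
  have hmono : Monotone fun k => S.orderEmbOfFin rfl (i k) := by
    intro a b hab
    refine (S.orderEmbOfFin rfl).monotone ?_
    simp only [hi, Fin.mk_le_mk]
    omega
  have hsurj : ∀ s ∈ S, ∃ k ∈ Finset.range (S.card - 1 + 1), S.orderEmbOfFin rfl (i k) = s := by
    intro s hs
    have : s ∈ Set.range (S.orderEmbOfFin rfl) := by
      rw [Finset.range_orderEmbOfFin]
      exact hs
    obtain ⟨j, rfl⟩ := this
    refine ⟨j, Finset.mem_range.2 (by omega), ?_⟩
    congr 1
    ext
    simp only [hi]
    omega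
  refine ⟨fun k => S.orderEmbOfFin rfl (i k), S.card - 1, hmono, hsurj, fun k hk => ?_⟩
  refine le_antisymm (hS _ (Finset.orderEmbOfFin_mem _ _ _)) ?_
  obtain ⟨j, hj, hjt⟩ := hsurj t ht
  nth_rw 1 [← hjt]
  exact hmono ((Nat.lt_succ_iff.1 (Finset.mem_range.1 hj)).trans hk)

/-- Doob's `L^r` inequality along a countable set of times. -/
theorem lintegral_iSup_rpow_le [LinearOrder ι] [IsFiniteMeasure μ] {F : Filtration ι mΩ}
    {N : ι → Ω → Vec d} (hN : Martingale N F μ) {r : ℝ} (hr : 1 < r) (e : ℕ → ι) {t : ι}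
    (ht : ∀ n, e n ≤ t) :
    ∫⁻ ω, (⨆ n, ‖N (e n) ω‖ₑ) ^ r ∂μ ≤
      ENNReal.ofReal (r / (r - 1)) ^ r * ∫⁻ ω, ‖N t ω‖ₑ ^ r ∂μ := by
  have hr0 : 0 < r := by linarith
  have hNm : ∀ s, Measurable fun ω => ‖N s ω‖ₑ := fun s =>
    ((hN.1 s).mono (F.le _)).enorm
  have key : ∀ n : ℕ, ∫⁻ ω, (⨆ k ∈ Finset.range (n + 1), ‖N (e k) ω‖ₑ) ^ r ∂μ ≤
      ENNReal.ofReal (r / (r - 1)) ^ r * ∫⁻ ω, ‖N t ω‖ₑ ^ r ∂μ := by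
    intro n
    obtain ⟨u, j, hu, hS, hj⟩ := exists_monotone_enumeration
      (S := insert t ((Finset.range (n + 1)).image e)) (t := t) (Finset.mem_insert_self _ _) (by
        intro s hs
        rcases Finset.mem_insert.1 hs with rfl | hs
        · exact le_rfl
        · obtain ⟨k, -, rfl⟩ := Finset.mem_image.1 hs
          exact ht k)
    have := lintegral_iSup_range_rpow_le hN hu hr j
    rw [hj j le_rfl] at this
    refine le_trans (lintegral_mono fun ω => ?_) this
    dsimp only
    gcongr ?_ ^ r
    refine iSup₂_le fun k hk => ?_
    obtain ⟨i, hi, hik⟩ := hS (e k) (Finset.mem_insert_of_mem (Finset.mem_image_of_mem e hk))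
    rw [← hik]
    exact le_iSup₂_of_le i hi le_rfl
  have hlim : ∫⁻ ω, (⨆ n, ‖N (e n) ω‖ₑ) ^ r ∂μ =
      ∫⁻ ω, ⨆ n : ℕ, (⨆ k ∈ Finset.range (n + 1), ‖N (e k) ω‖ₑ) ^ r ∂μ := by
    refine lintegral_congr fun ω => ?_
    have h1 : (⨆ n, ‖N (e n) ω‖ₑ) = ⨆ n : ℕ, ⨆ k ∈ Finset.range (n + 1), ‖N (e k) ω‖ₑ := by
      refine le_antisymm (iSup_le fun n => ?_) (iSup_le fun n => iSup₂_le fun k _ => ?_)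
      · exact le_iSup_of_le n (le_iSup₂_of_le n (Finset.self_mem_range_succ n) le_rfl)
      · exact le_iSup (fun n => ‖N (e n) ω‖ₑ) k
    rw [h1]
    exact (ENNReal.orderIsoRpow r hr0).map_iSup _
  rw [hlim, lintegral_iSup]
  · exact iSup_le key
  · exact fun n => (Measurable.iSup fun k => Measurable.iSup fun _ => hNm (e k)).pow_const _
  · intro n k hnk ω
    dsimp only
    gcongr ?_ ^ r
    exact biSup_mono fun i hi => Finset.range_mono (by omega) hi

/-- Doob's inequality for the restricted measures, with `A` in the initial sigma-algebra, is the
conditional Doob inequality. -/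
theorem martingale_restrict [Preorder ι] [IsFiniteMeasure μ] {F : Filtration ι mΩ}
    {N : ι → Ω → Vec d} (hN : Martingale N F μ) {A : Set Ω} (hA : ∀ t, MeasurableSet[F t] A) :
    Martingale N F (μ.restrict A) := by
  refine ⟨hN.1, fun s t hst => ?_⟩
  exact (condExp_restrict_ae_eq_restrict (F.le s) (hA s) (hN.integrable t)).trans
    (ae_restrict_of_ae (hN.2 s t hst))

theorem setLIntegral_enorm_condExp_le {m : MeasurableSpace Ω} [IsFiniteMeasure μ]
    {x : Ω → Vec d} (hx : Integrable x μ) {A : Set Ω} (hA : MeasurableSet[m] A) :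
    ∫⁻ ω in A, ‖μ[x | m] ω‖ₑ ∂μ ≤ ∫⁻ ω in A, ‖x ω‖ₑ ∂μ := by
  rw [← ofReal_integral_norm_eq_lintegral_enorm integrable_condExp.integrableOn,
    ← ofReal_integral_norm_eq_lintegral_enorm hx.integrableOn]
  exact ENNReal.ofReal_le_ofReal (setIntegral_norm_condExp_le hA x)

end Doob

/-! ### Processes with right continuous paths with left limits -/

section RCLL

variable {Ω : Type*} {T : ℝ} {d : ℕ} {X : Time T → Ω → Vec d}

theorem le_tEnd (hT : 0 < T) (t : Time T) : t ≤ tEnd hT := t.2.2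

theorem tInit_le (hT : 0 < T) (t : Time T) : tInit hT ≤ t := t.2.1

theorem enorm_le_supNorm (X : Time T → Ω → Vec d) {s t : Time T} (h : s ≤ t) (ω : Ω) :
    ‖X s ω‖ₑ ≤ supNorm X t ω :=
  le_iSup₂_of_le s h le_rfl

/-- There is a dense sequence of times that contains the terminal time. -/
theorem exists_dense_times (hT : 0 < T) :
    ∃ e : ℕ → Time T, DenseRange e ∧ ∃ n, e n = tEnd hT := by
  have : Nonempty (Time T) := ⟨tInit hT⟩
  obtain ⟨e, he⟩ := TopologicalSpace.exists_dense_seq (Time T)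
  refine ⟨fun n => Nat.casesOn n (tEnd hT) e, ?_, 0, rfl⟩
  refine Dense.mono ?_ he
  rintro _ ⟨n, rfl⟩
  exact ⟨n + 1, rfl⟩

theorem nhdsGT_neBot {s t : Time T} (h : s < t) : (𝓝[>] s).NeBot := by
  have : DenselyOrdered (Time T) := inferInstance
  exact nhdsGT_neBot_of_exists_gt ⟨t, h⟩

/-- By right continuity a value at `s < t` is approximated at dense times in `(s, t)`. The endpoint
`t` is listed separately, because its right neighbourhoods leave `[0, t]`. -/
theorem supNorm_eq_of_dense (hX : IsRCLL X) {e : ℕ → Time T} (he : DenseRange e) (t : Time T)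
    (ω : Ω) : supNorm X t ω = ‖X t ω‖ₑ ⊔ ⨆ n, ⨆ _ : e n ≤ t, ‖X (e n) ω‖ₑ := by
  refine le_antisymm (iSup₂_le fun s hs => ?_) (sup_le (enorm_le_supNorm X le_rfl ω)
    (iSup₂_le fun n hn => enorm_le_supNorm X hn ω))
  rcases hs.eq_or_lt with rfl | hst
  · exact le_sup_left
  refine le_trans ?_ le_sup_right
  set c : ℝ≥0∞ := ⨆ n, ⨆ _ : e n ≤ t, ‖X (e n) ω‖ₑ with hc
  by_contra hlt
  rw [not_le] at hlt
  have hcont : ContinuousWithinAt (fun s => ‖X s ω‖ₑ) (Ici s) s := (hX ω s).1.enorm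
  have hev : ∀ᶠ v in 𝓝[Ici s] s, c < ‖X v ω‖ₑ := hcont.eventually_const_lt hlt
  have hev' : ∀ᶠ v in 𝓝[>] s, c < ‖X v ω‖ₑ := hev.filter_mono (nhdsWithin_mono _ Ioi_subset_Ici_self)
  obtain ⟨u, hu, hsub⟩ := (mem_nhdsGT_iff_exists_Ioo_subset' hst).1 hev'
  have hne : (Ioo s (min u t)).Nonempty := nonempty_Ioo.2 (lt_min hu hst)
  obtain ⟨n, hn⟩ := he.exists_mem_open isOpen_Ioo hne
  have h1 : c < ‖X (e n) ω‖ₑ := hsub ⟨hn.1, hn.2.trans_le (min_le_left _ _)⟩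
  have h2 : ‖X (e n) ω‖ₑ ≤ c :=
    le_iSup₂_of_le (f := fun n (_ : e n ≤ t) => ‖X (e n) ω‖ₑ) n
      (hn.2.le.trans (min_le_right _ _)) le_rfl
  exact absurd h1 (not_lt.2 h2)

theorem supNorm_tEnd_eq_of_dense (hT : 0 < T) (hX : IsRCLL X) {e : ℕ → Time T} (he : DenseRange e)
    (he' : ∃ n, e n = tEnd hT) (ω : Ω) :
    supNorm X (tEnd hT) ω = ⨆ n, ‖X (e n) ω‖ₑ := by
  rw [supNorm_eq_of_dense hX he]
  have : ∀ n, (⨆ _ : e n ≤ tEnd hT, ‖X (e n) ω‖ₑ) = ‖X (e n) ω‖ₑ := fun n =>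
    iSup_pos (le_tEnd hT (e n))
  simp only [this]
  obtain ⟨n, hn⟩ := he'
  refine sup_eq_right.2 ?_
  rw [← hn]
  exact le_iSup (fun n => ‖X (e n) ω‖ₑ) n

theorem measurable_supNorm [MeasurableSpace Ω] (hT : 0 < T) (hX : IsRCLL X) (hm : ∀ t, Measurable (X t)) (t : Time T) :
    Measurable (supNorm X t) := by
  obtain ⟨e, he, -⟩ := exists_dense_times hT
  have : supNorm X t = fun ω => ‖X t ω‖ₑ ⊔ ⨆ n, ⨆ _ : e n ≤ t, ‖X (e n) ω‖ₑ :=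
    funext fun ω => supNorm_eq_of_dense hX he t ω
  rw [this]
  exact (hm t).enorm.sup (Measurable.iSup fun n => Measurable.iSup fun _ => (hm _).enorm)

/-- Versions of the same process with regular paths are indistinguishable. -/
theorem IsRCLL.ae_eq [MeasurableSpace Ω] (hT : 0 < T) {X' : Time T → Ω → Vec d} {P : Measure Ω} (hX : IsRCLL X)
    (hX' : IsRCLL X') (h : ∀ t, X t =ᵐ[P] X' t) : ∀ᵐ ω ∂P, ∀ t, X t ω = X' t ω := by
  obtain ⟨e, he, n, hn⟩ := exists_dense_times hT
  filter_upwards [ae_all_iff.2 fun n => h (e n)] with ω hω t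
  rcases (le_tEnd hT t).eq_or_lt with rfl | ht
  · rw [← hn]
    exact hω n
  have := nhdsGT_neBot ht
  have hc : ∀ {Y : Time T → Ω → Vec d}, IsRCLL Y → Tendsto (fun s => Y s ω) (𝓝[range e ∩ Ioi t] t)
      (𝓝 (Y t ω)) := fun hY =>
    ((hY ω t).1.mono fun s hs => (mem_Ioi.1 hs.2).le)
  have hne : (𝓝[range e ∩ Ioi t] t).NeBot := by
    rw [← mem_closure_iff_nhdsWithin_neBot, inter_comm]
    have h1 := Dense.open_subset_closure_inter he (isOpen_Ioi (a := t))
    have h2 : t ∈ closure (Ioi t) := mem_closure_iff_nhdsWithin_neBot.2 inferInstance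
    exact closure_minimal h1 isClosed_closure h2
  refine tendsto_nhds_unique (hc hX) ((hc hX').congr' ?_)
  refine eventually_of_mem self_mem_nhdsWithin ?_
  rintro s ⟨⟨k, rfl⟩, -⟩
  exact (hω k).symm

end RCLL

/-! ### Doob and Jensen for conditional norms -/

/-- The constant of Doob's inequality. -/
noncomputable def doobConst (p : ℝ≥0∞) : ℝ :=
  if p = ∞ then 1 else p.toReal / (p.toReal - 1)

/-- Doob's inequality for conditional norms. -/
theorem condSupNorm_le_of_martingale {Ω : Type*} [mΩ : MeasurableSpace Ω] {P : Measure Ω}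
    [IsFiniteMeasure P] {T : ℝ} (hT : 0 < T) {F : Filtration (Time T) mΩ} {p : ℝ≥0∞} (hp : 1 < p)
    {d : ℕ} {N : Time T → Ω → Vec d} (hN : Martingale N F P) (hrc : IsRCLL N)
    {η : Ω → ℝ≥0∞} (hη : Measurable[F (tInit hT)] η)
    (h : condNorm (F (tInit hT)) P p (fun ω => ‖N (tEnd hT) ω‖ₑ) ≤ᵐ[P] η) :
    condSupNorm hT F P p N (tEnd hT) ≤ᵐ[P] fun ω => ENNReal.ofReal (doobConst p) * η ω := by
  obtain ⟨e, he, he'⟩ := exists_dense_times hT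
  have hm := F.le (tInit hT)
  have hsup : supNorm N (tEnd hT) = fun ω => ⨆ n, ‖N (e n) ω‖ₑ :=
    funext fun ω => supNorm_tEnd_eq_of_dense hT hrc he he' ω
  have hqη : Measurable[F (tInit hT)] fun ω => ENNReal.ofReal (doobConst p) * η ω :=
    hη.const_mul _
  rw [condSupNorm, hsup]
  by_cases hp' : p = ∞
  · subst hp'
    rw [condNorm_top_le_iff hm hqη]
    have h1 := (condNorm_top_le_iff hm hη).1 h
    -- For `p = ∞` no maximal inequality is needed: `|N_t| ≤ E[|N_T| | F_t] ≤ η`, since `η` is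
    -- measurable for `F_t`.
    have key : ∀ t : Time T, ∀ᵐ ω ∂P, ‖N t ω‖ₑ ≤ η ω := by
      intro t
      refine ae_le_of_setLIntegral_le (F.le t) (hN.1 t).enorm
        (hη.mono (F.mono (tInit_le hT t)) le_rfl) fun A hA => ?_
      calc ∫⁻ ω in A, ‖N t ω‖ₑ ∂P = ∫⁻ ω in A, ‖P[N (tEnd hT) | F t] ω‖ₑ ∂P := by
            refine lintegral_congr_ae (ae_restrict_of_ae ?_)
            filter_upwards [hN.2 t _ (le_tEnd hT t)] with ω hω
            rw [hω]
        _ ≤ ∫⁻ ω in A, ‖N (tEnd hT) ω‖ₑ ∂P :=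
            setLIntegral_enorm_condExp_le (hN.integrable _) hA
        _ ≤ ∫⁻ ω in A, η ω ∂P := lintegral_mono_ae (ae_restrict_of_ae h1)
    filter_upwards [ae_all_iff.2 fun n => key (e n)] with ω hω
    simpa [doobConst] using hω
  · rw [condNorm_le_iff hm hp hp' hqη]
    have h1 := (condNorm_le_iff hm hp hp' hη).1 h
    have hr : 1 < p.toReal := toReal_pos_of_one_lt hp hp'
    intro A hA
    refine (lintegral_iSup_rpow_le (martingale_restrict hN fun t =>
      F.mono (tInit_le hT t) A hA) hr e fun n => le_tEnd hT (e n)).trans ?_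
    have e1 : ∀ ω, (ENNReal.ofReal (doobConst p) * η ω) ^ p.toReal =
        ENNReal.ofReal (doobConst p) ^ p.toReal * η ω ^ p.toReal := fun ω =>
      ENNReal.mul_rpow_of_nonneg _ _ ENNReal.toReal_nonneg
    simp only [e1]
    rw [lintegral_const_mul _ ((hη.mono hm le_rfl).pow_const _), doobConst, if_neg hp']
    exact mul_le_mul_right (h1 A hA) _

/-- Conditional Jensen's inequality. -/
theorem enorm_condExp_le_of_condNorm_le {Ω : Type*} {m : MeasurableSpace Ω}
    [mΩ : MeasurableSpace Ω] {P : Measure Ω} [IsFiniteMeasure P] (hm : m ≤ mΩ) {p : ℝ≥0∞}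
    (hp : 1 < p) {d : ℕ} {x : Ω → Vec d} (hx : Integrable x P) (hxm : Measurable x)
    {η : Ω → ℝ≥0∞} (hη : Measurable[m] η) (h : condNorm m P p (fun ω => ‖x ω‖ₑ) ≤ᵐ[P] η) :
    ∀ᵐ ω ∂P, ‖P[x | m] ω‖ₑ ≤ η ω := by
  refine ae_le_of_setLIntegral_le hm stronglyMeasurable_condExp.enorm hη fun A hA => ?_
  exact (setLIntegral_enorm_condExp_le hx hA).trans
    (setLIntegral_le_of_condNorm_le hm hp hxm.enorm hη h hA)

/-! ### Upcrossings along countable sets of times -/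

section UpChain

variable {ι : Type*} [LinearOrder ι]

/-- `UpChain D z a b k x`: after the time `x` the path `z` has at least `k` upcrossings of `[a, b]`
along `D`. -/
def UpChain (D : Set ι) (z : ι → ℝ) (a b : ℝ) : ℕ → ι → Prop
  | 0, _ => True
  | k + 1, x => ∃ s ∈ D, ∃ t ∈ D, x < s ∧ s < t ∧ z s ≤ a ∧ b ≤ z t ∧ UpChain D z a b k t

theorem UpChain.mono_set {D D' : Set ι} (h : D ⊆ D') {z : ι → ℝ} {a b : ℝ} :
    ∀ {k : ℕ} {x : ι}, UpChain D z a b k x → UpChain D' z a b k x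
  | 0, _, _ => trivial
  | _ + 1, _, ⟨s, hs, t, ht, hxs, hst, hsa, htb, hc⟩ =>
    ⟨s, h hs, t, h ht, hxs, hst, hsa, htb, hc.mono_set h⟩

theorem UpChain.mono_start {D : Set ι} {z : ι → ℝ} {a b : ℝ} :
    ∀ {k : ℕ} {x y : ι}, y ≤ x → UpChain D z a b k x → UpChain D z a b k y
  | 0, _, _, _, _ => trivial
  | _ + 1, _, _, hyx, ⟨s, hs, t, ht, hxs, hst, hsa, htb, hc⟩ =>
    ⟨s, hs, t, ht, hyx.trans_lt hxs, hst, hsa, htb, hc⟩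

theorem UpChain.exists_finite {e : ℕ → ι} {z : ι → ℝ} {a b : ℝ} :
    ∀ {k : ℕ} {x : ι}, UpChain (range e) z a b k x → ∃ n, UpChain (e '' Iic n) z a b k x
  | 0, _, _ => ⟨0, trivial⟩
  | _ + 1, _, ⟨s, ⟨i, hi⟩, t, ⟨j, hj⟩, hxs, hst, hsa, htb, hc⟩ => by
    obtain ⟨n, hn⟩ := hc.exists_finite
    refine ⟨max n (max i j), s, ⟨i, by simp, hi⟩, t, ⟨j, by simp, hj⟩, hxs, hst, hsa, htb, ?_⟩
    exact hn.mono_set (image_mono (Iic_subset_Iic.2 (le_max_left _ _)))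

/-- Induction along the chain, with the invariant that `c` upcrossings are completed by index `j`,
and that no index below `j` carries a time after `x`. The horizon `n + 1` exceeds every index in
use, so the strict inequality is the condition counted by `upcrossingsBefore`. -/
theorem upperCrossingTime_lt_of_upChain {Ω : Type*} {X : ι → Ω → ℝ} {u : ℕ → ι} (hu : Monotone u)
    {S : Set ι} {n : ℕ} (hS : ∀ s ∈ S, ∃ i ≤ n, u i = s) {a b : ℝ} {ω : Ω} :
    ∀ {k c j : ℕ} {x : ι}, (∀ i, x < u i → j ≤ i) → j ≤ n →
      upperCrossingTime a b (fun i => X (u i)) (n + 1) c ω ≤ j →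
      UpChain S (fun s => X s ω) a b k x →
      upperCrossingTime a b (fun i => X (u i)) (n + 1) (c + k) ω < n + 1
  | 0, _, _, _, _, hjn, hc, _ => by
    rw [add_zero]
    exact hc.trans_lt (by omega)
  | k + 1, c, j, x, hx, hjn, hc, ⟨s, hs, t, ht, hxs, hst, hsa, htb, hch⟩ => by
    obtain ⟨i, hi, rfl⟩ := hS s hs
    obtain ⟨l, hl, rfl⟩ := hS t ht
    have hil : i < l := by
      by_contra h
      exact absurd hst (not_lt.2 (hu (not_lt.1 h)))
    have hji : j ≤ i := hx i hxs
    have h1 : lowerCrossingTime a b (fun i => X (u i)) (n + 1) c ω ≤ i :=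
      hittingBtwn_le_of_mem (hc.trans hji) (by omega) hsa
    have h2 : upperCrossingTime a b (fun i => X (u i)) (n + 1) (c + 1) ω ≤ l := by
      rw [upperCrossingTime_succ_eq]
      exact hittingBtwn_le_of_mem (h1.trans hil.le) (by omega) htb
    have := upperCrossingTime_lt_of_upChain (X := X) hu hS (k := k) (c := c + 1) (j := l)
      (x := u l) (fun i' hi' => by
        by_contra h
        exact absurd hi' (not_lt.2 (hu (not_le.1 h).le))) hl h2 hch
    rwa [show c + (k + 1) = c + 1 + k by ring]

/-- Almost every path of a martingale has finitely many upcrossings along a countable set. -/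
theorem ae_exists_not_upChain {Ω : Type*} [mΩ : MeasurableSpace Ω] {P : Measure Ω}
    [IsFiniteMeasure P] {F : Filtration ι mΩ} {Z : ι → Ω → ℝ} (hZ : Martingale Z F P)
    {e : ℕ → ι} {T : ι} (he : ∀ n, e n ≤ T) {a b : ℝ} (hab : a < b) :
    ∀ᵐ ω ∂P, ∃ k, ∀ x, ¬ UpChain (range e) (fun s => Z s ω) a b k x := by
  set C : ℝ≥0∞ := ENNReal.ofReal (∫ ω, (Z T ω - a)⁺ ∂P) with hC
  -- The upcrossing inequality with Markov's inequality along finitely many times.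
  have key : ∀ k n : ℕ, (k : ℝ≥0∞) * (ENNReal.ofReal (b - a) *
      P {ω | ∃ x, UpChain (e '' Iic n) (fun s => Z s ω) a b k x}) ≤ C := by
    intro k n
    obtain ⟨u, j, hu, hS, hj⟩ := exists_monotone_enumeration
      (S := insert T ((Finset.range (n + 1)).image e)) (t := T) (Finset.mem_insert_self _ _) (by
        intro s hs
        rcases Finset.mem_insert.1 hs with rfl | hs
        · exact le_rfl
        · obtain ⟨i, -, rfl⟩ := Finset.mem_image.1 hs
          exact he i)
    set f : ℕ → Ω → ℝ := fun i => Z (u i) with hf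
    have hfm : Martingale f (sampledFiltration F hu) P :=
      ⟨fun i => hZ.1 (u i), fun i l hil => hZ.2 _ _ (hu hil)⟩
    have h1 := hfm.submartingale.mul_integral_upcrossingsBefore_le_integral_pos_part a b (j + 1)
    have hint : Integrable (fun ω => (upcrossingsBefore a b f (j + 1) ω : ℝ)) P :=
      hfm.1.integrable_upcrossingsBefore hab
    have h2 := mul_meas_ge_le_integral_of_nonneg (μ := P)
      (ae_of_all _ fun ω => Nat.cast_nonneg (upcrossingsBefore a b f (j + 1) ω)) hint (k : ℝ)
    have hsub : {ω | ∃ x, UpChain (e '' Iic n) (fun s => Z s ω) a b k x} ⊆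
        {ω | (k : ℝ) ≤ upcrossingsBefore a b f (j + 1) ω} := by
      rintro ω ⟨x, hx⟩
      have := upperCrossingTime_lt_of_upChain (X := Z) hu (n := j) (S := e '' Iic n) (by
          rintro _ ⟨i, hi, rfl⟩
          obtain ⟨l, hl, hle⟩ := hS (e i) (Finset.mem_insert_of_mem
            (Finset.mem_image_of_mem e (Finset.mem_range.2 (Nat.lt_succ_of_le hi))))
          exact ⟨l, Nat.lt_succ_iff.1 (Finset.mem_range.1 hl), hle⟩)
        (c := 0) (j := 0) (fun i _ => i.zero_le) j.zero_le (by simp) hx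
      rw [zero_add] at this
      have h3 : k ≤ upcrossingsBefore a b f (j + 1) ω :=
        le_csSup (upperCrossingTime_lt_bddAbove hab) this
      exact_mod_cast (Nat.cast_le (α := ℝ)).2 h3
    have h3 : (k : ℝ≥0∞) * P {ω | (k : ℝ) ≤ upcrossingsBefore a b f (j + 1) ω} ≤
        ENNReal.ofReal (∫ ω, (upcrossingsBefore a b f (j + 1) ω : ℝ) ∂P) := by
      rw [← ENNReal.ofReal_natCast, ← ofReal_measureReal, ← ENNReal.ofReal_mul k.cast_nonneg]
      exact ENNReal.ofReal_le_ofReal h2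
    -- Past `j` the sampled sequence rests at `T`, so the bound does not depend on the finite set
    -- and survives the limit.
    have h4 : f (j + 1) = Z T := by
      rw [hf]
      simp only
      rw [hj _ (Nat.le_succ j)]
    calc (k : ℝ≥0∞) * (ENNReal.ofReal (b - a) *
          P {ω | ∃ x, UpChain (e '' Iic n) (fun s => Z s ω) a b k x})
        ≤ ENNReal.ofReal (b - a) *
          ((k : ℝ≥0∞) * P {ω | (k : ℝ) ≤ upcrossingsBefore a b f (j + 1) ω}) := by
          rw [mul_left_comm]
          gcongr
      _ ≤ ENNReal.ofReal (b - a) *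
          ENNReal.ofReal (∫ ω, (upcrossingsBefore a b f (j + 1) ω : ℝ) ∂P) := by gcongr
      _ ≤ C := by
          rw [← ENNReal.ofReal_mul (sub_pos.2 hab).le, hC]
          refine ENNReal.ofReal_le_ofReal (h1.trans (le_of_eq ?_))
          rw [h4]
  have key2 : ∀ k : ℕ, (k : ℝ≥0∞) * (ENNReal.ofReal (b - a) *
      P {ω | ∃ x, UpChain (range e) (fun s => Z s ω) a b k x}) ≤ C := by
    intro k
    have hU : P {ω | ∃ x, UpChain (range e) (fun s => Z s ω) a b k x} ≤
        ⨆ n, P {ω | ∃ x, UpChain (e '' Iic n) (fun s => Z s ω) a b k x} := by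
      rw [← Monotone.measure_iUnion]
      · refine measure_mono ?_
        rintro ω ⟨x, hx⟩
        obtain ⟨n, hn⟩ := hx.exists_finite
        exact mem_iUnion.2 ⟨n, x, hn⟩
      · rintro n n' hnn' ω ⟨x, hx⟩
        exact ⟨x, hx.mono_set (image_mono (Iic_subset_Iic.2 hnn'))⟩
    refine (mul_le_mul_right (mul_le_mul_right hU _) _).trans ?_
    rw [ENNReal.mul_iSup, ENNReal.mul_iSup]
    exact iSup_le fun n => key k n
  -- A positive probability would make `k * q` unbounded in `k`, against the bound `C`.
  have hnull : P {ω | ∀ k, ∃ x, UpChain (range e) (fun s => Z s ω) a b k x} = 0 := by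
    by_contra h0
    set q := ENNReal.ofReal (b - a) *
      P {ω | ∀ k, ∃ x, UpChain (range e) (fun s => Z s ω) a b k x} with hq
    have hq0 : q ≠ 0 := by
      refine mul_ne_zero ?_ h0
      simpa using hab
    have hk : ∀ k : ℕ, (k : ℝ≥0∞) * q ≤ C := fun k => by
      refine le_trans ?_ (key2 k)
      rw [hq]
      gcongr with ω
      intro h
      exact h k
    have hqtop : q ≠ ∞ := ENNReal.mul_ne_top ENNReal.ofReal_ne_top (measure_ne_top _ _)
    obtain ⟨k, hk'⟩ := ENNReal.exists_nat_gt (ENNReal.div_ne_top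
      (show C ≠ ∞ from ENNReal.ofReal_ne_top) hq0)
    have := (ENNReal.div_lt_iff (Or.inl hq0) (Or.inl hqtop)).1 hk'
    exact absurd this (not_lt.2 (hk k))
  rw [ae_iff]
  refine measure_mono_null ?_ hnull
  intro ω hω k
  by_contra h
  exact hω ⟨k, fun x hx => h ⟨x, hx⟩⟩

variable [TopologicalSpace ι] [OrderTopology ι]

/-- Oscillation to the left of `t` gives upcrossings one after another, each closer to `t`. -/
theorem upChain_of_frequently_left {D : Set ι} {z : ι → ℝ} {a b : ℝ} {t : ι}
    (ha : ∃ᶠ s in 𝓝[D ∩ Iio t] t, z s < a) (hb : ∃ᶠ s in 𝓝[D ∩ Iio t] t, b < z s) (k : ℕ) :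
    ∀ x < t, UpChain D z a b k x := by
  have h : ∀ {q : ι → Prop}, (∃ᶠ s in 𝓝[D ∩ Iio t] t, q s) → ∀ x < t, ∃ s ∈ D, x < s ∧ s < t ∧ q s := by
    intro q hq x hx
    have h1 : ∀ᶠ s in 𝓝[D ∩ Iio t] t, s ∈ D ∩ Iio t := self_mem_nhdsWithin
    have h2 : ∀ᶠ s in 𝓝[D ∩ Iio t] t, x < s := nhdsWithin_le_nhds (Ioi_mem_nhds hx)
    obtain ⟨s, hs, hs1, hs2⟩ := (hq.and_eventually (h1.and h2)).exists
    exact ⟨s, hs1.1, hs2, hs1.2, hs⟩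
  induction k with
  | zero => exact fun _ _ => trivial
  | succ k ih =>
    intro x hx
    obtain ⟨s, hs, hxs, hst, hsa⟩ := h ha x hx
    obtain ⟨s', hs', hxs', hst', hsb⟩ := h hb s hst
    exact ⟨s, hs, s', hs', hxs, hxs', hsa.le, hsb.le, ih s' hst'⟩

/-- Here the chain grows backwards: a new upcrossing is inserted between `t` and the start of the
chain already found. -/
theorem upChain_of_frequently_right {D : Set ι} {z : ι → ℝ} {a b : ℝ} {t v : ι} (htv : t < v)
    (ha : ∃ᶠ s in 𝓝[D ∩ Ioi t] t, z s < a) (hb : ∃ᶠ s in 𝓝[D ∩ Ioi t] t, b < z s) (k : ℕ) :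
    UpChain D z a b k t := by
  have h : ∀ {q : ι → Prop}, (∃ᶠ s in 𝓝[D ∩ Ioi t] t, q s) → ∀ x > t, ∃ s ∈ D, t < s ∧ s < x ∧ q s := by
    intro q hq x hx
    have h1 : ∀ᶠ s in 𝓝[D ∩ Ioi t] t, s ∈ D ∩ Ioi t := self_mem_nhdsWithin
    have h2 : ∀ᶠ s in 𝓝[D ∩ Ioi t] t, s < x := nhdsWithin_le_nhds (Iio_mem_nhds hx)
    obtain ⟨s, hs, hs1, hs2⟩ := (hq.and_eventually (h1.and h2)).exists
    exact ⟨s, hs1.1, hs1.2, hs2, hs⟩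
  suffices ∃ x > t, UpChain D z a b k x by
    obtain ⟨x, hx, hc⟩ := this
    exact hc.mono_start (le_of_lt hx)
  induction k with
  | zero => exact ⟨v, htv, trivial⟩
  | succ k ih =>
    obtain ⟨x, hx, hc⟩ := ih
    obtain ⟨s', hs', hts', hsx', hsb⟩ := h hb x hx
    obtain ⟨s, hs, hts, hss', hsa⟩ := h ha s' hts'
    -- The point `y` only serves as a starting time strictly between `t` and `s`.
    obtain ⟨y, hy, hty, hys, -⟩ := h ha s hts
    exact ⟨y, hty, s, hs, s', hs', hys, hss', hsa.le, hsb.le, hc.mono_start hsx'.le⟩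

/-- A bounded path without a one-sided limit oscillates across some rational interval, hence crosses
it arbitrarily often. -/
theorem exists_tendsto_of_not_upChain {D : Set ι} {z : ι → ℝ} {c : ℝ} (hc : ∀ s ∈ D, |z s| ≤ c)
    (h : ∀ a b : ℚ, (a : ℝ) < b → ∃ k, ∀ x, ¬ UpChain D z a b k x) (t : ι) :
    (∀ x < t, ∃ l, Tendsto z (𝓝[D ∩ Iio t] t) (𝓝 l)) ∧
    (∀ x > t, ∃ l, Tendsto z (𝓝[D ∩ Ioi t] t) (𝓝 l)) := by
  have hbdd : ∀ {A : Set ι}, (∀ᶠ s in 𝓝[D ∩ A] t, z s ≤ c) ∧ (∀ᶠ s in 𝓝[D ∩ A] t, -c ≤ z s) :=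
    ⟨eventually_of_mem self_mem_nhdsWithin fun s hs => (abs_le.1 (hc s hs.1)).2,
      eventually_of_mem self_mem_nhdsWithin fun s hs => (abs_le.1 (hc s hs.1)).1⟩
  have hdense : Dense (range ((↑) : ℚ → ℝ)) := Rat.denseRange_cast
  constructor
  · intro x hx
    refine tendsto_of_no_upcrossings hdense ?_ (isBoundedUnder_of_eventually_le hbdd.1)
      (isBoundedUnder_of_eventually_ge hbdd.2)
    rintro _ ⟨a, rfl⟩ _ ⟨b, rfl⟩ hab ⟨ha, hb⟩
    obtain ⟨k, hk⟩ := h a b hab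
    exact hk x (upChain_of_frequently_left ha hb k x hx)
  · intro x hx
    refine tendsto_of_no_upcrossings hdense ?_ (isBoundedUnder_of_eventually_le hbdd.1)
      (isBoundedUnder_of_eventually_ge hbdd.2)
    rintro _ ⟨a, rfl⟩ _ ⟨b, rfl⟩ hab ⟨ha, hb⟩
    obtain ⟨k, hk⟩ := h a b hab
    exact hk t (upChain_of_frequently_right hx ha hb k)

end UpChain

/-! ### Regularization of martingales -/

section RightLimit

variable {T : ℝ} {d : ℕ}

theorem neBot_nhdsWithin_inter_Ioi {D : Set (Time T)} (hD : Dense D) {s t : Time T} (h : s < t) :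
    (𝓝[D ∩ Ioi s] s).NeBot := by
  have := nhdsGT_neBot h
  rw [← mem_closure_iff_nhdsWithin_neBot, inter_comm]
  have h1 := hD.open_subset_closure_inter (isOpen_Ioi (a := s))
  have h2 : s ∈ closure (Ioi s) := mem_closure_iff_nhdsWithin_neBot.2 inferInstance
  exact closure_minimal h1 isClosed_closure h2

open Classical in
/-- The path of the right limits of `z` along `D`, with the value of `z` at the terminal time. -/
noncomputable def rightLimitPath (hT : 0 < T) (D : Set (Time T)) (z : Time T → Vec d) :
    Time T → Vec d :=
  fun t => if t = tEnd hT then z t else limUnder (𝓝[D ∩ Ioi t] t) z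

theorem rightLimitPath_tEnd (hT : 0 < T) (D : Set (Time T)) (z : Time T → Vec d) :
    rightLimitPath hT D z (tEnd hT) = z (tEnd hT) := if_pos rfl

theorem tendsto_rightLimitPath (hT : 0 < T) {D : Set (Time T)} (z : Time T → Vec d)
    {t : Time T} (ht : t < tEnd hT) (hR : ∃ l, Tendsto z (𝓝[D ∩ Ioi t] t) (𝓝 l)) :
    Tendsto z (𝓝[D ∩ Ioi t] t) (𝓝 (rightLimitPath hT D z t)) := by
  rw [rightLimitPath, if_neg ht.ne]
  exact tendsto_nhds_limUnder hR

/-- Closed sets are kept by limits. With closed neighbourhoods as a basis, this carries the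
behaviour of `z` along `D` over to the path of right limits. -/
theorem rightLimitPath_mem (hT : 0 < T) {D : Set (Time T)} (hD : Dense D) {z : Time T → Vec d}
    (hR : ∀ t < tEnd hT, ∃ l, Tendsto z (𝓝[D ∩ Ioi t] t) (𝓝 l)) {V : Set (Vec d)}
    (hV : IsClosed V) {x y : Time T} (h : ∀ s ∈ D, s ∈ Ioo x y → z s ∈ V) :
    ∀ s ∈ Ioo x y, rightLimitPath hT D z s ∈ V := by
  intro s hs
  have hsT : s < tEnd hT := hs.2.trans_le (le_tEnd hT y)
  have := neBot_nhdsWithin_inter_Ioi hD hsT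
  refine hV.mem_of_tendsto (tendsto_rightLimitPath hT z hsT (hR s hsT)) ?_
  filter_upwards [self_mem_nhdsWithin, nhdsWithin_le_nhds (Iio_mem_nhds hs.2)] with v hv hv'
  exact h v hv.1 ⟨hs.1.trans hv.2, hv'⟩

theorem rightLimitPath_rcll (hT : 0 < T) {D : Set (Time T)} (hD : Dense D) {z : Time T → Vec d}
    (hR : ∀ t < tEnd hT, ∃ l, Tendsto z (𝓝[D ∩ Ioi t] t) (𝓝 l))
    (hL : ∀ t > tInit hT, ∃ l, Tendsto z (𝓝[D ∩ Iio t] t) (𝓝 l)) (t : Time T) :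
    ContinuousWithinAt (rightLimitPath hT D z) (Ici t) t ∧
      ∃ l, Tendsto (rightLimitPath hT D z) (𝓝[<] t) (𝓝 l) := by
  constructor
  · rcases (le_tEnd hT t).eq_or_lt with rfl | ht
    · have : Ici (tEnd hT) = {tEnd hT} := by
        ext s
        exact ⟨fun h => le_antisymm (le_tEnd hT s) h, fun h => (mem_singleton_iff.1 h).ge⟩
      rw [this]
      exact continuousWithinAt_singleton
    · rw [← continuousWithinAt_Ioi_iff_Ici]
      refine (closed_nhds_basis _).tendsto_right_iff.2 fun V ⟨hV, hVc⟩ => ?_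
      have h1 := tendsto_rightLimitPath hT z ht (hR t ht) hV
      rw [mem_map, inter_comm, nhdsWithin_inter', mem_inf_principal,
        mem_nhdsGT_iff_exists_Ioo_subset' ht] at h1
      obtain ⟨u, hu, hsub⟩ := h1
      filter_upwards [Ioo_mem_nhdsGT hu] with s hs
      exact rightLimitPath_mem hT hD hR hVc (fun v hv hv' => hsub hv' hv) s hs
  · rcases (tInit_le hT t).eq_or_lt with rfl | ht
    · have : Iio (tInit hT) = ∅ := by
        ext s
        simpa using tInit_le hT s
      rw [this, nhdsWithin_empty]
      exact ⟨0, tendsto_bot⟩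
    · obtain ⟨l, hl⟩ := hL t ht
      refine ⟨l, (closed_nhds_basis _).tendsto_right_iff.2 fun V ⟨hV, hVc⟩ => ?_⟩
      have h1 := hl hV
      rw [mem_map, inter_comm, nhdsWithin_inter', mem_inf_principal,
        mem_nhdsLT_iff_exists_Ioo_subset' ht] at h1
      obtain ⟨u, hu, hsub⟩ := h1
      filter_upwards [Ioo_mem_nhdsLT hu] with s hs
      exact rightLimitPath_mem hT hD hR hVc (fun v hv hv' => hsub hv' hv) s hs

end RightLimit

section Regularization

variable {Ω : Type*} [mΩ : MeasurableSpace Ω] {P : Measure Ω} {T : ℝ} {d : ℕ}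

theorem exists_tendsto_of_apply {ι : Type*} {f : Filter ι} {z : ι → Vec d}
    (h : ∀ i, ∃ l, Tendsto (fun s => z s i) f (𝓝 l)) : ∃ l, Tendsto z f (𝓝 l) := by
  choose l hl using h
  refine ⟨WithLp.toLp 2 l, ?_⟩
  have h1 : Tendsto (fun s => WithLp.ofLp (z s)) f (𝓝 l) := tendsto_pi_nhds.2 hl
  exact ((PiLp.continuous_toLp 2 fun _ : Fin d => ℝ).tendsto l).comp h1

/-- Almost every path of a martingale has one-sided limits along a countable dense set. -/
theorem ae_exists_tendsto_of_martingale [IsFiniteMeasure P] (hT : 0 < T)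
    {F : Filtration (Time T) mΩ} {Z : Time T → Ω → Vec d} (hZ : Martingale Z F P)
    {e : ℕ → Time T} (hbdd : ∀ᵐ ω ∂P, ⨆ n, ‖Z (e n) ω‖ₑ < ∞) :
    ∀ᵐ ω ∂P,
      (∀ t < tEnd hT, ∃ l, Tendsto (fun s => Z s ω) (𝓝[range e ∩ Ioi t] t) (𝓝 l)) ∧
      (∀ t > tInit hT, ∃ l, Tendsto (fun s => Z s ω) (𝓝[range e ∩ Iio t] t) (𝓝 l)) := by
  have hcoord : ∀ i : Fin d, Martingale (fun t ω => Z t ω i) F P := by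
    intro i
    refine ⟨fun t => ?_, fun s t hst => ?_⟩
    · exact (EuclideanSpace.proj (𝕜 := ℝ) i).continuous.comp_stronglyMeasurable (hZ.1 t)
    · have h1 := (EuclideanSpace.proj (𝕜 := ℝ) i).comp_condExp_comm (μ := P) (m := F s)
        (hZ.integrable t)
      filter_upwards [h1, hZ.2 s t hst] with ω hω hω'
      rw [← hω']
      exact hω.symm
  have hup : ∀ᵐ ω ∂P, ∀ (i : Fin d) (a b : ℚ), (a : ℝ) < b →
      ∃ k, ∀ x, ¬ UpChain (range e) (fun s => Z s ω i) a b k x := by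
    refine ae_all_iff.2 fun i => ae_all_iff.2 fun a => ae_all_iff.2 fun b => ?_
    by_cases hab : (a : ℝ) < b
    · filter_upwards [ae_exists_not_upChain (hcoord i) (fun n => le_tEnd hT (e n)) hab] with ω hω _
      exact hω
    · exact ae_of_all _ fun ω h => absurd h hab
  filter_upwards [hup, hbdd] with ω hω hb
  have hc : ∀ i : Fin d, ∀ s ∈ range e, |Z s ω i| ≤ (⨆ n, ‖Z (e n) ω‖ₑ).toReal := by
    rintro i _ ⟨n, rfl⟩
    refine (PiLp.norm_apply_le (Z (e n) ω) i).trans ?_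
    rw [← toReal_enorm]
    exact ENNReal.toReal_mono hb.ne (le_iSup (fun n => ‖Z (e n) ω‖ₑ) n)
  exact ⟨fun t ht => exists_tendsto_of_apply fun i =>
      (exists_tendsto_of_not_upChain (hc i) (hω i) t).2 _ ht,
    fun t ht => exists_tendsto_of_apply fun i =>
      (exists_tendsto_of_not_upChain (hc i) (hω i) t).1 _ ht⟩

theorem UsualConditions.measurableSet_of_null {hT : 0 < T} {F : Filtration (Time T) mΩ}
    (hF : UsualConditions hT F P) {A : Set Ω} (hA : P A = 0) (t : Time T) :
    MeasurableSet[F t] A := F.mono (tInit_le hT t) A (hF.complete A hA)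

theorem UsualConditions.measurable_of_forall_gt {hT : 0 < T} {F : Filtration (Time T) mΩ}
    (hF : UsualConditions hT F P) {t : Time T} (ht : t < tEnd hT) {x : Ω → Vec d}
    (hx : ∀ s, t < s → Measurable[F s] x) : Measurable[F t] x := by
  have h1 := hF.rightCont.RC t
  rw [F.rightCont_eq_of_not_isMax (not_isMax_iff.2 ⟨_, ht⟩)] at h1
  intro B hB
  refine h1 _ ?_
  rw [MeasurableSpace.measurableSet_iInf]
  intro s
  rw [MeasurableSpace.measurableSet_iInf]
  intro hs
  exact hx s hs hB

/-- Under the usual conditions the martingale closed by an `L^r`-variable, `r > 1`, has a version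
with regular paths. -/
theorem exists_rcll_condExp [IsFiniteMeasure P] {hT : 0 < T} {F : Filtration (Time T) mΩ}
    (hF : UsualConditions hT F P) {x : Ω → Vec d} {r : ℝ} (hr : 1 < r)
    (hxm : StronglyMeasurable[F (tEnd hT)] x)
    (hint : Integrable x P) (hx : ∫⁻ ω, ‖x ω‖ₑ ^ r ∂P < ∞) :
    ∃ N : Time T → Ω → Vec d, IsRCLL N ∧ Adapted F N ∧ ∀ t, N t =ᵐ[P] P[x | F t] := by
  obtain ⟨e, he, he'⟩ := exists_dense_times hT
  set Z : Time T → Ω → Vec d := fun t => P[x | F t] with hZdef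
  have hZ : Martingale Z F P := martingale_condExp x F P
  have hZT : Z (tEnd hT) = x := condExp_of_stronglyMeasurable (F.le _) hxm hint
  -- Doob's majorant, integrable because `r > 1`. It bounds the paths for the upcrossing argument
  -- and dominates the passage to right limits.
  set H : Ω → ℝ≥0∞ := fun ω => ⨆ n, ‖Z (e n) ω‖ₑ with hH
  have hHm : Measurable H :=
    Measurable.iSup fun n => ((hZ.1 (e n)).mono (F.le _)).enorm
  have hHr : ∫⁻ ω, H ω ^ r ∂P < ∞ := by
    refine (lintegral_iSup_rpow_le hZ hr e fun n => le_tEnd hT (e n)).trans_lt ?_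
    rw [hZT]
    exact ENNReal.mul_lt_top (ENNReal.rpow_lt_top_of_nonneg (by linarith) ENNReal.ofReal_ne_top) hx
  have hHfin : ∀ᵐ ω ∂P, H ω < ∞ := by
    filter_upwards [ae_lt_top (hHm.pow_const r) hHr.ne] with ω hω
    exact (ENNReal.rpow_lt_top_iff_of_pos (by linarith)).1 hω
  have hHint : Integrable (fun ω => (H ω).toReal) P := by
    have h1 : ∫⁻ ω, H ω ∂P ≠ ∞ := by
      refine ne_top_of_le_ne_top ?_ (lintegral_mono (g := fun ω => 1 + H ω ^ r) fun ω => ?_)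
      · rw [lintegral_add_left measurable_const, lintegral_const]
        exact ENNReal.add_ne_top.2 ⟨ENNReal.mul_ne_top ENNReal.one_ne_top (measure_ne_top _ _), hHr.ne⟩
      · dsimp only
        rcases le_total (H ω) 1 with h | h
        · exact h.trans le_self_add
        · refine le_trans ?_ le_add_self
          conv_lhs => rw [← ENNReal.rpow_one (H ω)]
          exact ENNReal.rpow_le_rpow_of_exponent_le h hr.le
    exact integrable_toReal_of_lintegral_ne_top hHm.aemeasurable h1
  have hae := ae_exists_tendsto_of_martingale hT hZ (e := e) hHfin
  set G : Set Ω := {ω |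
    (∀ t < tEnd hT, ∃ l, Tendsto (fun s => Z s ω) (𝓝[range e ∩ Ioi t] t) (𝓝 l)) ∧
    (∀ t > tInit hT, ∃ l, Tendsto (fun s => Z s ω) (𝓝[range e ∩ Iio t] t) (𝓝 l))} with hG
  have hGc : P Gᶜ = 0 := hae
  -- The good set has a null complement, so completeness puts it into every `F t`; cutting off to
  -- `G` keeps adaptedness.
  have hGm : ∀ t, MeasurableSet[F t] G := fun t => by
    have := (hF.measurableSet_of_null hGc t).compl
    rwa [compl_compl] at this
  set N : Time T → Ω → Vec d := fun t =>
    G.indicator fun ω => rightLimitPath hT (range e) (fun s => Z s ω) t with hN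
  have hNG : ∀ t, ∀ ω ∈ G, N t ω = rightLimitPath hT (range e) (fun s => Z s ω) t :=
    fun t ω hω => indicator_of_mem hω _
  have happ : ∀ t < tEnd hT, ∃ v : ℕ → Time T, (∀ n, t < v n) ∧ (∀ s, t < s → ∀ᶠ n in atTop, v n < s) ∧
      (∀ n, v n ∈ range e) ∧ ∀ ω ∈ G, Tendsto (fun n => Z (v n) ω) atTop (𝓝 (N t ω)) := by
    intro t ht
    have := neBot_nhdsWithin_inter_Ioi he ht
    obtain ⟨v, hv⟩ := exists_seq_tendsto (𝓝[range e ∩ Ioi t] t)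
    have hv' : ∀ᶠ n in atTop, v n ∈ range e ∩ Ioi t := hv self_mem_nhdsWithin
    obtain ⟨k, hk⟩ := eventually_atTop.1 hv'
    have hvk : Tendsto (fun n => v (n + k)) atTop (𝓝[range e ∩ Ioi t] t) :=
      hv.comp (tendsto_add_atTop_nat k)
    refine ⟨fun n => v (n + k), fun n => (hk _ (Nat.le_add_left k n)).2, fun s hs => ?_,
      fun n => (hk _ (Nat.le_add_left k n)).1, fun ω hω => ?_⟩
    · exact hvk (nhdsWithin_le_nhds (Iio_mem_nhds hs))
    · rw [hNG t ω hω]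
      exact (tendsto_rightLimitPath hT (fun s => Z s ω) ht (hω.1 t ht)).comp hvk
  have hNT : ∀ ω ∈ G, N (tEnd hT) ω = Z (tEnd hT) ω := fun ω hω => by
    rw [hNG _ ω hω, rightLimitPath_tEnd]
  have hNa : Adapted F N := fun t => by
    rcases (le_tEnd hT t).eq_or_lt with rfl | ht
    · have : N (tEnd hT) = G.indicator (Z (tEnd hT)) := by
        ext1 ω
        by_cases hω : ω ∈ G
        · rw [hNT ω hω, indicator_of_mem hω]
        · simp only [hN, indicator_of_notMem hω]
      rw [this]
      exact (hZ.1 _).measurable.indicator (hGm _)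
    -- The right limit at `t` is measurable for every `F s` with `s > t`, hence for `F t` by right
    -- continuity of the filtration.
    · refine hF.measurable_of_forall_gt ht fun s hs => ?_
      obtain ⟨v, -, hvs, -, hvN⟩ := happ t ht
      obtain ⟨k, hk⟩ := eventually_atTop.1 (hvs s hs)
      refine (stronglyMeasurable_of_tendsto atTop (f := fun n => G.indicator (Z (v (n + k))))
        (fun n => ?_) (tendsto_pi_nhds.2 fun ω => ?_)).measurable
      · exact ((hZ.1 _).mono (F.mono (hk _ (Nat.le_add_left k n)).le)).indicator (hGm s)
      · by_cases hω : ω ∈ G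
        · simp only [indicator_of_mem hω]
          exact (hvN ω hω).comp (tendsto_add_atTop_nat k)
        · have : N t ω = 0 := indicator_of_notMem hω _
          simp only [indicator_of_notMem hω, this]
          exact tendsto_const_nhds
  refine ⟨N, fun ω t => ?_, hNa, fun t => ?_⟩
  · by_cases hω : ω ∈ G
    · have : (fun s => N s ω) = rightLimitPath hT (range e) (fun s => Z s ω) :=
        funext fun s => hNG s ω hω
      rw [this]
      exact rightLimitPath_rcll hT he hω.1 hω.2 t
    · have : (fun s => N s ω) = fun _ => 0 := funext fun s => indicator_of_notMem hω _
      rw [this]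
      exact ⟨continuousWithinAt_const, 0, tendsto_const_nhds⟩
  · rcases (le_tEnd hT t).eq_or_lt with rfl | ht
    · filter_upwards [hae] with ω hω
      exact hNT ω hω
    · obtain ⟨v, hvt, -, hve, hvN⟩ := happ t ht
      have hNm : StronglyMeasurable[F t] (N t) := (hNa t).stronglyMeasurable
      have hbound : ∀ n, ∀ᵐ ω ∂P, ‖Z (v n) ω‖ ≤ (H ω).toReal := by
        intro n
        obtain ⟨k, hk⟩ := hve n
        filter_upwards [hHfin] with ω hω
        rw [← toReal_enorm, ← hk]
        exact ENNReal.toReal_mono hω.ne (le_iSup (fun n => ‖Z (e n) ω‖ₑ) k)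
      have hlim : ∀ᵐ ω ∂P, Tendsto (fun n => Z (v n) ω) atTop (𝓝 (N t ω)) := by
        filter_upwards [hae] with ω hω
        exact hvN ω hω
      have hNint : Integrable (N t) P := by
        refine hHint.mono' (hNm.mono (F.le t)).aestronglyMeasurable ?_
        filter_upwards [hlim, ae_all_iff.2 hbound] with ω hω hb
        exact le_of_tendsto' hω.norm hb
      -- `E[Z (v n) | F t] = Z t` for all `n`, and dominated convergence turns the left side into
      -- `E[N t | F t]`, which is `N t`.
      have h1 := tendsto_condExp_unique (m := F t) (fun n => Z (v n)) (fun _ => Z t) (N t) (Z t)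
        (fun n => hZ.integrable _) (fun n => hZ.integrable _) hlim
        (ae_of_all _ fun ω => tendsto_const_nhds) (fun ω => (H ω).toReal) hHint
        (fun ω => ‖Z t ω‖) (hZ.integrable t).norm hbound (fun n => ae_of_all _ fun ω => le_rfl)
        (fun n => by
          rw [condExp_of_stronglyMeasurable (F.le t) (hZ.1 t) (hZ.integrable t)]
          exact hZ.2 t (v n) (hvt n).le)
      rwa [condExp_of_stronglyMeasurable (F.le t) (hZ.1 t) (hZ.integrable t),
        condExp_of_stronglyMeasurable (F.le t) hNm hNint] at h1

end Regularization

/-! ### Operations on processes -/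

section Processes

variable {Ω : Type*} {T : ℝ} {d : ℕ} {X X' : Time T → Ω → Vec d}

theorem IsRCLL.add (hX : IsRCLL X) (hX' : IsRCLL X') : IsRCLL fun t ω => X t ω + X' t ω :=
  fun ω t => by
    obtain ⟨h1, l, hl⟩ := hX ω t
    obtain ⟨h1', l', hl'⟩ := hX' ω t
    exact ⟨h1.add h1', l + l', hl.add hl'⟩

theorem IsRCLL.sub (hX : IsRCLL X) (hX' : IsRCLL X') : IsRCLL fun t ω => X t ω - X' t ω :=
  fun ω t => by
    obtain ⟨h1, l, hl⟩ := hX ω t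
    obtain ⟨h1', l', hl'⟩ := hX' ω t
    exact ⟨h1.sub h1', l - l', hl.sub hl'⟩

theorem IsRCLL.smul (b : Ω → ℝ) (hX : IsRCLL X) : IsRCLL fun t ω => b ω • X t ω :=
  fun ω t => by
    obtain ⟨h1, l, hl⟩ := hX ω t
    exact ⟨(continuousWithinAt_const (b := b ω)).smul h1, b ω • l, hl.const_smul _⟩

theorem isRCLL_const (y : Ω → Vec d) : IsRCLL fun (_ : Time T) ω => y ω :=
  fun ω _ => ⟨continuousWithinAt_const, y ω, tendsto_const_nhds⟩

theorem isRCLL_of_continuous (h : ∀ ω, Continuous fun t => X t ω) : IsRCLL X :=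
  fun ω t => ⟨(h ω).continuousWithinAt, X t ω, ((h ω).tendsto t).mono_left nhdsWithin_le_nhds⟩

theorem supNorm_add_le (X X' : Time T → Ω → Vec d) (t : Time T) (ω : Ω) :
    supNorm (fun s ω => X s ω + X' s ω) t ω ≤ supNorm X t ω + supNorm X' t ω :=
  iSup₂_le fun _ hs => (enorm_add_le _ _).trans
    (add_le_add (le_iSup₂_of_le _ hs le_rfl) (le_iSup₂_of_le _ hs le_rfl))

theorem supNorm_sub_le (X X' : Time T → Ω → Vec d) (t : Time T) (ω : Ω) :
    supNorm (fun s ω => X s ω - X' s ω) t ω ≤ supNorm X t ω + supNorm X' t ω :=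
  iSup₂_le fun _ hs => (enorm_sub_le).trans
    (add_le_add (le_iSup₂_of_le _ hs le_rfl) (le_iSup₂_of_le _ hs le_rfl))

theorem supNorm_smul_le (b : Ω → ℝ) (X : Time T → Ω → Vec d) (t : Time T) (ω : Ω) :
    supNorm (fun s ω => b ω • X s ω) t ω ≤ ‖b ω‖ₑ * supNorm X t ω :=
  iSup₂_le fun _ hs => (enorm_smul (b ω) _).le.trans
    (mul_le_mul_right (le_iSup₂_of_le (f := fun s (_ : s ≤ t) => ‖X s ω‖ₑ) _ hs le_rfl) _)

theorem supNorm_const_le (y : Ω → Vec d) (t : Time T) (ω : Ω) :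
    supNorm (fun (_ : Time T) ω => y ω) t ω ≤ ‖y ω‖ₑ :=
  iSup₂_le fun _ _ => le_rfl

theorem supNorm_mono (X : Time T → Ω → Vec d) {s t : Time T} (h : s ≤ t) (ω : Ω) :
    supNorm X s ω ≤ supNorm X t ω :=
  iSup₂_le fun _ hs => le_iSup₂_of_le _ (hs.trans h) le_rfl

theorem supNorm_congr {ω : Ω} (h : ∀ t, X t ω = X' t ω) (t : Time T) :
    supNorm X t ω = supNorm X' t ω := by
  simp only [supNorm, h]

end Processes

/-! ### Generalized martingales and the stability estimate -/

section CondSupNorm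

variable {Ω : Type*} [mΩ : MeasurableSpace Ω] {P : Measure Ω} [IsFiniteMeasure P] {T : ℝ}
  {hT : 0 < T} {F : Filtration (Time T) mΩ} {p : ℝ≥0∞} {d : ℕ} {X X' : Time T → Ω → Vec d}

theorem measurable_condSupNorm (t : Time T) :
    Measurable[F (tInit hT)] (condSupNorm hT F P p X t) :=
  measurable_condNorm (F.le _)

theorem measurable_supNorm_of_adapted (hT : 0 < T) (hX : IsRCLL X) (ha : Adapted F X) (t : Time T) :
    Measurable (supNorm X t) :=
  measurable_supNorm hT hX (fun _ => ha.measurable) t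

theorem condSupNorm_le_add (hp : 1 < p) {Z Z' : Ω → ℝ≥0∞} {W : Time T → Ω → Vec d} {t : Time T}
    (hZ : Measurable Z) (hZ' : Measurable Z')
    (h : ∀ᵐ ω ∂P, supNorm W t ω ≤ Z ω + Z' ω) :
    condSupNorm hT F P p W t ≤ᵐ[P]
      fun ω => condNorm (F (tInit hT)) P p Z ω + condNorm (F (tInit hT)) P p Z' ω :=
  (condNorm_mono (F.le _) hp h).trans (condNorm_add_le (F.le _) hp hZ hZ')

/-- The conditional norm of a process divided by a bound for it. -/
theorem integrable_inv_smul (hp : 1 < p) (hX : IsRCLL X) (ha : Adapted F X) {a : Ω → ℝ}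
    (ham : Measurable[F (tInit hT)] a) (ha1 : ∀ ω, 1 ≤ a ω)
    (h : ∀ᵐ ω ∂P, condSupNorm hT F P p X (tEnd hT) ω ≤ ENNReal.ofReal (a ω)) (t : Time T) :
    Integrable (fun ω => (a ω)⁻¹ • X t ω) P := by
  have hm := F.le (tInit hT)
  have hsm := measurable_supNorm_of_adapted hT hX ha (tEnd hT)
  have him : Measurable[F (tInit hT)] fun ω => ENNReal.ofReal (a ω)⁻¹ :=
    ham.inv.ennreal_ofReal
  have h1 : condNorm (F (tInit hT)) P p
      (fun ω => ENNReal.ofReal (a ω)⁻¹ * supNorm X (tEnd hT) ω) ≤ᵐ[P] fun _ => 1 := by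
    filter_upwards [condNorm_mul_le hm hp him hsm, h] with ω h1 h2
    refine h1.trans ((mul_le_mul_right h2 _).trans (le_of_eq ?_))
    have : 0 < a ω := zero_lt_one.trans_le (ha1 ω)
    rw [← ENNReal.ofReal_mul (by positivity), inv_mul_cancel₀ this.ne', ENNReal.ofReal_one]
  -- The scaled supremum has conditional norm at most `1`, hence integral at most `1`.
  have h2 := setLIntegral_le_of_condNorm_le hm hp ((him.mono hm le_rfl).mul hsm)
    (@measurable_const _ _ _ (F (tInit hT)) _) h1 (@MeasurableSet.univ _ (F (tInit hT)))
  refine ⟨?_, ?_⟩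
  · exact ((ham.inv.mono hm le_rfl).smul ha.measurable).aestronglyMeasurable
  · refine lt_of_le_of_lt (lintegral_mono fun ω => ?_) ((setLIntegral_univ _).symm.le.trans_lt
      (h2.trans_lt ?_))
    · have : 0 < a ω := zero_lt_one.trans_le (ha1 ω)
      rw [enorm_smul, Real.enorm_eq_ofReal (inv_nonneg.2 this.le)]
      exact mul_le_mul_right (enorm_le_supNorm X (le_tEnd hT t) ω) _
    · simp

/-- A generalized martingale divided by an integrating factor is a martingale. -/
theorem IsGenMartingale.martingale_inv_smul {M : Time T → Ω → Vec d} (hM : IsGenMartingale F P M)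
    {a : Ω → ℝ} (ham : Measurable[F (tInit hT)] a) (ha1 : ∀ ω, 1 ≤ a ω)
    (hint : ∀ t, Integrable (fun ω => (a ω)⁻¹ • M t ω) P) :
    Martingale (fun t ω => (a ω)⁻¹ • M t ω) F P := by
  have hat : ∀ t, Measurable[F t] a := fun t => ham.mono (F.mono (tInit_le hT t)) le_rfl
  have hsm : ∀ t, StronglyMeasurable[F t] fun ω => (a ω)⁻¹ • M t ω := fun t =>
    ((hat t).inv.smul (hM.adapted t)).stronglyMeasurable
  refine ⟨hsm, fun s t hst => ?_⟩
  rcases hst.eq_or_lt with rfl | hst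
  · rw [condExp_of_stronglyMeasurable (F.le _) (hsm s) (hint s)]
  have hg := hM.condExp_eq s t hst
  have key : ∀ n : ℕ, ∀ᵐ ω ∂P, a ω ≤ n →
      P[fun ω => (a ω)⁻¹ • M t ω | F s] ω = (a ω)⁻¹ • M s ω := by
    intro n
    -- On `A` the variable `M t` is integrable, so its generalized conditional expectation is the
    -- ordinary one and `a` can be pulled out. The sets `{a ≤ n}` exhaust `Ω`.
    set A : Set Ω := {ω | a ω ≤ n} with hA
    have hAm : MeasurableSet[F s] A := measurableSet_le (hat s) measurable_const
    have hAm' : MeasurableSet A := F.le s _ hAm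
    have hMt : IntegrableOn (M t) A P := by
      refine Integrable.mono' (g := fun ω => n * ‖(a ω)⁻¹ • M t ω‖)
        ((hint t).norm.const_mul _).integrableOn
        (hM.adapted.measurable).aestronglyMeasurable ?_
      refine (ae_restrict_iff' hAm').2 (ae_of_all _ fun ω hω => ?_)
      have h0 : 0 < a ω := zero_lt_one.trans_le (ha1 ω)
      rw [norm_smul, norm_inv, Real.norm_of_nonneg h0.le, ← mul_assoc]
      refine le_mul_of_one_le_left (norm_nonneg _) ?_
      rw [← div_eq_mul_inv, one_le_div h0]
      exact hω
    have hW : Integrable (A.indicator (M t)) P := hMt.integrable_indicator hAm'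
    have hWs : P[A.indicator (M t) | F s] =ᵐ[P] A.indicator (M s) := by
      refine (ae_eq_condExp_of_forall_setIntegral_eq (F.le s) hW ?_ ?_ ?_).symm
      · intro B hB _
        have := (hg.integral_eq (B ∩ A) (hB.inter hAm) (hMt.mono_set inter_subset_right)).1
        rw [integrableOn_indicator_iff hAm', inter_comm]
        exact this
      · intro B hB _
        rw [setIntegral_indicator hAm', setIntegral_indicator hAm']
        exact (hg.integral_eq (B ∩ A) (hB.inter hAm) (hMt.mono_set inter_subset_right)).2
      · have hMs : Measurable[F s] (M s) := hM.adapted s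
        exact (hMs.stronglyMeasurable.indicator hAm).aestronglyMeasurable
    have hWeq : A.indicator (M t) = (A.indicator a) • fun ω => (a ω)⁻¹ • M t ω := by
      ext1 ω
      by_cases hω : ω ∈ A
      · have h0 : a ω ≠ 0 := (zero_lt_one.trans_le (ha1 ω)).ne'
        simp [hω, smul_smul, h0]
      · simp [hω]
    have hpull : P[A.indicator (M t) | F s] =ᵐ[P]
        (A.indicator a) • P[fun ω => (a ω)⁻¹ • M t ω | F s] := by
      rw [hWeq] at hW ⊢
      exact condExp_smul_of_aestronglyMeasurable_left
        ((hat s).indicator hAm).stronglyMeasurable.aestronglyMeasurable hW (hint t)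
    filter_upwards [hWs, hpull] with ω h1 h2 hω
    have hωA : ω ∈ A := hω
    have h0 : a ω ≠ 0 := (zero_lt_one.trans_le (ha1 ω)).ne'
    rw [h1] at h2
    simp only [Pi.smul_apply', indicator_of_mem hωA] at h2
    rw [h2, smul_smul, inv_mul_cancel₀ h0, one_smul]
  filter_upwards [ae_all_iff.2 key] with ω hω
  obtain ⟨n, hn⟩ := exists_nat_ge (a ω)
  exact hω n hn

/-- A martingale multiplied by an initial random variable is a generalized martingale. -/
theorem isGenMartingale_smul {N : Time T → Ω → Vec d} (hN : Martingale N F P) {b : Ω → ℝ}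
    (hb : Measurable[F (tInit hT)] b) : IsGenMartingale F P fun t ω => b ω • N t ω := by
  have hbt : ∀ t, Measurable[F t] b := fun t => hb.mono (F.mono (tInit_le hT t)) le_rfl
  have had : Adapted F fun t ω => b ω • N t ω := fun t => (hbt t).smul (hN.1 t).measurable
  refine ⟨had, fun s t hst => ⟨⟨fun n => {ω | |b ω| ≤ n}, ?_, fun n => ?_, ?_, fun n => ?_⟩,
    had s, fun A hA hint => ?_⟩⟩
  · intro n k hnk ω hω
    have h1 : |b ω| ≤ n := hω
    exact h1.trans (Nat.cast_le.2 hnk)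
  · exact measurableSet_le (continuous_abs.measurable.comp (hbt s)) measurable_const
  · refine eq_univ_of_forall fun ω => ?_
    obtain ⟨n, hn⟩ := exists_nat_ge |b ω|
    exact mem_iUnion.2 ⟨n, hn⟩
  · have hAm : MeasurableSet {ω | |b ω| ≤ n} :=
      measurableSet_le (hb.mono (F.le _) le_rfl).abs measurable_const
    refine Integrable.mono' (g := fun ω => n * ‖N t ω‖)
      ((hN.integrable t).norm.const_mul _).integrableOn had.measurable.aestronglyMeasurable ?_
    refine (ae_restrict_iff' hAm).2 (ae_of_all _ fun ω hω => ?_)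
    rw [norm_smul]
    exact mul_le_mul_of_nonneg_right hω (norm_nonneg _)
  · have hA' : MeasurableSet A := F.le s _ hA
    have heq : ∀ r, A.indicator (fun ω => b ω • N r ω) = (A.indicator b) • N r := by
      intro r
      ext1 ω
      by_cases hω : ω ∈ A <;> simp [hω]
    have hint' : Integrable (A.indicator b • N t) P := by
      rw [← heq]
      exact hint.integrable_indicator hA'
    have hpull : P[A.indicator b • N t | F s] =ᵐ[P] A.indicator b • N s := by
      refine (condExp_smul_of_aestronglyMeasurable_left
        ((hbt s).stronglyMeasurable.indicator hA).aestronglyMeasurable hint'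
        (hN.integrable t)).trans ?_
      filter_upwards [hN.2 s t hst.le] with ω hω
      simp only [Pi.smul_apply', hω]
    refine ⟨?_, ?_⟩
    · rw [← integrable_indicator_iff hA', heq]
      exact integrable_condExp.congr hpull
    · rw [← integral_indicator hA', ← integral_indicator hA', heq, heq,
        ← integral_congr_ae hpull, integral_condExp (F.le s)]

theorem martingale_const_process (hT : 0 < T) {y : Ω → Vec d} (hy : Measurable[F (tInit hT)] y)
    (hint : Integrable y P) : Martingale (fun _ => y) F P := by
  have hyt : ∀ t, StronglyMeasurable[F t] y := fun t =>
    (hy.mono (F.mono (tInit_le hT t)) le_rfl).stronglyMeasurable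
  refine ⟨hyt, fun s t _ => ?_⟩
  rw [condExp_of_stronglyMeasurable (F.le s) (hyt s) hint]

/-- The stability estimate for the pair formed by the initial value and the martingale part. -/
theorem enorm_sub_le_and_condSupNorm_sub_le (hp : 1 < p) {y y' : Ω → Vec d}
    (hy : Measurable[F (tInit hT)] y) (hy' : Measurable[F (tInit hT)] y')
    {M M' : Time T → Ω → Vec d} (hM : MemM0 hT F P p M) (hM' : MemM0 hT F P p M')
    {η : Ω → ℝ≥0∞} (hη : Measurable[F (tInit hT)] η)
    (h : condNorm (F (tInit hT)) P p
      (fun ω => ‖(y ω - M (tEnd hT) ω) - (y' ω - M' (tEnd hT) ω)‖ₑ) ≤ᵐ[P] η) :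
    ∀ᵐ ω ∂P, ‖y ω - y' ω‖ₑ + condSupNorm hT F P p (fun t ω => M t ω - M' t ω) (tEnd hT) ω ≤
      ENNReal.ofReal (2 + doobConst p) * η ω := by
  have hm := F.le (tInit hT)
  -- A single normalizer, measurable for `F_0`, that makes `M`, `M'` and `y - y'` integrable at
  -- once.
  set a : Ω → ℝ := fun ω => 1 + (condSupNorm hT F P p M (tEnd hT) ω).toReal +
    (condSupNorm hT F P p M' (tEnd hT) ω).toReal + ‖y ω - y' ω‖ with ha
  have hyy : Measurable[F (tInit hT)] fun ω => y ω - y' ω := hy.sub hy'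
  have hyn : Measurable[F (tInit hT)] fun ω => ‖y ω - y' ω‖ := measurable_norm.comp hyy
  have hye : Measurable fun ω => ‖y ω - y' ω‖ₑ :=
    measurable_enorm.comp (hyy.mono hm le_rfl)
  have ham : Measurable[F (tInit hT)] a :=
    ((measurable_const.add (measurable_condSupNorm (tEnd hT)).ennreal_toReal).add
      (measurable_condSupNorm (tEnd hT)).ennreal_toReal).add hyn
  have ha1 : ∀ ω, 1 ≤ a ω := fun ω => by
    have h1 : 0 ≤ (condSupNorm hT F P p M (tEnd hT) ω).toReal := ENNReal.toReal_nonneg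
    have h2 : 0 ≤ (condSupNorm hT F P p M' (tEnd hT) ω).toReal := ENNReal.toReal_nonneg
    have h3 := norm_nonneg (y ω - y' ω)
    simp only [ha]
    linarith
  have ha0 : ∀ ω, 0 < a ω := fun ω => zero_lt_one.trans_le (ha1 ω)
  have haM : ∀ᵐ ω ∂P, condSupNorm hT F P p M (tEnd hT) ω ≤ ENNReal.ofReal (a ω) := by
    filter_upwards [hM.memS.norm_lt_top] with ω hω
    rw [← ENNReal.ofReal_toReal hω.ne]
    refine ENNReal.ofReal_le_ofReal ?_
    have h2 : 0 ≤ (condSupNorm hT F P p M' (tEnd hT) ω).toReal := ENNReal.toReal_nonneg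
    have h3 := norm_nonneg (y ω - y' ω)
    simp only [ha]
    linarith
  have haM' : ∀ᵐ ω ∂P, condSupNorm hT F P p M' (tEnd hT) ω ≤ ENNReal.ofReal (a ω) := by
    filter_upwards [hM'.memS.norm_lt_top] with ω hω
    rw [← ENNReal.ofReal_toReal hω.ne]
    refine ENNReal.ofReal_le_ofReal ?_
    have h2 : 0 ≤ (condSupNorm hT F P p M (tEnd hT) ω).toReal := ENNReal.toReal_nonneg
    have h3 := norm_nonneg (y ω - y' ω)
    simp only [ha]
    linarith
  have hN := hM.martingale.martingale_inv_smul ham ha1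
    (integrable_inv_smul hp hM.memS.rcll hM.memS.adapted ham ha1 haM)
  have hN' := hM'.martingale.martingale_inv_smul ham ha1
    (integrable_inv_smul hp hM'.memS.rcll hM'.memS.adapted ham ha1 haM')
  have hym : Measurable[F (tInit hT)] fun ω => (a ω)⁻¹ • (y ω - y' ω) :=
    ham.inv.smul (hy.sub hy')
  have hyint : Integrable (fun ω => (a ω)⁻¹ • (y ω - y' ω)) P := by
    refine Integrable.of_bound (hym.mono hm le_rfl).aestronglyMeasurable 1
      (ae_of_all _ fun ω => ?_)
    rw [norm_smul, norm_inv, Real.norm_of_nonneg (ha0 ω).le, ← div_eq_inv_mul, div_le_one (ha0 ω)]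
    have h1 : 0 ≤ (condSupNorm hT F P p M (tEnd hT) ω).toReal := ENNReal.toReal_nonneg
    have h2 : 0 ≤ (condSupNorm hT F P p M' (tEnd hT) ω).toReal := ENNReal.toReal_nonneg
    simp only [ha]
    linarith
  -- The martingale `((y - M) - (y' - M')) / a`. Its terminal value is controlled by `η / a`, and
  -- its initial value is `(y - y') / a` because `M` and `M'` start at zero.
  set R : Time T → Ω → Vec d := fun t ω =>
    (a ω)⁻¹ • (y ω - y' ω) - ((a ω)⁻¹ • M t ω - (a ω)⁻¹ • M' t ω) with hR
  have hRmart : Martingale R F P :=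
    (martingale_const_process hT hym hyint).sub (hN.sub hN')
  have hRrc : IsRCLL R :=
    (isRCLL_const _).sub ((hM.memS.rcll.smul _).sub (hM'.memS.rcll.smul _))
  have hReq : ∀ t ω, R t ω = (a ω)⁻¹ • ((y ω - M t ω) - (y' ω - M' t ω)) := by
    intro t ω
    simp only [hR, ← smul_sub]
    congr 1
    abel
  have henorm : ∀ ω, ‖(a ω)⁻¹‖ₑ = ENNReal.ofReal (a ω)⁻¹ := fun ω =>
    Real.enorm_eq_ofReal (inv_nonneg.2 (ha0 ω).le)
  have hinv : ∀ ω, ENNReal.ofReal (a ω) * ENNReal.ofReal (a ω)⁻¹ = 1 := fun ω => by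
    rw [← ENNReal.ofReal_mul (ha0 ω).le, mul_inv_cancel₀ (ha0 ω).ne', ENNReal.ofReal_one]
  have him : Measurable[F (tInit hT)] fun ω => ENNReal.ofReal (a ω)⁻¹ := ham.inv.ennreal_ofReal
  have hη' : Measurable[F (tInit hT)] fun ω => ENNReal.ofReal (a ω)⁻¹ * η ω := him.mul hη
  have hRT : condNorm (F (tInit hT)) P p (fun ω => ‖R (tEnd hT) ω‖ₑ) ≤ᵐ[P]
      fun ω => ENNReal.ofReal (a ω)⁻¹ * η ω := by
    have e : (fun ω => ‖R (tEnd hT) ω‖ₑ) = fun ω => ENNReal.ofReal (a ω)⁻¹ *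
        ‖(y ω - M (tEnd hT) ω) - (y' ω - M' (tEnd hT) ω)‖ₑ := by
      ext1 ω
      rw [hReq, enorm_smul, henorm]
    rw [e]
    refine (condNorm_mul_le hm hp him ?_).trans ?_
    · exact (((hy.mono hm le_rfl).sub hM.memS.adapted.measurable).sub
        ((hy'.mono hm le_rfl).sub hM'.memS.adapted.measurable)).enorm
    · filter_upwards [h] with ω hω
      gcongr
  have h1 := condSupNorm_le_of_martingale hT hp hRmart hRrc hη' hRT
  have h2 := enorm_condExp_le_of_condNorm_le hm hp (hRmart.integrable (tEnd hT))
    ((hRmart.1 _).mono (F.le _)).measurable hη' hRT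
  have h3 : ∀ᵐ ω ∂P, ‖y ω - y' ω‖ₑ ≤ η ω := by
    filter_upwards [h2, hRmart.2 _ _ (le_tEnd hT (tInit hT)), hM.init, hM'.init]
      with ω h2 h3 h4 h5
    rw [h3, hReq, h4, h5, enorm_smul, henorm] at h2
    simp only [Pi.zero_apply, sub_zero] at h2
    have := mul_le_mul_right h2 (ENNReal.ofReal (a ω))
    rwa [← mul_assoc, ← mul_assoc, hinv, one_mul, one_mul] at this
  have hRad : Adapted F R := fun t => (hRmart.1 t).measurable
  have hRsup := measurable_supNorm_of_adapted hT hRrc hRad (tEnd hT)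
  -- `M - M' = (y - y') - a R` costs `1 + doobConst p`; the initial value itself adds the remaining
  -- `1` of the constant `2 + doobConst p`.
  have h4 : condSupNorm hT F P p (fun t ω => M t ω - M' t ω) (tEnd hT) ≤ᵐ[P] fun ω =>
      condNorm (F (tInit hT)) P p (fun ω => ‖y ω - y' ω‖ₑ) ω +
      condNorm (F (tInit hT)) P p (fun ω => ENNReal.ofReal (a ω) * supNorm R (tEnd hT) ω) ω := by
    refine condSupNorm_le_add hp hye
      ((ham.ennreal_ofReal.mono hm le_rfl).mul hRsup) (ae_of_all _ fun ω => ?_)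
    have e : supNorm (fun t ω => M t ω - M' t ω) (tEnd hT) ω =
        supNorm (fun t ω => (y ω - y' ω) - a ω • R t ω) (tEnd hT) ω := by
      refine supNorm_congr (fun t => ?_) _
      rw [hReq, smul_smul, mul_inv_cancel₀ (ha0 ω).ne', one_smul]
      abel
    rw [e]
    refine (supNorm_sub_le _ _ _ _).trans (add_le_add (supNorm_const_le _ _ _) ?_)
    refine (supNorm_smul_le _ _ _ _).trans (le_of_eq ?_)
    rw [Real.enorm_eq_ofReal (ha0 ω).le]
  have hq : 0 ≤ doobConst p := by
    rw [doobConst]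
    split_ifs with hp'
    · exact zero_le_one
    · have := toReal_pos_of_one_lt hp hp'
      exact div_nonneg (by linarith) (by linarith)
  filter_upwards [h1, h3, h4, condNorm_le_self hm hp (measurable_enorm.comp hyy),
    condNorm_mul_le hm hp ham.ennreal_ofReal hRsup] with ω h1 h3 h4 h5 h6
  have h7 : ENNReal.ofReal (a ω) * condNorm (F (tInit hT)) P p (supNorm R (tEnd hT)) ω ≤
      ENNReal.ofReal (doobConst p) * η ω := by
    refine (mul_le_mul_right h1 _).trans (le_of_eq ?_)
    rw [mul_left_comm, ← mul_assoc (ENNReal.ofReal (a ω)), hinv, one_mul]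
  calc ‖y ω - y' ω‖ₑ + condSupNorm hT F P p (fun t ω => M t ω - M' t ω) (tEnd hT) ω
      ≤ η ω + (η ω + ENNReal.ofReal (doobConst p) * η ω) := by
        refine add_le_add h3 (h4.trans (add_le_add (h5.trans h3) (h6.trans h7)))
    _ = ENNReal.ofReal (2 + doobConst p) * η ω := by
        rw [ENNReal.ofReal_add zero_le_two hq, ENNReal.ofReal_ofNat]
        ring

end CondSupNorm

/-! ### Recovering the pair from its forward process and terminal value -/

section TerminalPair

variable {Ω : Type*} [mΩ : MeasurableSpace Ω] {P : Measure Ω} [IsFiniteMeasure P] {T : ℝ}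
  {hT : 0 < T} {F : Filtration (Time T) mΩ} {p : ℝ≥0∞} {d : ℕ}

theorem condNorm_lt_top_of_memLp {Ω : Type*} {m : MeasurableSpace Ω} [mΩ : MeasurableSpace Ω]
    {P : Measure Ω} [IsFiniteMeasure P] {p : ℝ≥0∞} {d : ℕ} (hm : m ≤ mΩ) (hp : 1 < p)
    {x : Ω → Vec d} (hx : MemLp x p P) : ∀ᵐ ω ∂P, condNorm m P p (fun ω => ‖x ω‖ₑ) ω < ∞ := by
  by_cases hp' : p = ∞
  · subst hp'
    have h1 : (fun ω => ‖x ω‖ₑ) ≤ᵐ[P] fun _ => eLpNorm x ∞ P := by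
      rw [eLpNorm_exponent_top]
      exact enorm_ae_le_eLpNormEssSup x P
    filter_upwards [(condNorm_top_le_iff hm (@measurable_const _ _ _ m _)).2 h1] with ω hω
    exact hω.trans_lt hx.2
  · have hp0 : p ≠ 0 := (zero_lt_one.trans hp).ne'
    have h1 := lintegral_rpow_enorm_lt_top_of_eLpNorm_lt_top hp0 hp' hx.2
    rw [condNorm, if_neg hp']
    filter_upwards [condLExp_lt_top (mΩ := m) h1.ne] with ω hω
    exact ENNReal.rpow_lt_top_of_nonneg (by positivity) hω.ne

theorem MemLpCond.condNorm_lt_top (hp : 1 < p) {ξ : Ω → Vec d} (hξ : MemLpCond hT F P p ξ) :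
    ∀ᵐ ω ∂P, condNorm (F (tInit hT)) P p (fun ω => ‖ξ ω‖ₑ) ω < ∞ := by
  have hm := F.le (tInit hT)
  obtain ⟨a, x, ha, hx, hxp, hξ⟩ := hξ
  have ham : Measurable[F (tInit hT)] fun ω => ‖a ω‖ₑ := measurable_enorm.comp ha
  have h1 : (fun ω => ‖ξ ω‖ₑ) =ᵐ[P] fun ω => ‖a ω‖ₑ * ‖x ω‖ₑ := by
    filter_upwards [hξ] with ω hω
    rw [hω, enorm_smul]
  filter_upwards [condNorm_congr hm hp h1, condNorm_lt_top_of_memLp hm hp hxp,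
    condNorm_mul_le (P := P) hm hp ham (hx.mono (F.le _) le_rfl).enorm] with ω h1 h2 h3
  rw [h1]
  exact h3.trans_lt (ENNReal.mul_lt_top enorm_lt_top h2)

/-- A conditionally `p`-integrable terminal value is closed by a multiple of a martingale with right
continuous paths. -/
theorem exists_martingale_smul (hF : UsualConditions hT F P) (hp : 1 < p) {V : Ω → Vec d}
    (hV : Measurable[F (tEnd hT)] V)
    (hfin : ∀ᵐ ω ∂P, condNorm (F (tInit hT)) P p (fun ω => ‖V ω‖ₑ) ω < ∞) :
    ∃ (b : Ω → ℝ) (N : Time T → Ω → Vec d), Measurable[F (tInit hT)] b ∧ IsRCLL N ∧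
      Martingale N F P ∧ (∀ᵐ ω ∂P, b ω • N (tEnd hT) ω = V ω) ∧
      ∀ᵐ ω ∂P, condSupNorm hT F P p N (tEnd hT) ω < ∞ := by
  have hm := F.le (tInit hT)
  set η := condNorm (F (tInit hT)) P p (fun ω => ‖V ω‖ₑ) with hη
  have hηm : Measurable[F (tInit hT)] η := measurable_condNorm hm
  -- Dividing by `b` brings the conditional norm of `V` below `1`, so `x = V / b` is integrable and
  -- generates an ordinary martingale.
  set b : Ω → ℝ := fun ω => 1 + (η ω).toReal with hb
  have hbm : Measurable[F (tInit hT)] b := measurable_const.add hηm.ennreal_toReal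
  have hb0 : ∀ ω, 0 < b ω := fun ω => by positivity
  have hVm : Measurable V := hV.mono (F.le _) le_rfl
  set x : Ω → Vec d := fun ω => (b ω)⁻¹ • V ω with hx
  have hxT : Measurable[F (tEnd hT)] x :=
    (hbm.mono (F.mono (tInit_le hT _)) le_rfl).inv.smul hV
  have hxm : Measurable x := hxT.mono (F.le _) le_rfl
  have him : Measurable[F (tInit hT)] fun ω => ENNReal.ofReal (b ω)⁻¹ := hbm.inv.ennreal_ofReal
  have hx1 : condNorm (F (tInit hT)) P p (fun ω => ‖x ω‖ₑ) ≤ᵐ[P] fun _ => 1 := by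
    have e : (fun ω => ‖x ω‖ₑ) = fun ω => ENNReal.ofReal (b ω)⁻¹ * ‖V ω‖ₑ := by
      ext1 ω
      rw [hx, enorm_smul, Real.enorm_eq_ofReal (inv_nonneg.2 (hb0 ω).le)]
    rw [e]
    filter_upwards [condNorm_mul_le (P := P) hm hp him hVm.enorm, hfin] with ω h1 h2
    refine h1.trans ?_
    rw [← hη, ← ENNReal.ofReal_toReal h2.ne, ← ENNReal.ofReal_mul (inv_nonneg.2 (hb0 ω).le),
      ENNReal.ofReal_le_one, ← div_eq_inv_mul, div_le_one (hb0 ω)]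
    simp [hb]
  have hone : Measurable[F (tInit hT)] fun _ : Ω => (1 : ℝ≥0∞) := @measurable_const _ _ _ (F _) _
  have huniv : MeasurableSet[F (tInit hT)] (univ : Set Ω) := @MeasurableSet.univ _ (F _)
  have hint : Integrable x P := by
    refine ⟨hxm.aestronglyMeasurable, ?_⟩
    have := setLIntegral_le_of_condNorm_le hm hp hxm.enorm hone hx1 huniv
    rw [setLIntegral_univ] at this
    refine this.trans_lt ?_
    simp
  -- Regularization needs a finite exponent; for `p = ∞` any one would do.
  obtain ⟨r, hr, hxr⟩ : ∃ r : ℝ, 1 < r ∧ ∫⁻ ω, ‖x ω‖ₑ ^ r ∂P < ∞ := by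
    by_cases hp' : p = ∞
    · subst hp'
      refine ⟨2, one_lt_two, ?_⟩
      have h1 := (condNorm_top_le_iff hm hone).1 hx1
      refine (lintegral_mono_ae (g := fun _ => 1) ?_).trans_lt (by simp)
      filter_upwards [h1] with ω hω
      exact ENNReal.rpow_le_one hω zero_le_two
    · refine ⟨p.toReal, toReal_pos_of_one_lt hp hp', ?_⟩
      have := (condNorm_le_iff hm hp hp' hone).1 hx1 univ huniv
      rw [setLIntegral_univ] at this
      refine this.trans_lt ?_
      simp
  obtain ⟨N, hN, hNa, hNc⟩ := exists_rcll_condExp hF hr hxT.stronglyMeasurable hint hxr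
  have hNm : Martingale N F P := by
    refine ⟨fun t => (hNa t).stronglyMeasurable, fun s t hst => ?_⟩
    exact ((condExp_congr_ae (hNc t)).trans (condExp_condExp_of_le (F.mono hst) (F.le t))).trans
      (hNc s).symm
  have hNT : N (tEnd hT) =ᵐ[P] x := by
    refine (hNc _).trans ?_
    rw [condExp_of_stronglyMeasurable (F.le _) hxT.stronglyMeasurable hint]
  refine ⟨b, N, hbm, hN, hNm, ?_, ?_⟩
  · filter_upwards [hNT] with ω hω
    rw [hω, hx, smul_smul, mul_inv_cancel₀ (hb0 ω).ne', one_smul]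
  · have h1 : condNorm (F (tInit hT)) P p (fun ω => ‖N (tEnd hT) ω‖ₑ) ≤ᵐ[P] fun _ => 1 := by
      refine (condNorm_congr hm hp ?_).le.trans hx1
      filter_upwards [hNT] with ω hω
      rw [hω]
    filter_upwards [condSupNorm_le_of_martingale hT hp hNm hN hone h1] with ω hω
    exact hω.trans_lt (by simp)

theorem memS_of_supNorm_le (hp : 1 < p) {W : Time T → Ω → Vec d} (hW : IsRCLL W)
    (ha : Adapted F W) {Z Z' : Ω → ℝ≥0∞} (hZ : Measurable Z) (hZ' : Measurable Z')
    (h : ∀ᵐ ω ∂P, supNorm W (tEnd hT) ω ≤ Z ω + Z' ω)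
    (hfin : ∀ᵐ ω ∂P, condNorm (F (tInit hT)) P p Z ω < ∞)
    (hfin' : ∀ᵐ ω ∂P, condNorm (F (tInit hT)) P p Z' ω < ∞) : MemS hT F P p W := by
  refine ⟨hW, ha, ?_⟩
  filter_upwards [condSupNorm_le_add (hT := hT) (F := F) hp hZ hZ' h, hfin, hfin'] with ω h1 h2 h3
  exact h1.trans_lt (ENNReal.add_lt_top.2 ⟨h2, h3⟩)

/-- Every forward process `X` that starts at zero is `Y - Y_0 + M` for a pair `(Y, M)` with prescribed
terminal value of `Y`. -/
theorem exists_pair_of_terminal (hF : UsualConditions hT F P) (hp : 1 < p) {ξ : Ω → Vec d}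
    (hξ : MemLpCond hT F P p ξ) {X : Time T → Ω → Vec d} (hX : MemS hT F P p X)
    (h0 : ∀ᵐ ω ∂P, X (tInit hT) ω = 0) :
    ∃ (Y : SpaceS hT F P p d) (M : SpaceM0 hT F P p d), (∀ᵐ ω ∂P, Y.1 (tEnd hT) ω = ξ ω) ∧
      ∀ᵐ ω ∂P, ∀ t, Y.1 t ω - Y.1 (tInit hT) ω + M.1 t ω = X t ω := by
  have hm := F.le (tInit hT)
  have hξfin := hξ.condNorm_lt_top hp
  obtain ⟨a, x, ha, hx, -, hax⟩ := hξ
  -- `V` is a version of `ξ - X_T` measurable for `F_T`; it should equal `Y_0 - M_T`.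
  set V : Ω → Vec d := fun ω => a ω • x ω - X (tEnd hT) ω with hV
  have hax' : Measurable[F (tEnd hT)] fun ω => a ω • x ω :=
    (ha.mono (F.mono (tInit_le hT _)) le_rfl).smul hx
  have hXT : Measurable[F (tEnd hT)] (X (tEnd hT)) := hX.adapted _
  have hVm : Measurable[F (tEnd hT)] V := hax'.sub hXT
  have hVfin : ∀ᵐ ω ∂P, condNorm (F (tInit hT)) P p (fun ω => ‖V ω‖ₑ) ω < ∞ := by
    have h1 : (fun ω => ‖V ω‖ₑ) ≤ᵐ[P] fun ω => ‖a ω • x ω‖ₑ + supNorm X (tEnd hT) ω :=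
      ae_of_all _ fun ω => enorm_sub_le.trans
        (add_le_add le_rfl (enorm_le_supNorm X le_rfl ω))
    have h2 : (fun ω => ‖a ω • x ω‖ₑ) =ᵐ[P] fun ω => ‖ξ ω‖ₑ := by
      filter_upwards [hax] with ω hω
      rw [hω]
    filter_upwards [condNorm_mono hm hp h1, condNorm_congr hm hp h2, hξfin, hX.norm_lt_top,
      condNorm_add_le (P := P) hm hp (hax'.mono (F.le _) le_rfl).enorm
        (measurable_supNorm_of_adapted hT hX.rcll hX.adapted (tEnd hT))] with ω h1 h2 h3 h4 h5
    refine (h1.trans h5).trans_lt (ENNReal.add_lt_top.2 ⟨?_, h4⟩)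
    rw [h2]
    exact h3
  obtain ⟨b, N, hb, hN, hNm, hNV, hNfin⟩ := exists_martingale_smul hF hp hVm hVfin
  have hNa : Adapted F N := fun t => (hNm.1 t).measurable
  have hbe : Measurable[F (tInit hT)] fun ω => ‖b ω‖ₑ := measurable_enorm.comp hb
  have hNs := measurable_supNorm_of_adapted hT hN hNa (tEnd hT)
  have hZ : Measurable fun ω => ‖b ω‖ₑ * supNorm N (tEnd hT) ω := (hbe.mono hm le_rfl).mul hNs
  have hZfin : ∀ᵐ ω ∂P, condNorm (F (tInit hT)) P p
      (fun ω => ‖b ω‖ₑ * supNorm N (tEnd hT) ω) ω < ∞ := by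
    filter_upwards [condNorm_mul_le (P := P) hm hp hbe hNs, hNfin] with ω h1 h2
    exact h1.trans_lt (ENNReal.mul_lt_top enorm_lt_top h2)
  have hN0 : Measurable[F (tInit hT)] (N (tInit hT)) := hNa _
  have hmart : IsGenMartingale F P fun t ω => b ω • (N (tInit hT) ω - N t ω) :=
    isGenMartingale_smul ((martingale_const_process hT hN0 (hNm.integrable _)).sub hNm) hb
  have hbt : ∀ t, Measurable[F t] b := fun t => hb.mono (F.mono (tInit_le hT t)) le_rfl
  -- With `b N_T = ξ - X_T` the choice is `Y = b N + X` and `M = b (N_0 - N)`. Then `Y_T = ξ`, and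
  -- `b N` cancels in `Y - Y_0 + M`.
  have hY : MemS hT F P p fun t ω => b ω • N t ω + X t ω := by
    refine memS_of_supNorm_le hp ((hN.smul b).add hX.rcll) (fun t => ?_) hZ
      (measurable_supNorm_of_adapted hT hX.rcll hX.adapted (tEnd hT)) (ae_of_all _ fun ω => ?_)
      hZfin hX.norm_lt_top
    · have h1 : Measurable[F t] (N t) := hNa t
      have h2 : Measurable[F t] (X t) := hX.adapted t
      exact ((hbt t).smul h1).add h2
    · exact (supNorm_add_le _ _ _ _).trans (add_le_add (supNorm_smul_le _ _ _ _) le_rfl)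
  have hM : MemM0 hT F P p fun t ω => b ω • (N (tInit hT) ω - N t ω) := by
    refine ⟨memS_of_supNorm_le hp (((isRCLL_const _).sub hN).smul b) hmart.adapted hZ hZ
      (ae_of_all _ fun ω => ?_) hZfin hZfin, hmart, ae_of_all _ fun ω => ?_⟩
    · refine (supNorm_smul_le _ _ _ _).trans ?_
      rw [← mul_add]
      refine mul_le_mul_right ((supNorm_sub_le _ _ _ _).trans (add_le_add ?_ le_rfl)) _
      exact (supNorm_const_le _ _ _).trans (enorm_le_supNorm N (le_tEnd hT _) ω)
    · simp
  refine ⟨⟨_, hY⟩, ⟨_, hM⟩, ?_, ?_⟩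
  · filter_upwards [hNV, hax] with ω h1 h2
    simp only [h1, hV, h2, sub_add_cancel]
  · filter_upwards [h0] with ω hω t
    simp only [hω, smul_sub]
    abel

end TerminalPair

/-! ### Drift processes -/

section TimeVol

variable {T : ℝ}

instance : IsFiniteMeasure (timeVol T) := by
  refine ⟨?_⟩
  rw [timeVol, comap_subtype_coe_apply measurableSet_Icc, image_univ, Subtype.range_coe,
    Real.volume_Icc]
  exact ENNReal.ofReal_lt_top

instance : NullSingletonClass (timeVol T) := by
  refine ⟨fun t => ?_⟩
  rw [timeVol, comap_subtype_coe_apply measurableSet_Icc, image_singleton, Real.volume_singleton]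

theorem setLIntegral_timeVol_ofReal (t : Time T) {φ : ℝ → ℝ} (hφ : Continuous φ)
    (h0 : ∀ s ∈ Icc (0 : ℝ) t, 0 ≤ φ s) :
    ∫⁻ s in Iic t, ENNReal.ofReal (φ s) ∂timeVol T = ENNReal.ofReal (∫ s in (0 : ℝ)..t, φ s) := by
  have e : (Subtype.val '' Iic t : Set ℝ) = Icc 0 (t : ℝ) := by
    ext x
    constructor
    · rintro ⟨s, hs, rfl⟩
      exact ⟨s.2.1, hs⟩
    · rintro ⟨h1, h2⟩
      exact ⟨⟨x, h1, h2.trans t.2.2⟩, h2, rfl⟩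
  rw [timeVol, setLIntegral_subtype measurableSet_Icc _ fun x => ENNReal.ofReal (φ x), e,
    intervalIntegral.integral_of_le t.2.1, ← integral_Icc_eq_integral_Ioc,
    ofReal_integral_eq_lintegral_ofReal (hφ.integrableOn_Icc)]
  exact (ae_restrict_iff' measurableSet_Icc).2 (ae_of_all _ h0)

end TimeVol

section Drift

variable {Ω : Type*} {T : ℝ} {d : ℕ}

open Classical in
/-- The process `-∫_0^t φ_s ds`, set to zero on the paths that are not integrable. -/
noncomputable def drift (φ : Time T → Ω → Vec d) : Time T → Ω → Vec d := fun t ω =>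
  if Integrable (fun s => φ s ω) (timeVol T) then -∫ s in Iic t, φ s ω ∂timeVol T else 0

theorem drift_of_integrable {φ : Time T → Ω → Vec d} {ω : Ω}
    (h : Integrable (fun s => φ s ω) (timeVol T)) (t : Time T) :
    drift φ t ω = -∫ s in Iic t, φ s ω ∂timeVol T := if_pos h

/-- Dominated convergence: as `t` varies, the indicator of `[0, t]` is discontinuous only at the
single point `s = t`, which has measure zero. -/
theorem continuous_drift (φ : Time T → Ω → Vec d) (ω : Ω) : Continuous fun t => drift φ t ω := by
  by_cases h : Integrable (fun s => φ s ω) (timeVol T)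
  · simp only [drift_of_integrable h, ← integral_indicator measurableSet_Iic]
    refine Continuous.neg (continuous_iff_continuousAt.2 fun t => ?_)
    refine continuousAt_of_dominated (bound := fun s => ‖φ s ω‖)
      (Eventually.of_forall fun u => (h.indicator measurableSet_Iic).aestronglyMeasurable)
      (Eventually.of_forall fun u => ae_of_all _ fun s => norm_indicator_le_norm_self _ _)
      h.norm ?_
    have hne : ∀ᵐ s ∂timeVol T, s ≠ t := by
      simp [ae_iff]
    filter_upwards [hne] with s hs
    rcases hs.lt_or_gt with hs | hs
    · refine (continuousAt_const (y := φ s ω)).congr ?_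
      filter_upwards [Ioi_mem_nhds hs] with u hu
      exact (indicator_of_mem (mem_Iic.2 (mem_Ioi.1 hu).le) fun s => φ s ω).symm
    · refine (continuousAt_const (y := 0)).congr ?_
      filter_upwards [Iio_mem_nhds hs] with u hu
      exact (indicator_of_notMem (fun h => not_le.2 (mem_Iio.1 hu) (mem_Iic.1 h)) fun s => φ s ω).symm
  · simp only [drift, if_neg h]
    exact continuous_const

theorem drift_tInit (hT : 0 < T) (φ : Time T → Ω → Vec d) (ω : Ω) : drift φ (tInit hT) ω = 0 := by
  have : (Iic (tInit hT) : Set (Time T)) = {tInit hT} := by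
    ext t
    exact ⟨fun h => le_antisymm h (tInit_le hT t), fun h => h.le⟩
  simp [drift, this]

theorem enorm_drift_le (φ : Time T → Ω → Vec d) (t : Time T) (ω : Ω) :
    ‖drift φ t ω‖ₑ ≤ ∫⁻ s in Iic t, ‖φ s ω‖ₑ ∂timeVol T := by
  by_cases h : Integrable (fun s => φ s ω) (timeVol T)
  · rw [drift_of_integrable h, enorm_neg]
    exact enorm_integral_le_lintegral_enorm _
  · simp [drift, h]

theorem supNorm_drift_le (φ : Time T → Ω → Vec d) (t : Time T) (ω : Ω) :
    supNorm (drift φ) t ω ≤ ∫⁻ s in Iic t, ‖φ s ω‖ₑ ∂timeVol T :=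
  iSup₂_le fun s hs => (enorm_drift_le φ s ω).trans (lintegral_mono_set (Iic_subset_Iic.2 hs))

theorem supNorm_drift_sub_le {φ φ' : Time T → Ω → Vec d} {ω : Ω}
    (h : Integrable (fun s => φ s ω) (timeVol T)) (h' : Integrable (fun s => φ' s ω) (timeVol T))
    (t : Time T) : supNorm (fun t ω => drift φ t ω - drift φ' t ω) t ω ≤
      ∫⁻ s in Iic t, ‖φ s ω - φ' s ω‖ₑ ∂timeVol T := by
  refine iSup₂_le fun s hs => ?_
  dsimp only
  rw [drift_of_integrable h, drift_of_integrable h', neg_sub_neg,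
    ← integral_sub h'.integrableOn h.integrableOn]
  refine (enorm_integral_le_lintegral_enorm _).trans ?_
  simp_rw [enorm_sub_rev (φ' _ ω)]
  exact lintegral_mono_set (Iic_subset_Iic.2 hs)

variable [mΩ : MeasurableSpace Ω] {P : Measure Ω} {hT : 0 < T} {F : Filtration (Time T) mΩ}

theorem measurable_uncurry_of_isProgressive (hT : 0 < T) {φ : Time T → Ω → Vec d}
    (hφ : IsProgressive F φ) : Measurable (Function.uncurry φ) := by
  have h1 : Measurable fun q : Iic (tEnd hT) × Ω => φ q.1 q.2 :=
    (hφ (tEnd hT)).mono (sup_le_sup le_rfl (MeasurableSpace.comap_mono (F.le _))) le_rfl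
  have h2 : Measurable fun q : Time T × Ω => ((⟨q.1, le_tEnd hT q.1⟩ : Iic (tEnd hT)), q.2) :=
    (measurable_fst.subtype_mk).prodMk measurable_snd
  exact h1.comp h2

theorem measurable_setIntegral_of_isProgressive {φ : Time T → Ω → Vec d}
    (hφ : IsProgressive F φ) (t : Time T) :
    Measurable[F t] fun ω => ∫ s in Iic t, φ s ω ∂timeVol T := by
  have key : ∀ (m : MeasurableSpace Ω),
      (Measurable[Subtype.instMeasurableSpace.prod m] fun q : Iic t × Ω => φ q.1 q.2) →
      Measurable[m] fun ω => ∫ s in Iic t, φ s ω ∂timeVol T := by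
    clear hφ
    intro m h1
    -- Progressive measurability speaks only of times up to `t`; stopping the time at `t` extends
    -- the integrand without changing the integral over `Iic t`.
    have h2 : Measurable[Subtype.instMeasurableSpace.prod m, Subtype.instMeasurableSpace.prod m]
        fun q : Time T × Ω => ((⟨min q.1 t, mem_Iic.2 (min_le_right _ _)⟩ : Iic t), q.2) := by
      exact ((measurable_fst.min measurable_const).subtype_mk).prodMk measurable_snd
    have h3 := (h1.comp h2).stronglyMeasurable
    have h4 : StronglyMeasurable[m] fun ω => ∫ s in Iic t, φ (min s t) ω ∂timeVol T := by
      exact h3.integral_prod_left' (μ := (timeVol T).restrict (Iic t))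
    have e : (fun ω => ∫ s in Iic t, φ s ω ∂timeVol T) =
        fun ω => ∫ s in Iic t, φ (min s t) ω ∂timeVol T := by
      ext1 ω
      refine setIntegral_congr_fun measurableSet_Iic fun s hs => ?_
      rw [mem_Iic] at hs
      simp only [min_eq_left hs]
    rw [e]
    exact h4.measurable
  exact key _ (hφ t)

/-- The exceptional paths form a null set, which completeness places in every `F t`. -/
theorem adapted_drift (hF : UsualConditions hT F P) {φ : Time T → Ω → Vec d}
    (hφ : IsProgressive F φ) (hint : ∀ᵐ ω ∂P, Integrable (fun s => φ s ω) (timeVol T)) :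
    Adapted F (drift φ) := by
  classical
  intro t
  have hG : MeasurableSet[F t] {ω | Integrable (fun s => φ s ω) (timeVol T)} := by
    rw [← compl_compl {ω | Integrable (fun s => φ s ω) (timeVol T)}]
    exact (hF.measurableSet_of_null (by exact hint) t).compl
  exact Measurable.ite hG (measurable_setIntegral_of_isProgressive hφ t).neg measurable_const

end Drift

/-! ### The Picard iteration -/

section Picard

/-- The forward process `Y - Y_0 + M`. -/
def forward {Ω : Type*} {T : ℝ} {d : ℕ} (hT : 0 < T) (Y M : Time T → Ω → Vec d) :
    Time T → Ω → Vec d :=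
  fun t ω => Y t ω - Y (tInit hT) ω + M t ω

variable {Ω : Type*} [mΩ : MeasurableSpace Ω] {P : Measure Ω} [IsProbabilityMeasure P] {T : ℝ}
  {hT : 0 < T} {F : Filtration (Time T) mΩ} {p : ℝ≥0∞} {d : ℕ}

theorem memS_forward (hp : 1 < p) {Y M : Time T → Ω → Vec d} (hY : MemS hT F P p Y)
    (hM : MemS hT F P p M) : MemS hT F P p (forward hT Y M) := by
  have hm := F.le (tInit hT)
  have hYs := measurable_supNorm_of_adapted hT hY.rcll hY.adapted (tEnd hT)
  have hMs := measurable_supNorm_of_adapted hT hM.rcll hM.adapted (tEnd hT)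
  refine memS_of_supNorm_le hp ((hY.rcll.sub (isRCLL_const _)).add hM.rcll) (fun t => ?_) hYs
    (hYs.add hMs) (ae_of_all _ fun ω => ?_) hY.norm_lt_top ?_
  · have h1 : Measurable[F t] (Y t) := hY.adapted t
    have h2 : Measurable[F t] (M t) := hM.adapted t
    have h3 : Measurable[F t] (Y (tInit hT)) :=
      (hY.adapted (tInit hT)).mono (F.mono (tInit_le hT t)) le_rfl
    exact (h1.sub h3).add h2
  · refine (supNorm_add_le (fun t ω => Y t ω - Y (tInit hT) ω) M _ _).trans ?_
    rw [Pi.add_apply, ← add_assoc]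
    refine add_le_add ((supNorm_sub_le _ _ _ _).trans (add_le_add le_rfl ?_)) le_rfl
    exact (supNorm_const_le _ _ _).trans (enorm_le_supNorm Y (le_tEnd hT _) ω)
  · filter_upwards [condNorm_add_le (P := P) hm hp hYs hMs, hY.norm_lt_top, hM.norm_lt_top]
      with ω h1 h2 h3
    exact h1.trans_lt (ENNReal.add_lt_top.2 ⟨h2, h3⟩)

theorem MemS.sub_norm_lt_top (hp : 1 < p) {Y Y' : Time T → Ω → Vec d} (hY : MemS hT F P p Y)
    (hY' : MemS hT F P p Y') (t : Time T) :
    ∀ᵐ ω ∂P, condSupNorm hT F P p (fun t ω => Y t ω - Y' t ω) t ω < ∞ := by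
  filter_upwards [condSupNorm_le_add (hT := hT) (F := F) (P := P) hp
    (W := fun t ω => Y t ω - Y' t ω) (t := t)
    (measurable_supNorm_of_adapted hT hY.rcll hY.adapted (tEnd hT))
    (measurable_supNorm_of_adapted hT hY'.rcll hY'.adapted (tEnd hT))
    (ae_of_all _ fun ω => (supNorm_mono _ (le_tEnd hT t) ω).trans (supNorm_sub_le Y Y' _ ω)),
    hY.norm_lt_top, hY'.norm_lt_top] with ω h1 h2 h3
  exact h1.trans_lt (ENNReal.add_lt_top.2 ⟨h2, h3⟩)

variable {hp : 1 < p} {f : Driver hT F P p d}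

theorem DriverRegular.measurable_uncurry (hf : DriverRegular hT F P hp f) (Y : SpaceS hT F P p d)
    (M : SpaceM0 hT F P p d) : Measurable (Function.uncurry fun s ω => f s ω Y M) :=
  measurable_uncurry_of_isProgressive hT (hf.progressive Y M)

theorem measurable_of_uncurry {Ω : Type*} {T : ℝ} {m : MeasurableSpace Ω} {g : Time T → Ω → ℝ≥0∞}
    (hg : Measurable[Subtype.instMeasurableSpace.prod m] (Function.uncurry g)) (t : Time T) :
    Measurable[m] (g t) := by
  exact hg.comp (@measurable_prodMk_left _ _ _ m t)

theorem measurable_lintegral_of_uncurry {φ : Time T → Ω → ℝ≥0∞}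
    (h : Measurable (Function.uncurry φ)) (A : Set (Time T)) :
    Measurable fun ω => ∫⁻ s in A, φ s ω ∂timeVol T :=
  h.lintegral_prod_left'

/-- Minkowski in time, with the Lipschitz condition at each fixed `s`. Conditional norms are chosen
separately for each `s` and need not be jointly measurable, so a jointly measurable majorant `g` is
carried along instead. -/
theorem condNorm_lintegral_driver_sub_le (hf : DriverRegular hT F P hp f) {C₁ C₂ : Ω → ℝ}
    (hC₁ : Measurable[F (tInit hT)] C₁) (hC₂ : Measurable[F (tInit hT)] C₂)
    (hlip : DriverLipschitz hT F P f C₁ C₂) {Y Y' : SpaceS hT F P p d} {M M' : SpaceM0 hT F P p d}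
    {g : Time T → Ω → ℝ≥0∞}
    (hg : Measurable[Subtype.instMeasurableSpace.prod (F (tInit hT))] (Function.uncurry g))
    {β : Ω → ℝ≥0∞} (hβ : Measurable[F (tInit hT)] β)
    (h : ∀ s, condSupNorm hT F P p (fun t ω => forward hT Y.1 M.1 t ω - forward hT Y'.1 M'.1 t ω) s
      ≤ᵐ[P] g s)
    (h' : ∀ᵐ ω ∂P, ‖Y.1 (tInit hT) ω - Y'.1 (tInit hT) ω‖ₑ +
      condSupNorm hT F P p (fun t ω => M.1 t ω - M'.1 t ω) (tEnd hT) ω ≤ β ω) (t : Time T) :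
    condNorm (F (tInit hT)) P p
      (fun ω => ∫⁻ s in Iic t, ‖f s ω Y M - f s ω Y' M'‖ₑ ∂timeVol T) ≤ᵐ[P] fun ω =>
      ∫⁻ s in Iic t, (ENNReal.ofReal (C₁ ω) * g s ω + ENNReal.ofReal (C₂ ω) * β ω) ∂timeVol T := by
  refine condNorm_lintegral_le (F.le _) hp ?_ ?_ (ae_of_all _ fun s => ?_)
  · exact ((hf.measurable_uncurry Y M).sub (hf.measurable_uncurry Y' M')).enorm
  · have h1 : Measurable[F (tInit hT)] fun ω => ENNReal.ofReal (C₂ ω) * β ω :=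
      hC₂.ennreal_ofReal.mul hβ
    exact ((hC₁.ennreal_ofReal.comp measurable_snd).mul hg).add (h1.comp measurable_snd)
  · filter_upwards [hlip s Y Y' M M', h s, h'] with ω h1 h2 h3
    exact h1.trans (add_le_add (mul_le_mul_right h2 _) (mul_le_mul_right h3 _))

/-- Comparison with the driver at `(0, 0)`: the difference is controlled by the Lipschitz condition,
with a majorant constant in time. -/
theorem condNorm_lintegral_driver_lt_top (hf : DriverRegular hT F P hp f) {C₁ C₂ : Ω → ℝ}
    (hC₁ : Measurable[F (tInit hT)] C₁) (hC₂ : Measurable[F (tInit hT)] C₂)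
    (hlip : DriverLipschitz hT F P f C₁ C₂) (Y : SpaceS hT F P p d) (M : SpaceM0 hT F P p d) :
    ∀ᵐ ω ∂P, condNorm (F (tInit hT)) P p (fun ω => ∫⁻ s, ‖f s ω Y M‖ₑ ∂timeVol T) ω < ∞ := by
  have hm := F.le (tInit hT)
  set Y₀ : SpaceS hT F P p d := ⟨0, memS_zero hT F P hp d⟩
  set M₀ : SpaceM0 hT F P p d := ⟨0, memM0_zero hT F P hp d⟩
  have hX := MemS.sub_norm_lt_top hp (memS_forward hp Y.2 M.2.memS)
    (memS_forward hp Y₀.2 M₀.2.memS) (tEnd hT)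
  have hMM := MemS.sub_norm_lt_top hp M.2.memS M₀.2.memS (tEnd hT)
  set G : Ω → ℝ≥0∞ := condSupNorm hT F P p
    (fun t ω => forward hT Y.1 M.1 t ω - forward hT Y₀.1 M₀.1 t ω) (tEnd hT) with hG
  have hGm : Measurable[F (tInit hT)] G := measurable_condSupNorm _
  set β : Ω → ℝ≥0∞ := fun ω => ‖Y.1 (tInit hT) ω - Y₀.1 (tInit hT) ω‖ₑ +
    condSupNorm hT F P p (fun t ω => M.1 t ω - M₀.1 t ω) (tEnd hT) ω with hβ
  have hYY : Measurable[F (tInit hT)] fun ω => Y.1 (tInit hT) ω - Y₀.1 (tInit hT) ω := by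
    have h1 : Measurable[F (tInit hT)] (Y.1 (tInit hT)) := Y.2.adapted _
    have h2 : Measurable[F (tInit hT)] (Y₀.1 (tInit hT)) := Y₀.2.adapted _
    exact h1.sub h2
  have hβm : Measurable[F (tInit hT)] β :=
    (measurable_enorm.comp hYY).add (measurable_condSupNorm (tEnd hT))
  have h1 := condNorm_lintegral_driver_sub_le hf hC₁ hC₂ hlip (Y := Y) (Y' := Y₀) (M := M)
    (M' := M₀) (g := fun _ => G) (by exact hGm.comp measurable_snd) hβm
    (fun s => condNorm_mono hm hp (ae_of_all _ fun ω => supNorm_mono _ (le_tEnd hT s) ω))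
    (ae_of_all _ fun ω => le_rfl) (tEnd hT)
  have hI : (Iic (tEnd hT) : Set (Time T)) = univ := eq_univ_of_forall fun t => le_tEnd hT t
  rw [hI] at h1
  simp only [Measure.restrict_univ, lintegral_const] at h1
  have hd := hf.measurable_uncurry Y M
  have hd₀ := hf.measurable_uncurry Y₀ M₀
  have h2 : (fun ω => ∫⁻ s, ‖f s ω Y M‖ₑ ∂timeVol T) ≤ᵐ[P] fun ω =>
      ∫⁻ s, ‖f s ω Y M - f s ω Y₀ M₀‖ₑ ∂timeVol T + ∫⁻ s, ‖f s ω Y₀ M₀‖ₑ ∂timeVol T := by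
    refine ae_of_all _ fun ω => ?_
    dsimp only
    have e : Measurable fun s => ‖f s ω Y₀ M₀‖ₑ := (hd₀.comp measurable_prodMk_right).enorm
    rw [← lintegral_add_right _ e]
    refine lintegral_mono fun s => ?_
    calc ‖f s ω Y M‖ₑ = ‖(f s ω Y M - f s ω Y₀ M₀) + f s ω Y₀ M₀‖ₑ := by rw [sub_add_cancel]
      _ ≤ _ := enorm_add_le _ _
  have h3 := measurable_lintegral_of_uncurry (φ := fun s ω => ‖f s ω Y M - f s ω Y₀ M₀‖ₑ)
    (hd.sub hd₀).enorm univ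
  have h4 := measurable_lintegral_of_uncurry (φ := fun s ω => ‖f s ω Y₀ M₀‖ₑ) hd₀.enorm univ
  simp only [Measure.restrict_univ] at h3 h4
  filter_upwards [h1, condNorm_mono hm hp h2, condNorm_add_le (P := P) hm hp h3 h4,
    hf.integrable_zero, hX, hMM] with ω h1 h2 h3 h4 h5 h6
  refine (h2.trans h3).trans_lt (ENNReal.add_lt_top.2 ⟨h1.trans_lt ?_, h4⟩)
  refine ENNReal.mul_lt_top (ENNReal.add_lt_top.2 ⟨ENNReal.mul_lt_top ENNReal.ofReal_lt_top h5,
    ENNReal.mul_lt_top ENNReal.ofReal_lt_top ?_⟩) (measure_lt_top _ _)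
  exact ENNReal.add_lt_top.2 ⟨enorm_lt_top, h6⟩

theorem ae_integrable_driver (hf : DriverRegular hT F P hp f) {C₁ C₂ : Ω → ℝ}
    (hC₁ : Measurable[F (tInit hT)] C₁) (hC₂ : Measurable[F (tInit hT)] C₂)
    (hlip : DriverLipschitz hT F P f C₁ C₂) (Y : SpaceS hT F P p d) (M : SpaceM0 hT F P p d) :
    ∀ᵐ ω ∂P, Integrable (fun s => f s ω Y M) (timeVol T) := by
  have hd := hf.measurable_uncurry Y M
  have h1 := measurable_lintegral_of_uncurry (φ := fun s ω => ‖f s ω Y M‖ₑ) hd.enorm univ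
  simp only [Measure.restrict_univ] at h1
  filter_upwards [ae_lt_top_of_condNorm (F.le _) hp h1
    (condNorm_lintegral_driver_lt_top hf hC₁ hC₂ hlip Y M)] with ω hω
  exact ⟨(hd.comp measurable_prodMk_right).aestronglyMeasurable, hω⟩

/-- `(Y', M')` is the image of `(Y, M)` under the Picard map. -/
structure PicardStep (f : Driver hT F P p d) (ξ : Ω → Vec d) (Y : SpaceS hT F P p d)
    (M : SpaceM0 hT F P p d) (Y' : SpaceS hT F P p d) (M' : SpaceM0 hT F P p d) : Prop where
  terminal : ∀ᵐ ω ∂P, Y'.1 (tEnd hT) ω = ξ ω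
  integrable : ∀ᵐ ω ∂P, Integrable (fun s => f s ω Y M) (timeVol T)
  forward_eq : ∀ᵐ ω ∂P, ∀ t, forward hT Y'.1 M'.1 t ω = drift (fun s ω => f s ω Y M) t ω

theorem exists_picardStep (hF : UsualConditions hT F P) {ξ : Ω → Vec d}
    (hξ : MemLpCond hT F P p ξ) (hf : DriverRegular hT F P hp f) {C₁ C₂ : Ω → ℝ}
    (hC₁ : Measurable[F (tInit hT)] C₁) (hC₂ : Measurable[F (tInit hT)] C₂)
    (hlip : DriverLipschitz hT F P f C₁ C₂) (Y : SpaceS hT F P p d) (M : SpaceM0 hT F P p d) :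
    ∃ (Y' : SpaceS hT F P p d) (M' : SpaceM0 hT F P p d), PicardStep f ξ Y M Y' M' := by
  have hint := ae_integrable_driver hf hC₁ hC₂ hlip Y M
  have hX : MemS hT F P p (drift fun s ω => f s ω Y M) := by
    refine ⟨isRCLL_of_continuous (continuous_drift _),
      adapted_drift hF (hf.progressive Y M) hint, ?_⟩
    have h1 : supNorm (drift fun s ω => f s ω Y M) (tEnd hT) ≤ᵐ[P]
        fun ω => ∫⁻ s, ‖f s ω Y M‖ₑ ∂timeVol T :=
      ae_of_all _ fun ω => (supNorm_drift_le _ _ ω).trans (setLIntegral_le_lintegral _ _)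
    filter_upwards [condNorm_mono (F.le (tInit hT)) hp h1,
      condNorm_lintegral_driver_lt_top hf hC₁ hC₂ hlip Y M] with ω h1 h2
    exact h1.trans_lt h2
  obtain ⟨Y', M', h1, h2⟩ := exists_pair_of_terminal hF hp hξ hX
    (ae_of_all _ fun ω => drift_tInit hT _ ω)
  exact ⟨Y', M', h1, hint, h2⟩

/-- Stability of pairs with the same terminal value. -/
theorem enorm_sub_le_of_terminal_eq (hp : 1 < p) {Y Y' : SpaceS hT F P p d}
    {M M' : SpaceM0 hT F P p d} (hterm : ∀ᵐ ω ∂P, Y.1 (tEnd hT) ω = Y'.1 (tEnd hT) ω)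
    {η : Ω → ℝ≥0∞} (hη : Measurable[F (tInit hT)] η)
    (h : condSupNorm hT F P p (fun t ω => forward hT Y.1 M.1 t ω - forward hT Y'.1 M'.1 t ω)
      (tEnd hT) ≤ᵐ[P] η) :
    ∀ᵐ ω ∂P, ‖Y.1 (tInit hT) ω - Y'.1 (tInit hT) ω‖ₑ +
      condSupNorm hT F P p (fun t ω => M.1 t ω - M'.1 t ω) (tEnd hT) ω ≤
      ENNReal.ofReal (2 + doobConst p) * η ω := by
  refine enorm_sub_le_and_condSupNorm_sub_le hp (Y.2.adapted _) (Y'.2.adapted _) M.2 M'.2 hη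
    (EventuallyLE.trans (condNorm_mono (F.le _) hp ?_) h)
  filter_upwards [hterm] with ω hω
  refine le_trans (le_of_eq ?_) (enorm_le_supNorm
    (fun t ω => forward hT Y.1 M.1 t ω - forward hT Y'.1 M'.1 t ω) (le_refl (tEnd hT)) ω)
  -- For equal terminal values the difference of the variables `Y_0 - M_T` is minus the difference
  -- of the forward processes at `T`.
  simp only [forward, hω]
  rw [← enorm_neg]
  congr 1
  abel

/-- The one-step estimate written only in terms of forward processes. The `C₂` term depends on the
whole horizon and is fed by stability, hence the value of `g` at the terminal time. -/
theorem PicardStep.condSupNorm_sub_le (hf : DriverRegular hT F P hp f) {C₁ C₂ : Ω → ℝ}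
    (hC₁ : Measurable[F (tInit hT)] C₁) (hC₂ : Measurable[F (tInit hT)] C₂)
    (hlip : DriverLipschitz hT F P f C₁ C₂) {ξ ξ' : Ω → Vec d} {Y Y' Z Z' : SpaceS hT F P p d}
    {M M' N N' : SpaceM0 hT F P p d} (h₁ : PicardStep f ξ Y M Z N) (h₂ : PicardStep f ξ' Y' M' Z' N')
    (hterm : ∀ᵐ ω ∂P, Y.1 (tEnd hT) ω = Y'.1 (tEnd hT) ω) {g : Time T → Ω → ℝ≥0∞}
    (hg : Measurable[Subtype.instMeasurableSpace.prod (F (tInit hT))] (Function.uncurry g))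
    (h : ∀ s, condSupNorm hT F P p (fun t ω => forward hT Y.1 M.1 t ω - forward hT Y'.1 M'.1 t ω) s
      ≤ᵐ[P] g s) (t : Time T) :
    condSupNorm hT F P p (fun t ω => forward hT Z.1 N.1 t ω - forward hT Z'.1 N'.1 t ω) t ≤ᵐ[P]
      fun ω => ∫⁻ s in Iic t, (ENNReal.ofReal (C₁ ω) * g s ω +
        ENNReal.ofReal (C₂ ω) * (ENNReal.ofReal (2 + doobConst p) * g (tEnd hT) ω)) ∂timeVol T := by
  have hgT : Measurable[F (tInit hT)] (g (tEnd hT)) :=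
    measurable_of_uncurry hg _
  have hβ : Measurable[F (tInit hT)]
      fun ω => ENNReal.ofReal (2 + doobConst p) * g (tEnd hT) ω := by
    exact hgT.const_mul _
  have h3 := condNorm_lintegral_driver_sub_le hf hC₁ hC₂ hlip hg hβ h
      (enorm_sub_le_of_terminal_eq hp hterm hgT (h _)) t
  have h4 : supNorm (fun t ω => forward hT Z.1 N.1 t ω - forward hT Z'.1 N'.1 t ω) t ≤ᵐ[P]
      fun ω => ∫⁻ s in Iic t, ‖f s ω Y M - f s ω Y' M'‖ₑ ∂timeVol T := by
    filter_upwards [h₁.integrable, h₂.integrable, h₁.forward_eq, h₂.forward_eq] with ω h1 h2 h3 h4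
    have h5 := supNorm_drift_sub_le (φ := fun s ω => f s ω Y M) (φ' := fun s ω => f s ω Y' M')
      h1 h2 t
    have h6 : supNorm (fun t ω => forward hT Z.1 N.1 t ω - forward hT Z'.1 N'.1 t ω) t ω =
        supNorm (fun t ω => drift (fun s ω => f s ω Y M) t ω - drift (fun s ω => f s ω Y' M') t ω)
          t ω := by
      refine supNorm_congr (fun s => ?_) t
      rw [h3, h4]
    rw [h6]
    exact h5
  have h5 := condNorm_mono (p := p) (F.le (tInit hT)) hp h4
  filter_upwards [h3, h5] with ω h6 h7
  exact h7.trans h6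

end Picard

/-! ### The contraction constant -/

theorem doobConst_nonneg {p : ℝ≥0∞} (hp : 1 < p) : 0 ≤ doobConst p := by
  rw [doobConst]
  split_ifs with h
  · exact zero_le_one
  · have := toReal_pos_of_one_lt hp h
    exact div_nonneg (by linarith) (by linarith)

/-- The product is `4/5` for `p = 2`, `3/4` for `p = ∞`, and `(3p - 2)/(4p - 1)` otherwise. -/
theorem cConst_mul_lt_one {p : ℝ≥0∞} (hp : 1 < p) :
    0 ≤ cConst p ∧ cConst p * (2 + doobConst p) < 1 := by
  rw [cConst, doobConst]
  by_cases h2 : p = 2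
  · subst h2
    norm_num
  by_cases h : p = ∞
  · subst h
    norm_num
  · have hr := toReal_pos_of_one_lt hp h
    rw [if_neg h2, if_neg h, if_neg h]
    have h1 : 0 < p.toReal - 1 := by linarith
    have h3 : 0 < 4 * p.toReal - 1 := by linarith
    refine ⟨by positivity, ?_⟩
    have e : (p.toReal - 1) / (4 * p.toReal - 1) * (2 + p.toReal / (p.toReal - 1)) =
        (3 * p.toReal - 2) / (4 * p.toReal - 1) := by
      field_simp
      ring
    rw [e, div_lt_one h3]
    linarith

/-- The contraction factor. -/
noncomputable def factor (T κ c : ℝ) : ℝ := 1 - (1 - κ) * (c * T) / (Real.exp (c * T) - 1)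

section Factor

variable {T κ c t : ℝ}

theorem exp_sub_one_pos (h : 0 < c) (hT : 0 < T) : 0 < Real.exp (c * T) - 1 :=
  sub_pos.2 (Real.one_lt_exp_iff.2 (mul_pos h hT))

theorem factor_mem (hc : 0 < c) (hT : 0 < T) (hκ : 0 ≤ κ) (hκ1 : κ < 1) :
    0 ≤ factor T κ c ∧ factor T κ c < 1 := by
  have h1 := exp_sub_one_pos hc hT
  have h2 : c * T ≤ Real.exp (c * T) - 1 := by linarith [Real.add_one_le_exp (c * T)]
  have h3 := mul_pos hc hT
  refine ⟨?_, ?_⟩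
  · rw [factor, sub_nonneg, div_le_one h1]
    nlinarith
  · rw [factor, sub_lt_self_iff]
    have : 0 < 1 - κ := by linarith
    positivity

/-- The exponential lies below its chord over `[0, c T]`. -/
theorem exp_sub_one_le_div_mul (hT : 0 < T) (ht : 0 ≤ t) (htT : t ≤ T) :
    Real.exp (c * t) - 1 ≤ t / T * (Real.exp (c * T) - 1) := by
  have h1 : t / T ≤ 1 := (div_le_one hT).2 htT
  have h2 : 0 ≤ t / T := div_nonneg ht hT.le
  have h := convexOn_exp.2 (mem_univ 0) (mem_univ (c * T)) (sub_nonneg.2 h1) h2 (by ring)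
  have e : t / T * (c * T) = c * t := by
    field_simp
  simp only [smul_eq_mul, mul_zero, zero_add, e, Real.exp_zero, mul_one] at h
  linarith

/-- The gain `(1 - κ) c t` is a fixed proportion of `exp (c t) - 1`, and by the chord bound this
proportion is smallest at `t = T`. This is where `factor` comes from. -/
theorem sub_le_factor_mul (hc : 0 < c) (hT : 0 < T) (hκ1 : κ ≤ 1) (ht : 0 ≤ t) (htT : t ≤ T) :
    Real.exp (c * t) - 1 - (1 - κ) * (c * t) ≤ factor T κ c * (Real.exp (c * t) - 1) := by
  have h1 := exp_sub_one_pos hc hT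
  have h2 := exp_sub_one_le_div_mul (c := c) hT ht htT
  have h3 : (1 - κ) * (c * T) / (Real.exp (c * T) - 1) * (Real.exp (c * t) - 1) ≤
      (1 - κ) * (c * t) := by
    have h4 : 0 ≤ (1 - κ) * (c * T) / (Real.exp (c * T) - 1) :=
      div_nonneg (mul_nonneg (by linarith) (mul_pos hc hT).le) h1.le
    refine (mul_le_mul_of_nonneg_left h2 h4).trans (le_of_eq ?_)
    field_simp
  rw [factor]
  linarith

theorem integral_exp_add (c b t : ℝ) :
    ∫ s in (0 : ℝ)..t, (c * (Real.exp (c * s) - 1) + b) = Real.exp (c * t) - 1 - c * t + b * t := by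
  have h : ∀ s ∈ uIcc 0 t, HasDerivAt (fun s => Real.exp (c * s) - c * s + b * s)
      (c * (Real.exp (c * s) - 1) + b) s := by
    intro s _
    have h1 : HasDerivAt (fun s : ℝ => c * s) c s := by
      simpa using (hasDerivAt_id s).const_mul c
    have h2 : HasDerivAt (fun s : ℝ => b * s) b s := by
      simpa using (hasDerivAt_id s).const_mul b
    convert! (h1.exp.sub h1).add h2 using 1
    ring
  rw [intervalIntegral.integral_eq_sub_of_hasDerivAt h
    (Continuous.intervalIntegrable (by fun_prop) _ _)]
  simp
  ring

/-- One Picard step applied to the weight. The integral is `K (exp (c t) - 1 - c t + b t)`, and the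
smallness condition says `b ≤ κ c`. -/
theorem setLIntegral_exp_le_factor_mul {c₂ m K : ℝ} (hc : 0 < c) (hT : 0 < T) (hκ1 : κ ≤ 1)
    (hc₂ : 0 ≤ c₂) (hm : 0 ≤ m) (hK : 0 ≤ K) (hle : c₂ * m * (Real.exp (c * T) - 1) ≤ κ * c)
    (t : Time T) :
    ∫⁻ s in Iic t, (ENNReal.ofReal c * ENNReal.ofReal (K * (Real.exp (c * s) - 1)) +
        ENNReal.ofReal c₂ * (ENNReal.ofReal m * ENNReal.ofReal (K * (Real.exp (c * T) - 1))))
        ∂timeVol T ≤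
      ENNReal.ofReal (factor T κ c * K * (Real.exp (c * t) - 1)) := by
  have hT0 := exp_sub_one_pos hc hT
  have hs0 : ∀ s : ℝ, 0 ≤ s → 0 ≤ Real.exp (c * s) - 1 := fun s hs =>
    sub_nonneg.2 (Real.one_le_exp (mul_nonneg hc.le hs))
  set b := c₂ * m * (Real.exp (c * T) - 1) with hb
  have hb0 : 0 ≤ b := by positivity
  have e : ∀ s : Time T, ENNReal.ofReal c * ENNReal.ofReal (K * (Real.exp (c * s) - 1)) +
      ENNReal.ofReal c₂ * (ENNReal.ofReal m * ENNReal.ofReal (K * (Real.exp (c * T) - 1))) =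
      ENNReal.ofReal (K * (c * (Real.exp (c * s) - 1) + b)) := by
    intro s
    have := hs0 s s.2.1
    rw [← ENNReal.ofReal_mul hc.le, ← ENNReal.ofReal_mul hm, ← ENNReal.ofReal_mul hc₂,
      ← ENNReal.ofReal_add (by positivity) (by positivity)]
    congr 1
    rw [hb]
    ring
  simp_rw [e]
  rw [setLIntegral_timeVol_ofReal t (φ := fun s => K * (c * (Real.exp (c * s) - 1) + b))
    (by fun_prop) fun s hs => by have := hs0 s hs.1; positivity,
    intervalIntegral.integral_const_mul, integral_exp_add]
  refine ENNReal.ofReal_le_ofReal ?_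
  have h1 := sub_le_factor_mul hc hT hκ1 t.2.1 t.2.2
  have h2 : b * t ≤ κ * c * t := mul_le_mul_of_nonneg_right hle t.2.1
  calc K * (Real.exp (c * t) - 1 - c * t + b * t)
      ≤ K * (factor T κ c * (Real.exp (c * t) - 1)) :=
        mul_le_mul_of_nonneg_left (by linarith) hK
    _ = _ := by ring

/-- Starts the recursion: a bound constant in time becomes, after one step, a multiple of the
weight, because `c t ≤ exp (c t) - 1`. -/
theorem setLIntegral_const_le_exp {c₂ m K : ℝ} (hc : 0 < c) (hc₂ : 0 ≤ c₂)
    (hm : 0 ≤ m) (hK : 0 ≤ K) (t : Time T) :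
    ∫⁻ _ in Iic t, (ENNReal.ofReal c * ENNReal.ofReal K +
        ENNReal.ofReal c₂ * (ENNReal.ofReal m * ENNReal.ofReal K)) ∂timeVol T ≤
      ENNReal.ofReal (K * (c + c₂ * m) / c * (Real.exp (c * t) - 1)) := by
  have e : ENNReal.ofReal c * ENNReal.ofReal K +
        ENNReal.ofReal c₂ * (ENNReal.ofReal m * ENNReal.ofReal K) =
      ENNReal.ofReal (K * (c + c₂ * m)) := by
    rw [← ENNReal.ofReal_mul hc.le, ← ENNReal.ofReal_mul hm, ← ENNReal.ofReal_mul hc₂,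
      ← ENNReal.ofReal_add (by positivity) (by positivity)]
    congr 1
    ring
  rw [e, setLIntegral_timeVol_ofReal t (φ := fun _ => K * (c + c₂ * m)) (by fun_prop)
    fun s hs => by positivity, intervalIntegral.integral_const, sub_zero, smul_eq_mul]
  refine ENNReal.ofReal_le_ofReal ?_
  have h1 : c * t ≤ Real.exp (c * t) - 1 := by linarith [Real.add_one_le_exp (c * t)]
  have h2 : 0 ≤ K * (c + c₂ * m) / c := by positivity
  refine le_trans (le_of_eq ?_) (mul_le_mul_of_nonneg_left h1 h2)
  field_simp

end Factor

/-! ### Limits of forward processes -/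

section Limit

variable {Ω : Type*} [mΩ : MeasurableSpace Ω] {P : Measure Ω} [IsFiniteMeasure P] {T : ℝ}
  {hT : 0 < T} {F : Filtration (Time T) mΩ} {p : ℝ≥0∞} {d : ℕ}

/-- Minkowski for series makes `∑ sup_t |X n - X (n + 1)|` conditionally `p`-integrable, hence
finite almost surely, so almost every path converges uniformly. The tails of the series bound the
distance to the limit. -/
theorem exists_continuous_limit (hF : UsualConditions hT F P) (hp : 1 < p)
    {X : ℕ → Time T → Ω → Vec d} (hX : ∀ n, MemS hT F P p (X n))
    (hc : ∀ n, ∀ᵐ ω ∂P, Continuous fun t => X n t ω) (h0 : ∀ n, ∀ᵐ ω ∂P, X n (tInit hT) ω = 0)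
    {g : ℕ → Ω → ℝ≥0∞} (hg : ∀ n, Measurable[F (tInit hT)] (g n))
    (hle : ∀ n, condSupNorm hT F P p (fun t ω => X n t ω - X (n + 1) t ω) (tEnd hT) ≤ᵐ[P] g n)
    (hsum : ∀ᵐ ω ∂P, ∑' n, g n ω < ∞) :
    ∃ X' : Time T → Ω → Vec d, MemS hT F P p X' ∧ (∀ᵐ ω ∂P, X' (tInit hT) ω = 0) ∧
      ∀ n, condSupNorm hT F P p (fun t ω => X n t ω - X' t ω) (tEnd hT) ≤ᵐ[P]
        fun ω => ∑' k, g (n + k) ω := by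
  classical
  have hm := F.le (tInit hT)
  set D : ℕ → Ω → ℝ≥0∞ := fun n => supNorm (fun t ω => X n t ω - X (n + 1) t ω) (tEnd hT) with hD
  have hDm : ∀ n, Measurable (D n) := fun n => by
    refine measurable_supNorm hT ((hX n).rcll.sub (hX (n + 1)).rcll) (fun t => ?_) _
    exact (hX n).adapted.measurable.sub (hX (n + 1)).adapted.measurable
  have hDn : ∀ n, condNorm (F (tInit hT)) P p (fun ω => ∑' k, D (n + k) ω) ≤ᵐ[P]
      fun ω => ∑' k, g (n + k) ω := fun n =>
    condNorm_tsum_le hm hp (fun k => hDm (n + k)) (fun k => hg (n + k)) fun k => hle (n + k)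
  have hDfin : ∀ᵐ ω ∂P, condNorm (F (tInit hT)) P p (fun ω => ∑' k, D k ω) ω < ∞ := by
    have := hDn 0
    simp only [zero_add] at this
    filter_upwards [this, hsum] with ω h1 h2 using h1.trans_lt h2
  have hDsm : Measurable fun ω => ∑' k, D k ω := Measurable.tsum hDm
  set G : Set Ω := {ω | ∑' n, D n ω ≠ ∞ ∧ (∀ n, Continuous fun t => X n t ω) ∧
    ∀ n, X n (tInit hT) ω = 0} with hG
  have hGae : ∀ᵐ ω ∂P, ω ∈ G := by
    filter_upwards [ae_lt_top_of_condNorm hm hp hDsm hDfin, ae_all_iff.2 hc, ae_all_iff.2 h0]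
      with ω h1 h2 h3 using ⟨h1.ne, h2, h3⟩
  have hGm : ∀ t, MeasurableSet[F t] G := fun t => by
    rw [← compl_compl G]
    exact (hF.measurableSet_of_null (by exact hGae) t).compl
  set X' : Time T → Ω → Vec d := fun t ω =>
    if ω ∈ G then limUnder atTop (fun n => X n t ω) else 0 with hX'
  have hstep : ∀ ω t n, edist (X n t ω) (X n.succ t ω) ≤ D n ω := fun ω t n => by
    rw [edist_eq_enorm_sub]
    exact enorm_le_supNorm (fun t ω => X n t ω - X (n + 1) t ω) (le_tEnd hT t) ω
  have hlim : ∀ ω ∈ G, ∀ t, Tendsto (fun n => X n t ω) atTop (𝓝 (X' t ω)) := fun ω hω t => by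
    simp only [hX', if_pos hω]
    exact (cauchySeq_of_edist_le_of_tsum_ne_top _ (hstep ω t) hω.1).tendsto_limUnder
  have hdist : ∀ ω ∈ G, ∀ t n, ‖X n t ω - X' t ω‖ₑ ≤ ∑' k, D (n + k) ω := fun ω hω t n => by
    rw [← edist_eq_enorm_sub]
    exact edist_le_tsum_of_edist_le_of_tendsto _ (hstep ω t) (hlim ω hω t) n
  have hcont : ∀ ω, Continuous fun t => X' t ω := fun ω => by
    by_cases hω : ω ∈ G
    · have hu : TendstoUniformly (fun n t => X n t ω) (fun t => X' t ω) atTop := by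
        rw [EMetric.tendstoUniformly_iff]
        intro ε hε
        filter_upwards [(ENNReal.tendsto_sum_nat_add _ hω.1).eventually (gt_mem_nhds hε)]
          with n hn t
        rw [edist_comm, edist_eq_enorm_sub]
        refine (hdist ω hω t n).trans_lt ?_
        simpa only [add_comm n] using hn
      exact hu.continuous (Frequently.of_forall fun n => hω.2.1 n)
    · simp only [hX', if_neg hω]
      exact continuous_const
  have hsup : ∀ ω ∈ G, ∀ n, supNorm (fun t ω => X n t ω - X' t ω) (tEnd hT) ω ≤
      ∑' k, D (n + k) ω := fun ω hω n => iSup₂_le fun t _ => hdist ω hω t n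
  refine ⟨X', memS_of_supNorm_le hp (isRCLL_of_continuous hcont) (fun t => ?_)
    (measurable_supNorm_of_adapted hT (hX 0).rcll (hX 0).adapted (tEnd hT)) hDsm ?_
    (hX 0).norm_lt_top hDfin, ?_, fun n => ?_⟩
  · have h1 : ∀ n, StronglyMeasurable[F t] (G.indicator (X n t)) := fun n => by
      have : Measurable[F t] (X n t) := (hX n).adapted t
      exact this.stronglyMeasurable.indicator (hGm t)
    refine (stronglyMeasurable_of_tendsto (f := fun n => G.indicator (X n t)) (g := X' t) atTop h1
      (tendsto_pi_nhds.2 fun ω => ?_)).measurable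
    by_cases hω : ω ∈ G
    · simpa only [indicator_of_mem hω] using hlim ω hω t
    · simp only [indicator_of_notMem hω, hX', if_neg hω]
      exact tendsto_const_nhds
  · filter_upwards [hGae] with ω hω
    -- `X' = X 0 - (X 0 - X')`, where the second term is dominated by the whole series.
    have e : supNorm X' (tEnd hT) ω =
        supNorm (fun t ω => X 0 t ω - (X 0 t ω - X' t ω)) (tEnd hT) ω :=
      supNorm_congr (fun t => by rw [sub_sub_cancel]) _
    rw [e]
    refine (supNorm_sub_le _ _ _ _).trans (add_le_add le_rfl ?_)
    simpa only [zero_add] using hsup ω hω 0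
  · filter_upwards [hGae] with ω hω
    refine tendsto_nhds_unique (hlim ω hω _) ?_
    simp only [hω.2.2]
    exact tendsto_const_nhds
  · have h1 : supNorm (fun t ω => X n t ω - X' t ω) (tEnd hT) ≤ᵐ[P] fun ω => ∑' k, D (n + k) ω := by
      filter_upwards [hGae] with ω hω using hsup ω hω n
    filter_upwards [condNorm_mono hm hp h1, hDn n] with ω h2 h3
    exact h2.trans h3

end Limit

/-! ### Geometric convergence, existence and uniqueness -/

section Existence

variable {Ω : Type*} [mΩ : MeasurableSpace Ω] {P : Measure Ω} [IsProbabilityMeasure P] {T : ℝ}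
  {hT : 0 < T} {F : Filtration (Time T) mΩ} {p : ℝ≥0∞} {d : ℕ} {hp : 1 < p}
  {f : Driver hT F P p d} {C₁ C₂ : Ω → ℝ} {ξ : Ω → Vec d}

theorem Iic_tEnd (hT : 0 < T) : (Iic (tEnd hT) : Set (Time T)) = univ :=
  eq_univ_of_forall fun t => le_tEnd hT t

/-- Two sequences of Picard iterates approach each other geometrically. -/
theorem exists_geometric_bound (hf : DriverRegular hT F P hp f)
    (hC₁ : Measurable[F (tInit hT)] C₁) (hC₂ : Measurable[F (tInit hT)] C₂)
    (hpos : ∀ᵐ ω ∂P, 0 < C₁ ω) (hnonneg : ∀ᵐ ω ∂P, 0 ≤ C₂ ω)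
    (hlt : ∀ᵐ ω ∂P, C₂ ω < cConst p * C₁ ω / (Real.exp (C₁ ω * T) - 1))
    (hlip : DriverLipschitz hT F P f C₁ C₂)
    {Y Y' : ℕ → SpaceS hT F P p d} {M M' : ℕ → SpaceM0 hT F P p d}
    (h : ∀ n, PicardStep f ξ (Y n) (M n) (Y (n + 1)) (M (n + 1)))
    (h' : ∀ n, PicardStep f ξ (Y' n) (M' n) (Y' (n + 1)) (M' (n + 1)))
    (h0 : ∀ᵐ ω ∂P, (Y 0).1 (tEnd hT) ω = ξ ω) (h0' : ∀ᵐ ω ∂P, (Y' 0).1 (tEnd hT) ω = ξ ω) :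
    ∃ g : ℕ → Ω → ℝ≥0∞, (∀ n, Measurable[F (tInit hT)] (g n)) ∧
      (∀ᵐ ω ∂P, ∑' n, g n ω < ∞) ∧ ∀ n, condSupNorm hT F P p (fun t ω =>
        forward hT (Y (n + 1)).1 (M (n + 1)).1 t ω -
          forward hT (Y' (n + 1)).1 (M' (n + 1)).1 t ω) (tEnd hT) ≤ᵐ[P] g n := by
  obtain ⟨hc0, hκ1⟩ := cConst_mul_lt_one hp
  have hm : 0 ≤ 2 + doobConst p := by
    have := doobConst_nonneg hp
    linarith
  set κ := cConst p * (2 + doobConst p) with hκ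
  have hκ0 : 0 ≤ κ := mul_nonneg hc0 hm
  have hterm : ∀ n, ∀ᵐ ω ∂P, (Y n).1 (tEnd hT) ω = (Y' n).1 (tEnd hT) ω := by
    intro n
    cases n with
    | zero =>
      filter_upwards [h0, h0'] with ω h1 h2
      rw [h1, h2]
    | succ n =>
      filter_upwards [(h n).terminal, (h' n).terminal] with ω h1 h2
      rw [h1, h2]
  set Δ : ℕ → Time T → Ω → Vec d := fun n t ω =>
    forward hT (Y n).1 (M n).1 t ω - forward hT (Y' n).1 (M' n).1 t ω with hΔ
  set K₀ : Ω → ℝ := fun ω => (condSupNorm hT F P p (Δ 0) (tEnd hT) ω).toReal with hK₀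
  have hK₀m : Measurable[F (tInit hT)] K₀ := (measurable_condSupNorm (tEnd hT)).ennreal_toReal
  -- The constant in front of the weight after the first step, by `setLIntegral_const_le_exp`. The
  -- geometric bound therefore starts with the iterates of index `1`.
  set K : Ω → ℝ := fun ω => K₀ ω * (C₁ ω + C₂ ω * (2 + doobConst p)) / C₁ ω with hK
  have hKm : Measurable[F (tInit hT)] K := by
    exact (hK₀m.mul (hC₁.add (hC₂.mul_const _))).div hC₁
  have hK0 : ∀ᵐ ω ∂P, 0 ≤ K ω := by
    filter_upwards [hpos, hnonneg] with ω h1 h2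
    have : 0 ≤ K₀ ω := ENNReal.toReal_nonneg
    simp only [hK]
    positivity
  have hfm : Measurable[F (tInit hT)] fun ω => factor T κ (C₁ ω) := by
    exact ((hC₁.mul_const _).const_mul _).div
      ((Real.measurable_exp.comp (hC₁.mul_const _)).sub_const _) |>.const_sub _
  set g : ℕ → Time T → Ω → ℝ≥0∞ := fun n t ω =>
    ENNReal.ofReal (factor T κ (C₁ ω) ^ n * K ω * (Real.exp (C₁ ω * t) - 1)) with hg
  have hgm : ∀ n, Measurable[Subtype.instMeasurableSpace.prod (F (tInit hT))]
      (Function.uncurry (g n)) := by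
    intro n
    have h1 : Measurable[F (tInit hT)] fun ω => factor T κ (C₁ ω) ^ n * K ω := by
      exact (hfm.pow_const n).mul hKm
    exact ((h1.comp measurable_snd).mul ((Real.measurable_exp.comp ((hC₁.comp measurable_snd).mul
      (measurable_subtype_coe.comp measurable_fst))).sub_const 1)).ennreal_ofReal
  have key : ∀ n t, condSupNorm hT F P p (Δ (n + 1)) t ≤ᵐ[P] g n t := by
    intro n
    induction n with
    | zero =>
      intro t
      have h1 : ∀ s, condSupNorm hT F P p (Δ 0) s ≤ᵐ[P] fun ω => ENNReal.ofReal (K₀ ω) := by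
        intro s
        filter_upwards [condNorm_mono (p := p) (F.le (tInit hT)) hp
          (ae_of_all P fun ω => supNorm_mono (Δ 0) (le_tEnd hT s) ω),
          MemS.sub_norm_lt_top hp (memS_forward hp (Y 0).2 (M 0).2.memS)
            (memS_forward hp (Y' 0).2 (M' 0).2.memS) (tEnd hT)] with ω h2 h3
        rw [hK₀, ENNReal.ofReal_toReal h3.ne]
        exact h2
      have h2 := PicardStep.condSupNorm_sub_le hf hC₁ hC₂ hlip (h 0) (h' 0) (hterm 0)
        (g := fun _ ω => ENNReal.ofReal (K₀ ω)) (by exact hK₀m.ennreal_ofReal.comp measurable_snd)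
        h1 t
      filter_upwards [h2, hpos, hnonneg] with ω h2 h3 h4
      refine h2.trans ((setLIntegral_const_le_exp (K := K₀ ω) h3 h4 hm ENNReal.toReal_nonneg t).trans
        (le_of_eq ?_))
      simp only [hg, pow_zero, one_mul, hK]
    | succ n ih =>
      intro t
      have h2 := PicardStep.condSupNorm_sub_le hf hC₁ hC₂ hlip (h (n + 1)) (h' (n + 1))
        (hterm (n + 1)) (hgm n) ih t
      filter_upwards [h2, hpos, hnonneg, hlt, hK0] with ω h2 h3 h4 h5 h6
      have h7 := factor_mem h3 hT hκ0 hκ1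
      have h8 : C₂ ω * (2 + doobConst p) * (Real.exp (C₁ ω * T) - 1) ≤ κ * C₁ ω := by
        rw [lt_div_iff₀ (exp_sub_one_pos h3 hT)] at h5
        calc C₂ ω * (2 + doobConst p) * (Real.exp (C₁ ω * T) - 1)
            = C₂ ω * (Real.exp (C₁ ω * T) - 1) * (2 + doobConst p) := by ring
          _ ≤ cConst p * C₁ ω * (2 + doobConst p) := mul_le_mul_of_nonneg_right h5.le hm
          _ = κ * C₁ ω := by rw [hκ]; ring
      have h9 := setLIntegral_exp_le_factor_mul h3 hT hκ1.le h4 hm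
        (mul_nonneg (pow_nonneg h7.1 n) h6) h8 t
      have h10 : factor T κ (C₁ ω) * (factor T κ (C₁ ω) ^ n * K ω) =
          factor T κ (C₁ ω) ^ (n + 1) * K ω := by ring
      rw [h10] at h9
      exact h2.trans h9
  refine ⟨fun n => g n (tEnd hT), fun n => ?_, ?_, fun n => key n _⟩
  · exact measurable_of_uncurry (hgm n) (tEnd hT)
  · filter_upwards [hpos] with ω h1
    -- The factor depends on `ω`, and being below `1` pointwise is enough for summability.
    have h2 := factor_mem h1 hT hκ0 hκ1
    exact (((summable_geometric_of_lt_one h2.1 h2.2).mul_right _).mul_right _).tsum_ofReal_lt_top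

theorem forall_eq_of_condSupNorm_le (hp : 1 < p) {X X' : Time T → Ω → Vec d}
    (hX : MemS hT F P p X) (hX' : MemS hT F P p X')
    (h : condSupNorm hT F P p (fun t ω => X t ω - X' t ω) (tEnd hT) ≤ᵐ[P] 0) :
    ∀ᵐ ω ∂P, ∀ t, X t ω = X' t ω := by
  have hsm : Measurable (supNorm (fun t ω => X t ω - X' t ω) (tEnd hT)) :=
    measurable_supNorm hT (hX.rcll.sub hX'.rcll)
      (fun t => hX.adapted.measurable.sub hX'.adapted.measurable) _
  filter_upwards [ae_eq_zero_of_condNorm (F.le (tInit hT)) hp hsm h] with ω hω t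
  have := enorm_le_supNorm (fun t ω => X t ω - X' t ω) (le_tEnd hT t) ω
  rw [hω, nonpos_iff_eq_zero, enorm_eq_zero, sub_eq_zero] at this
  exact this

theorem PicardStep.isSolution {Ω : Type*} [mΩ : MeasurableSpace Ω] {P : Measure Ω}
    {F : Filtration (Time T) mΩ} {f : Driver hT F P p d} {ξ : Ω → Vec d} {Y : SpaceS hT F P p d}
    {M : SpaceM0 hT F P p d} (h : PicardStep f ξ Y M Y M) : IsSolution hT F P f ξ Y M := by
  refine ⟨h.integrable, fun t => ?_⟩
  filter_upwards [h.terminal, h.integrable, h.forward_eq] with ω h1 h2 h3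
  have hd := drift_of_integrable (φ := fun s ω => f s ω Y M) h2
  have h4 := h3 t
  have h5 := h3 (tEnd hT)
  rw [hd] at h4 h5
  rw [Iic_tEnd, Measure.restrict_univ, ← integral_add_compl (measurableSet_Iic (a := t)) h2,
    compl_Iic] at h5
  simp only [forward, h1] at h4 h5
  have h6 : Y.1 t ω = (Y.1 t ω - Y.1 (tInit hT) ω + M.1 t ω) + Y.1 (tInit hT) ω - M.1 t ω := by
    abel
  have h7 : Y.1 (tInit hT) ω = ξ ω + M.1 (tEnd hT) ω -
      (ξ ω - Y.1 (tInit hT) ω + M.1 (tEnd hT) ω) := by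
    abel
  rw [h5] at h7
  rw [h6, h4, h7]
  abel

/-- Time `T` gives the terminal value. Subtracting the equation at `0` from the one at `t`
identifies the forward process for each fixed `t`, and regular paths make this simultaneous in `t`.
-/
theorem IsSolution.picardStep (hp : 1 < p) {Y : SpaceS hT F P p d} {M : SpaceM0 hT F P p d} (h : IsSolution hT F P f ξ Y M) :
    PicardStep f ξ Y M Y M := by
  have hI : (Ioi (tEnd hT) : Set (Time T)) = ∅ := by
    rw [← compl_Iic, Iic_tEnd, compl_univ]
  refine ⟨?_, h.integrable, ?_⟩
  · filter_upwards [h.eq (tEnd hT)] with ω h1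
    rw [h1, hI]
    simp
  · refine IsRCLL.ae_eq hT (memS_forward hp Y.2 M.2.memS).rcll
      (isRCLL_of_continuous (continuous_drift _)) fun t => ?_
    filter_upwards [h.integrable, h.eq t, h.eq (tInit hT), M.2.init] with ω h1 h2 h3 h4
    have h5 : drift (fun s ω => f s ω Y M) (tInit hT) ω = 0 := drift_tInit hT _ ω
    have hd := drift_of_integrable (φ := fun s ω => f s ω Y M) h1
    rw [hd, neg_eq_zero] at h5
    have h6 := integral_add_compl (measurableSet_Iic (a := t)) h1
    rw [← integral_add_compl (measurableSet_Iic (a := tInit hT)) h1, h5, zero_add, compl_Iic,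
      compl_Iic] at h6
    rw [hd, forward, h2, h3, h4, ← h6]
    simp only [Pi.zero_apply]
    abel

/-- Constant sequences of fixed points satisfy the geometric bound, so the norm of the difference of
the forward processes is below every term of a null sequence. Stability then identifies `Y_0` and
`M`, hence `Y`. -/
theorem PicardStep.unique (hf : DriverRegular hT F P hp f)
    (hC₁ : Measurable[F (tInit hT)] C₁) (hC₂ : Measurable[F (tInit hT)] C₂)
    (hpos : ∀ᵐ ω ∂P, 0 < C₁ ω) (hnonneg : ∀ᵐ ω ∂P, 0 ≤ C₂ ω)
    (hlt : ∀ᵐ ω ∂P, C₂ ω < cConst p * C₁ ω / (Real.exp (C₁ ω * T) - 1))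
    (hlip : DriverLipschitz hT F P f C₁ C₂) {Y Y' : SpaceS hT F P p d} {M M' : SpaceM0 hT F P p d}
    (h : PicardStep f ξ Y M Y M) (h' : PicardStep f ξ Y' M' Y' M') :
    (∀ᵐ ω ∂P, ∀ t, Y.1 t ω = Y'.1 t ω) ∧ ∀ᵐ ω ∂P, ∀ t, M.1 t ω = M'.1 t ω := by
  obtain ⟨g, -, hsum, hg⟩ := exists_geometric_bound hf hC₁ hC₂ hpos hnonneg hlt hlip
    (Y := fun _ => Y) (Y' := fun _ => Y') (M := fun _ => M) (M' := fun _ => M') (fun _ => h)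
    (fun _ => h') h.terminal h'.terminal
  have h0 : condSupNorm hT F P p (fun t ω => forward hT Y.1 M.1 t ω - forward hT Y'.1 M'.1 t ω)
      (tEnd hT) ≤ᵐ[P] 0 := by
    filter_upwards [ae_all_iff.2 hg, hsum] with ω h1 h2
    exact ge_of_tendsto' (ENNReal.tendsto_atTop_zero_of_tsum_ne_top h2.ne) h1
  have hX := forall_eq_of_condSupNorm_le hp (memS_forward hp Y.2 M.2.memS)
    (memS_forward hp Y'.2 M'.2.memS) h0
  have hterm : ∀ᵐ ω ∂P, Y.1 (tEnd hT) ω = Y'.1 (tEnd hT) ω := by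
    filter_upwards [h.terminal, h'.terminal] with ω h1 h2
    rw [h1, h2]
  have hB := enorm_sub_le_of_terminal_eq hp hterm (@measurable_const _ _ _ (F (tInit hT)) 0) h0
  have hM := forall_eq_of_condSupNorm_le hp M.2.memS M'.2.memS (by
    filter_upwards [hB] with ω hω
    refine le_trans (le_add_self) (hω.trans (le_of_eq ?_))
    simp)
  refine ⟨?_, hM⟩
  filter_upwards [hX, hM, hB] with ω h1 h2 h3 t
  have h4 : Y.1 (tInit hT) ω = Y'.1 (tInit hT) ω := by
    have h5 := le_self_add.trans h3
    rw [mul_zero, nonpos_iff_eq_zero, enorm_eq_zero, sub_eq_zero] at h5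
    exact h5
  have h6 := h1 t
  rw [forward, forward, h2 t, h4] at h6
  exact sub_left_injective (add_left_injective _ h6)

theorem exists_picardStep_self (hF : UsualConditions hT F P) (hξ : MemLpCond hT F P p ξ)
    (hf : DriverRegular hT F P hp f)
    (hC₁ : Measurable[F (tInit hT)] C₁) (hC₂ : Measurable[F (tInit hT)] C₂)
    (hpos : ∀ᵐ ω ∂P, 0 < C₁ ω) (hnonneg : ∀ᵐ ω ∂P, 0 ≤ C₂ ω)
    (hlt : ∀ᵐ ω ∂P, C₂ ω < cConst p * C₁ ω / (Real.exp (C₁ ω * T) - 1))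
    (hlip : DriverLipschitz hT F P f C₁ C₂) :
    ∃ (Y : SpaceS hT F P p d) (M : SpaceM0 hT F P p d), PicardStep f ξ Y M Y M := by
  -- The iteration starts from the forward process zero, so that the first pair already has terminal
  -- value `ξ`, as stability requires.
  obtain ⟨Y₀, M₀, hY₀, -⟩ := exists_pair_of_terminal hF hp hξ (memS_zero hT F P hp d)
    (ae_of_all _ fun _ => rfl)
  choose Φ Ψ hΦ using fun q : SpaceS hT F P p d × SpaceM0 hT F P p d =>
    exists_picardStep hF hξ hf hC₁ hC₂ hlip q.1 q.2
  let q : ℕ → SpaceS hT F P p d × SpaceM0 hT F P p d := fun n =>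
    Nat.rec (Y₀, M₀) (fun _ q => (Φ q, Ψ q)) n
  have hq : ∀ n, PicardStep f ξ (q n).1 (q n).2 (q (n + 1)).1 (q (n + 1)).2 := fun n => hΦ (q n)
  obtain ⟨g, hgm, hsum, hg⟩ := exists_geometric_bound hf hC₁ hC₂ hpos hnonneg hlt hlip
    (Y := fun n => (q n).1) (Y' := fun n => (q (n + 1)).1) (M := fun n => (q n).2)
    (M' := fun n => (q (n + 1)).2) hq (fun n => hq (n + 1)) hY₀ (hq 0).terminal
  -- The index is shifted by one: images under the Picard map have almost surely continuous forward
  -- paths starting at zero, and the geometric bound begins there.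
  set X : ℕ → Time T → Ω → Vec d := fun n => forward hT (q (n + 1)).1.1 (q (n + 1)).2.1 with hX
  have hXS : ∀ n, MemS hT F P p (X n) := fun n => memS_forward hp (q (n + 1)).1.2 (q (n + 1)).2.2.memS
  obtain ⟨X', hX'S, hX'0, hX'⟩ := exists_continuous_limit hF hp hXS (fun n => by
      filter_upwards [(hq n).forward_eq] with ω hω
      simp only [hX, hω]
      exact continuous_drift _ ω) (fun n => by
      filter_upwards [(hq n).forward_eq] with ω hω
      simp only [hX, hω]
      exact drift_tInit hT _ ω) hgm hg hsum
  -- Only the forward processes are passed to the limit; the pair is rebuilt from the limit and `ξ`.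
  obtain ⟨Y, M, hY, hYM⟩ := exists_pair_of_terminal hF hp hξ hX'S hX'0
  obtain ⟨Y', M', hstep⟩ := exists_picardStep hF hξ hf hC₁ hC₂ hlip Y M
  refine ⟨Y, M, hY, hstep.integrable, ?_⟩
  set tail : ℕ → Ω → ℝ≥0∞ := fun n ω => ∑' k, g (n + k) ω with htail
  have htm : ∀ n, Measurable[F (tInit hT)] (tail n) := fun n =>
    @Measurable.tsum _ _ _ (F (tInit hT)) _ _ _ _ _ _ _ _ _ _ _ _ fun k => hgm (n + k)
  have htlim : ∀ᵐ ω ∂P, Tendsto (fun n => tail n ω) atTop (𝓝 0) := by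
    filter_upwards [hsum] with ω hω
    have := ENNReal.tendsto_sum_nat_add (fun n => g n ω) hω.ne
    simpa only [htail, add_comm] using this
  have hdist : ∀ n, condSupNorm hT F P p (fun t ω => X n t ω - forward hT Y.1 M.1 t ω) (tEnd hT)
      ≤ᵐ[P] tail n := by
    intro n
    have h1 : supNorm (fun t ω => X n t ω - forward hT Y.1 M.1 t ω) (tEnd hT) ≤ᵐ[P]
        supNorm (fun t ω => X n t ω - X' t ω) (tEnd hT) := by
      filter_upwards [hYM] with ω hω
      refine (supNorm_congr (fun t => ?_) _).le
      rw [forward, hω]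
    filter_upwards [condNorm_mono (p := p) (F.le (tInit hT)) hp h1, hX' n] with ω h2 h3
    exact h2.trans h3
  have hdist' : ∀ n, condSupNorm hT F P p
      (fun t ω => X (n + 1) t ω - forward hT Y'.1 M'.1 t ω) (tEnd hT) ≤ᵐ[P] fun ω =>
      (ENNReal.ofReal (C₁ ω) * tail n ω + ENNReal.ofReal (C₂ ω) *
        (ENNReal.ofReal (2 + doobConst p) * tail n ω)) * timeVol T univ := by
    intro n
    have h1 := PicardStep.condSupNorm_sub_le hf hC₁ hC₂ hlip (hq (n + 1)) hstep (by
      filter_upwards [(hq n).terminal, hY] with ω h1 h2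
      rw [h1, h2]) (g := fun _ => tail n) (by exact (htm n).comp measurable_snd) (fun s => by
      filter_upwards [condNorm_mono (p := p) (F.le (tInit hT)) hp
        (ae_of_all P fun ω => supNorm_mono (fun t ω => X n t ω - forward hT Y.1 M.1 t ω)
          (le_tEnd hT s) ω), hdist n] with ω h2 h3
      exact h2.trans h3) (tEnd hT)
    simpa only [Iic_tEnd, Measure.restrict_univ, lintegral_const] using h1
  have hYS := memS_forward hp Y.2 M.2.memS
  have hYS' := memS_forward hp Y'.2 M'.2.memS
  -- The iterate `X (n + 1)` is close to the limit and, by the one-step estimate, to its Picard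
  -- image. Letting `n` tend to infinity shows that the rebuilt pair and its image share the same
  -- forward process.
  have hfin : condSupNorm hT F P p
      (fun t ω => forward hT Y.1 M.1 t ω - forward hT Y'.1 M'.1 t ω) (tEnd hT) ≤ᵐ[P] 0 := by
    have h1 : ∀ n, condSupNorm hT F P p
        (fun t ω => forward hT Y.1 M.1 t ω - forward hT Y'.1 M'.1 t ω) (tEnd hT) ≤ᵐ[P] fun ω =>
        (ENNReal.ofReal (C₁ ω) * tail n ω + ENNReal.ofReal (C₂ ω) *
          (ENNReal.ofReal (2 + doobConst p) * tail n ω)) * timeVol T univ + tail (n + 1) ω := by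
      intro n
      have h2 := condSupNorm_le_add (hT := hT) (F := F) (P := P) hp
        (W := fun t ω => forward hT Y.1 M.1 t ω - forward hT Y'.1 M'.1 t ω) (t := tEnd hT)
        (measurable_supNorm hT ((hXS (n + 1)).rcll.sub hYS'.rcll)
          (fun t => (hXS (n + 1)).adapted.measurable.sub hYS'.adapted.measurable) (tEnd hT))
        (measurable_supNorm hT ((hXS (n + 1)).rcll.sub hYS.rcll)
          (fun t => (hXS (n + 1)).adapted.measurable.sub hYS.adapted.measurable) (tEnd hT))
        (ae_of_all _ fun ω => by
          refine le_trans (le_of_eq (supNorm_congr (fun t => ?_) _)) (supNorm_sub_le _ _ _ _)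
          simp only [sub_sub_sub_cancel_left])
      filter_upwards [h2, hdist' n, hdist (n + 1)] with ω h2 h3 h4
      exact h2.trans (add_le_add h3 h4)
    filter_upwards [ae_all_iff.2 h1, htlim] with ω h2 h3
    refine ge_of_tendsto' (x := (atTop : Filter ℕ)) ?_ h2
    have h4 := ENNReal.Tendsto.const_mul (a := ENNReal.ofReal (C₁ ω)) h3
      (Or.inr ENNReal.ofReal_ne_top)
    have h5 := ENNReal.Tendsto.const_mul (a := ENNReal.ofReal (C₂ ω))
      (ENNReal.Tendsto.const_mul (a := ENNReal.ofReal (2 + doobConst p)) h3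
        (Or.inr ENNReal.ofReal_ne_top)) (Or.inr ENNReal.ofReal_ne_top)
    have h6 := (ENNReal.Tendsto.mul_const (b := timeVol T univ) (h4.add h5)
      (Or.inr (measure_ne_top _ _))).add (h3.comp (tendsto_add_atTop_nat 1))
    simpa using h6
  filter_upwards [forall_eq_of_condSupNorm_le hp hYS hYS' hfin, hstep.forward_eq] with ω h1 h2 t
  rw [h1, h2]

end Existence

end CondBSDE

theorem proposition5p5 {Ω : Type*} [mΩ : MeasurableSpace Ω] (P : Measure Ω)
    [IsProbabilityMeasure P] {T : ℝ} (hT : 0 < T) (F : Filtration (CondBSDE.Time T) mΩ)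
    (hF : CondBSDE.UsualConditions hT F P) (d : ℕ) {p : ℝ≥0∞} (hp : 1 < p)
    (ξ : Ω → CondBSDE.Vec d) (hξ : CondBSDE.MemLpCond hT F P p ξ)
    (f : CondBSDE.Driver hT F P p d) (hf : CondBSDE.DriverRegular hT F P hp f)
    (hlip : ∃ C₁ C₂ : Ω → ℝ,
      Measurable[F (CondBSDE.tInit hT)] C₁ ∧ Measurable[F (CondBSDE.tInit hT)] C₂ ∧
      (∀ᵐ ω ∂P, 0 < C₁ ω) ∧ (∀ᵐ ω ∂P, 0 ≤ C₂ ω) ∧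
      (∀ᵐ ω ∂P, C₂ ω < CondBSDE.cConst p * C₁ ω / (Real.exp (C₁ ω * T) - 1)) ∧
      CondBSDE.DriverLipschitz hT F P f C₁ C₂) :
    ∃ (Y : CondBSDE.SpaceS hT F P p d) (M : CondBSDE.SpaceM0 hT F P p d),
      CondBSDE.IsSolution hT F P f ξ Y M ∧
      ∀ (Y' : CondBSDE.SpaceS hT F P p d) (M' : CondBSDE.SpaceM0 hT F P p d),
        CondBSDE.IsSolution hT F P f ξ Y' M' →
          CondBSDE.StochEquiv P Y'.1 Y.1 ∧ CondBSDE.StochEquiv P M'.1 M.1 := by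
  obtain ⟨C₁, C₂, hC₁, hC₂, hpos, hnonneg, hlt, hlip⟩ := hlip
  obtain ⟨Y, M, h⟩ := CondBSDE.exists_picardStep_self hF hξ hf hC₁ hC₂ hpos hnonneg hlt hlip
  refine ⟨Y, M, h.isSolution, fun Y' M' h' => ?_⟩
  obtain ⟨h1, h2⟩ := (h'.picardStep hp).unique hf hC₁ hC₂ hpos hnonneg hlt hlip h
  refine ⟨fun t => ?_, fun t => ?_⟩
  · filter_upwards [h1] with ω hω using hω t
  · filter_upwards [h2] with ω hω using hω t
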